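/- Let $k$ be a field of characteristic $0$ and $H$ a finite-dimensional symplectic vector space over $k$ with symplectic form $\langle\cdot,\cdot\rangle$ (for instance $H=H_1(\Sigma_{g,1};k)$). Let $\mathsf L(H)=\bigoplus_n \mathsf L_n(H)$ be the free Lie algebra on $H$, graded by bracket length. *Definitions.* - $\mathsf D_s(H)=\ker\big(H\otimes \mathsf L_{s+1}(H)\to \mathsf L_{s+2}(H)\big)$, the kernel of the bracketing map. - $\mathcal T(H)$ is the space of unitrivalent trees with cyclically ordered trivalent vertices and univalent vertices labelled by elements of $H$, modulo AS, IHX and multilinearity; $\mathcal T_s(H)$ is the part with $s$ trivalent vertices. The map $\eta(t)=\sum_x \ell(x)\otimes t_x$ sums over the univalent vertices $x$ of $t$, where $\ell(x)$ is the label of $x$ and $t_x\in\mathsf L_{s+1}(H)$ is represented by the tree rooted at $x$; a vertex with cyclic order (root, $a$, $b$) stands for $[a,b]$. - On $H^{\otimes s}$, the group $\mathbb Z_s$ acts by cyclic rotation, and the dihedral group $D_{2s}$ acts by rotations together with $b(v_1\otimes\cdots\otimes v_s)=(-1)^{s+1}v_s\otimes\cdots\otimes v_1$. Write $[H^{\otimes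 s}]_G$ for coinvariants. The map $b$ induces an involution of $[H^{\otimes s}]_{\mathbb Z_s}$, also denoted $b$. Here $[H^{\otimes s}]_G$ means the quotient of $H^{\otimes s}$ by all $ax-x$ with $a$ the rotation and, for $D_{2s}$, also all $bx-x$; this makes sense for $s=0$ too. - The Enomoto–Satoh trace $\mathrm{Tr}^{\mathrm{ES}}\colon \mathsf D_s(H)\to[H^{\otimes s}]_{\mathbb Z_s}$ is the composition of $\mathsf D_s(H)\subset H\otimes\mathsf L_{s+1}(H)\to H\otimes H^{\otimes(s+1)}$, the contraction of the first two factors, $v\otimes v_0\otimes v_1\otimes\cdots\otimes v_s\mapsto\langle v,v_0\rangle\, v_1\otimes\cdots\otimes v_s$, and the projection to coinvariants. - $C_k\mathscr H(H)$ is spanned by hairy graphs: $k$ unitrivalent trees with cyclically ordered trivalent vertices, numbered $1,\dots,k$, some pairs of whose univalent vertices are joined by directed external edges, the remaining univalent vertices (hairs) being labelled by $H$. The relations are AS and IHX within trees, multilinearity on hairs, a sign for switching the direction of an external edge, and the sign of the permutation for renumbering trees. The map $\partial\colon C_2\mathscr H(H)\to C_1\mathscr H(H)$ sums over the external edges between the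 two trees, joining the trees along the edge, with sign $+1$ if the edge is directed from tree $1$ to tree $2$ and $-1$ otherwise. - $S_2\subset C_2\mathscr H(H)$ is spanned by the graphs that consist of a tripod and another tree (which may have external edges joining it to itself), such that two or three legs of the tripod are joined to the other tree, or two legs of the tripod are joined to each other and the third one is joined to the other tree. Let $\iota\colon\mathcal T(H)\to C_1\mathscr H(H)$ be the inclusion as graphs without external edges, and put $\Omega(H)=C_1\mathscr H(H)/(\partial S_2+\iota\mathcal T(H))$. With $C_{1,r,s}$ and $S_{2,r,s}$ the parts spanned by graphs with $s$ hairs and first Betti number $r$, put $\Omega_{s,r}(H)=C_{1,r,s}\mathscr H(H)/\partial S_{2,r,s}$; there is a natural projection $\Omega(H)\to\Omega_{s,r}(H)$ for $r\ge1$. - $\mathrm{Tr}^{\mathrm C}\colon\mathcal T(H)\to\Omega(H)$ is $\exp(T)\circ\iota$ followed by the projection to $\Omega(H)$. The operator $T$ sums over all unordered pairs of hairs, joining the two hairs by a new external edge, directed from a hair labelled $v$ to a hair labelled $w$, and multiplying by $\langle v,w\rangle$; the choice of direction is immaterial. **Theorem.** 1. For every $s\ge 0$ and every $d\in\mathsf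 D_s(H)$, $b\,\mathrm{Tr}^{\mathrm{ES}}(d)=\mathrm{Tr}^{\mathrm{ES}}(d)$ in $[H^{\otimes s}]_{\mathbb Z_s}$. Moreover, the natural projection $[H^{\otimes s}]_{\mathbb Z_s}\to[H^{\otimes s}]_{D_{2s}}$ restricts to a bijection from the subspace of $b$-invariant elements onto $[H^{\otimes s}]_{D_{2s}}$. So, without loss of information, $\mathrm{Tr}^{\mathrm{ES}}$ takes values in $[H^{\otimes s}]_{D_{2s}}$. 2. For every $s\ge 0$, $\eta$ restricts to an isomorphism $\mathcal T_s(H)\to\mathsf D_s(H)$. For every $s\geq 2$ there is an isomorphism $\Phi\colon\Omega_{s,1}(H)\to[H^{\otimes s}]_{D_{2s}}$ that sends, for all $v_1,\dots,v_s\in H$, the loop with hairs $v_1,\dots,v_s$ to the class of $v_1\otimes\cdots\otimes v_s$, and for all $t\in\mathcal T_s(H)$ $$\Phi\big(\mathrm{pr}_{s,1}\,\mathrm{Tr}^{\mathrm C}(t)\big)=\tfrac12\,\mathrm{Tr}^{\mathrm{ES}}(\eta(t))\quad\text{in } [H^{\otimes s}]_{D_{2s}},$$ where $\mathrm{pr}_{s,1}\colon\Omega(H)\to\Omega_{s,1}(H)$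 is the projection. Here the loop with hairs $v_1,\dots,v_s$ is the rooted tree $[\cdots[[\bullet,v_1],v_2],\cdots,v_s]$ with an external edge directed from its root to the leaf $\bullet$. -/

import Mathlib

open scoped TensorProduct


noncomputable section

namespace Johnson

universe u v

/-! ### Unitrivalent trees

A planar binary rooted tree with leaves labelled by `X` is an element of `FreeMagma X`.  A
unitrivalent tree with a cyclic order at each trivalent vertex, together with a chosen edge `ε`, is
a pair `(a, b)` of planar rooted trees, glued along their roots to form `ε`.  A trivalent vertex
with subtrees `a`, `b` above it and root below it carries the cyclic order (root, `a`, `b`).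
Changing the chosen edge gives another presentation of the same unitrivalent tree. -/

/-- Unitrivalent trees with cyclic orders at the vertices and leaves labelled by `X`, presented by
cutting one of the edges. -/
abbrev UTree (X : Type v) := FreeMagma X × FreeMagma X

section Trees

variable {X : Type v}

/-- The leaves of a rooted tree. -/
def leavesR : FreeMagma X → List X
  | .of x => [x]
  | .mul a b => leavesR a ++ leavesR b

/-- The number of trivalent vertices of a rooted tree. -/
def nodesR : FreeMagma X → ℕ
  | .of _ => 0
  | .mul a b => nodesR a + nodesR b + 1

/-- The univalent vertices of a unitrivalent tree. -/
def leaves (t : UTree X) : List X := leavesR t.1 ++ leavesR t.2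

/-- The number of trivalent vertices of a unitrivalent tree. -/
def trivalent (t : UTree X) : ℕ := nodesR t.1 + nodesR t.2

/-- For every leaf `x` of `a`, the pair of `x` and the rooted tree obtained from the unitrivalent
tree `(a, c)` by removing the label from `x` and regarding `x` as the root. -/
def rootingsR : FreeMagma X → FreeMagma X → List (X × FreeMagma X)
  | .of x, c => [(x, c)]
  | .mul a b, c => rootingsR a (b * c) ++ rootingsR b (c * a)

/-- For every univalent vertex `x` of `t`, the pair of the label `ℓ(x)` and the rooted tree `t_x`
obtained by removing the label from `x` and regarding `x` as the root. -/
def rootings (t : UTree X) : List (X × FreeMagma X) := rootingsR t.1 t.2 ++ rootingsR t.2 t.1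

@[simp] theorem leavesR_of (x : X) : leavesR (.of x) = [x] := rfl
@[simp] theorem leavesR_mul (a b : FreeMagma X) : leavesR (a * b) = leavesR a ++ leavesR b := rfl
@[simp] theorem nodesR_of (x : X) : nodesR (.of x) = 0 := rfl
@[simp] theorem nodesR_mul (a b : FreeMagma X) : nodesR (a * b) = nodesR a + nodesR b + 1 := rfl
@[simp] theorem rootingsR_of (x : X) (c : FreeMagma X) : rootingsR (.of x) c = [(x, c)] := rfl
@[simp] theorem rootingsR_mul (a b c : FreeMagma X) :
    rootingsR (a * b) c = rootingsR a (b * c) ++ rootingsR b (c * a) := rfl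

theorem leavesR_length (a : FreeMagma X) : (leavesR a).length = nodesR a + 1 := by
  induction a with
  | ih1 x => simp
  | ih2 a b ha hb => simp [ha, hb]; omega

theorem rootingsR_perm (a c : FreeMagma X) (p : X × FreeMagma X) (hp : p ∈ rootingsR a c) :
    (p.1 :: leavesR p.2).Perm (leavesR a ++ leavesR c) := by
  induction a generalizing c with
  | ih1 x => simp only [rootingsR_of, List.mem_singleton] at hp; subst hp; simp
  | ih2 a b ha hb =>
    simp only [rootingsR_mul, List.mem_append] at hp
    rcases hp with hp | hp
    · simpa using ha _ hp
    · refine (hb _ hp).trans ?_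
      simp only [leavesR_mul]
      rw [← List.append_assoc]
      exact List.perm_append_comm.trans (by simp)

theorem rootings_perm (t : UTree X) (p : X × FreeMagma X) (hp : p ∈ rootings t) :
    (p.1 :: leavesR p.2).Perm (leaves t) := by
  simp only [rootings, List.mem_append] at hp
  rcases hp with hp | hp
  · exact rootingsR_perm _ _ _ hp
  · exact (rootingsR_perm _ _ _ hp).trans List.perm_append_comm

theorem rootings_nodes (t : UTree X) (p : X × FreeMagma X) (hp : p ∈ rootings t) :
    nodesR p.2 = trivalent t := by
  have h := (rootings_perm t p hp).length_eq
  simp only [List.length_cons, leavesR_length, leaves, List.length_append] at h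
  simp only [trivalent]
  omega

end Trees

variable (k : Type u) [Field k]

/-- The relations between labelled unitrivalent trees.  The labels in the image of `lab` come from
a vector space.  The first two constructors identify the presentations of one tree obtained by
cutting different edges; then come AS, IHX and multilinearity.  As every edge of a tree can be made
the chosen one, it is enough to impose the last three next to the chosen edge. -/
inductive TreeRel {H : Type v} [AddCommGroup H] [Module k H] {X : Type v} (lab : H → X) :
    (UTree X →₀ k) → Prop
  | flip (a b : FreeMagma X) :
      TreeRel lab (Finsupp.single (a, b) 1 - Finsupp.single (b, a) 1)
  | move (a b c : FreeMagma X) :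
      TreeRel lab (Finsupp.single (a * b, c) 1 - Finsupp.single (a, b * c) 1)
  | antisymm (a b c : FreeMagma X) :
      TreeRel lab (Finsupp.single (a, b * c) 1 + Finsupp.single (a, c * b) 1)
  | ihx (a b c d : FreeMagma X) :
      TreeRel lab (Finsupp.single (a, b * c * d) 1 + Finsupp.single (a, c * d * b) 1
        + Finsupp.single (a, d * b * c) 1)
  | multilinear (r : k) (v w : H) (a : FreeMagma X) :
      TreeRel lab (Finsupp.single (.of (lab (r • v + w)), a) 1
        - r • Finsupp.single (.of (lab v), a) 1 - Finsupp.single (.of (lab w), a) 1)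

/-- The vector space of unitrivalent trees with leaves labelled by `X`, modulo AS, IHX and
multilinearity in the labels coming from the vector space `H`. -/
abbrev TreeSpace {H : Type v} [AddCommGroup H] [Module k H] {X : Type v} (lab : H → X) :=
  (UTree X →₀ k) ⧸ Submodule.span k {x | TreeRel k lab x}

/-- The class of a tree. -/
def treeMk {H : Type v} [AddCommGroup H] [Module k H] {X : Type v} (lab : H → X) (t : UTree X) :
    TreeSpace k lab :=
  Submodule.mkQ _ (Finsupp.single t 1)

section TreeSpace

variable {H : Type v} [AddCommGroup H] [Module k H] {X : Type v} (lab : H → X)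

theorem treeMk_flip (a b : FreeMagma X) : treeMk k lab (a, b) = treeMk k lab (b, a) :=
  (Submodule.Quotient.eq (Submodule.span k {x | TreeRel k lab x})).2
    (Submodule.subset_span (TreeRel.flip a b))

theorem treeMk_move (a b c : FreeMagma X) :
    treeMk k lab (a * b, c) = treeMk k lab (a, b * c) :=
  (Submodule.Quotient.eq (Submodule.span k {x | TreeRel k lab x})).2
    (Submodule.subset_span (TreeRel.move a b c))

theorem treeMk_antisymm (a b c : FreeMagma X) :
    treeMk k lab (a, b * c) + treeMk k lab (a, c * b) = 0 := by
  have := (Submodule.Quotient.mk_eq_zero (Submodule.span k {x | TreeRel k lab x})).2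
    (Submodule.subset_span (TreeRel.antisymm a b c))
  simpa [treeMk] using this

theorem treeMk_ihx (a b c d : FreeMagma X) :
    treeMk k lab (a, b * c * d) + treeMk k lab (a, c * d * b) + treeMk k lab (a, d * b * c)
      = 0 := by
  have := (Submodule.Quotient.mk_eq_zero (Submodule.span k {x | TreeRel k lab x})).2
    (Submodule.subset_span (TreeRel.ihx a b c d))
  simpa [treeMk] using this

theorem treeMk_linear (r : k) (v w : H) (a : FreeMagma X) :
    treeMk k lab (.of (lab (r • v + w)), a)
      = r • treeMk k lab (.of (lab v), a) + treeMk k lab (.of (lab w), a) := by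
  have := (Submodule.Quotient.mk_eq_zero (Submodule.span k {x | TreeRel k lab x})).2
    (Submodule.subset_span (TreeRel.multilinear r v w a))
  rw [← sub_eq_zero, ← sub_sub]
  exact this

/-- A function on trees that respects the relations extends to a linear map. -/
def treeLift {M : Type*} [AddCommGroup M] [Module k M] (f : UTree X → M)
    (hflip : ∀ a b, f (a, b) = f (b, a))
    (hmove : ∀ a b c, f (a * b, c) = f (a, b * c))
    (hanti : ∀ a b c, f (a, b * c) + f (a, c * b) = 0)
    (hihx : ∀ a b c d, f (a, b * c * d) + f (a, c * d * b) + f (a, d * b * c) = 0)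
    (hlin : ∀ (r : k) v w a, f (.of (lab (r • v + w)), a)
      = r • f (.of (lab v), a) + f (.of (lab w), a)) :
    TreeSpace k lab →ₗ[k] M :=
  Submodule.liftQ _ (Finsupp.linearCombination k f) <| by
    rw [Submodule.span_le]
    rintro _ (⟨a, b⟩ | ⟨a, b, c⟩ | ⟨a, b, c⟩ | ⟨a, b, c, d⟩ | ⟨r, v, w, a⟩)
    · simp [hflip a b]
    · simp [hmove a b c]
    · simpa using hanti a b c
    · simpa using hihx a b c d
    · simp [hlin r v w a]

@[simp] theorem treeLift_mk {M : Type*} [AddCommGroup M] [Module k M] (f : UTree X → M)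
    (h1 h2 h3 h4 h5) (t : UTree X) :
    treeLift k lab f h1 h2 h3 h4 h5 (treeMk k lab t) = f t := by
  simp [treeLift, treeMk]

theorem treeSpace_ext {M : Type*} [AddCommGroup M] [Module k M] {f g : TreeSpace k lab →ₗ[k] M}
    (h : ∀ t, f (treeMk k lab t) = g (treeMk k lab t)) : f = g := by
  apply Submodule.linearMap_qext
  ext t
  simpa [treeMk] using h t

theorem span_treeMk (x : TreeSpace k lab) :
    x ∈ Submodule.span k (Set.range (treeMk k lab)) := by
  obtain ⟨x, rfl⟩ := Submodule.mkQ_surjective _ x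
  induction x using Finsupp.induction_linear with
  | zero => simp
  | add f g hf hg => rw [map_add]; exact add_mem hf hg
  | single t r =>
    rw [← mul_one r, ← smul_eq_mul, ← Finsupp.smul_single, map_smul]
    exact Submodule.smul_mem _ _ (Submodule.subset_span ⟨t, rfl⟩)

end TreeSpace

variable (H : Type v) [AddCommGroup H] [Module k H]

/-- `𝒯(H)`: unitrivalent trees labelled by elements of `H`, modulo AS, IHX, multilinearity. -/
abbrev T := TreeSpace k (id : H → H)

/-- `𝒯_s(H)`: the part of `𝒯(H)` with `s` trivalent vertices. -/
def TDeg (s : ℕ) : Submodule k (T k H) :=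
  Submodule.span k {x | ∃ t : UTree H, trivalent t = s ∧ x = treeMk k id t}

/-! ### The free Lie algebra and `D_s(H)` -/

/-- The ideal of the free Lie algebra on the set `H` that makes the generators linear in `H`. -/
def linIdeal : LieIdeal k (FreeLieAlgebra k H) :=
  LieSubmodule.lieSpan k (FreeLieAlgebra k H)
    {x | ∃ (r : k) (v w : H), x = FreeLieAlgebra.of k (r • v + w)
      - (r • FreeLieAlgebra.of k v + FreeLieAlgebra.of k w)}

/-- The free Lie algebra on the vector space `H`. -/
abbrev L := FreeLieAlgebra k H ⧸ linIdeal k H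

/-- The inclusion of the generators. -/
def L.ι : H →ₗ[k] L k H where
  toFun v := LieSubmodule.Quotient.mk (FreeLieAlgebra.of k v)
  map_add' v w := by
    have : FreeLieAlgebra.of k ((1 : k) • v + w)
      - ((1 : k) • FreeLieAlgebra.of k v + FreeLieAlgebra.of k w) ∈ linIdeal k H :=
      LieSubmodule.subset_lieSpan ⟨1, v, w, rfl⟩
    rw [one_smul, one_smul] at this
    exact (Submodule.Quotient.eq _).2 this
  map_smul' r v := by
    have h0 : FreeLieAlgebra.of k ((0 : k) • v + (0 : H))
      - ((0 : k) • FreeLieAlgebra.of k v + FreeLieAlgebra.of k (0 : H)) ∈ linIdeal k H :=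
      LieSubmodule.subset_lieSpan ⟨0, v, 0, rfl⟩
    have h1 : FreeLieAlgebra.of k ((-1 : k) • (0 : H) + (0 : H))
      - ((-1 : k) • FreeLieAlgebra.of k 0 + FreeLieAlgebra.of k (0 : H)) ∈ linIdeal k H :=
      LieSubmodule.subset_lieSpan ⟨-1, 0, 0, rfl⟩
    have h2 : FreeLieAlgebra.of k (r • v + (0 : H))
      - (r • FreeLieAlgebra.of k v + FreeLieAlgebra.of k (0 : H)) ∈ linIdeal k H :=
      LieSubmodule.subset_lieSpan ⟨r, v, 0, rfl⟩
    simp only [smul_zero, add_zero, neg_smul, one_smul, neg_add_cancel, sub_zero] at h1 h2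
    refine (Submodule.Quotient.eq _).2 ?_
    have := add_mem h2 h1
    simpa [sub_add_eq_sub_sub] using this

variable {H} in
/-- The iterated bracket represented by a rooted tree: a trivalent vertex with cyclic order
(root, `a`, `b`) stands for `⁅a, b⁆`. -/
def lieOf : FreeMagma H → L k H
  | .of v => L.ι k H v
  | .mul a b => ⁅lieOf a, lieOf b⁆

variable {H} in
@[simp] theorem lieOf_of (v : H) : lieOf k (.of v) = L.ι k H v := rfl
variable {H} in
@[simp] theorem lieOf_mul (a b : FreeMagma H) : lieOf k (a * b) = ⁅lieOf k a, lieOf k b⁆ := rfl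

/-- `L_n(H)`: the degree `n` part of the free Lie algebra, spanned by all iterated brackets of `n`
elements of `H`. -/
def LDeg (n : ℕ) : Submodule k (L k H) :=
  Submodule.span k {x | ∃ a : FreeMagma H, (leavesR a).length = n ∧ x = lieOf k a}

/-- The bracketing map `H ⊗ L(H) → L(H)`. -/
def bracketing : H ⊗[k] L k H →ₗ[k] L k H :=
  TensorProduct.lift ((LieModule.toEnd k (L k H) (L k H) : L k H →ₗ[k] _) ∘ₗ L.ι k H)

/-- `D_s(H)`: the kernel of the bracketing map on `H ⊗ L_{s+1}(H)`, the latter being regarded as a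
subspace of `H ⊗ L(H)`. -/
def D (s : ℕ) : Submodule k (H ⊗[k] L k H) :=
  LinearMap.range ((LDeg k H (s + 1)).subtype.lTensor H) ⊓ LinearMap.ker (bracketing k H)

@[simp] theorem bracketing_tmul (v : H) (x : L k H) :
    bracketing k H (v ⊗ₜ x) = ⁅L.ι k H v, x⁆ := by
  simp [bracketing]

/-! ### The map `η` -/

section Eta

variable {H}

/-- `∑_x ℓ(x) ⊗ t_x`, the sum over all univalent vertices `x` of `t`. -/
def etaTree (t : UTree H) : H ⊗[k] L k H :=
  ((rootings t).map fun p => p.1 ⊗ₜ[k] lieOf k p.2).sum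

/-- Auxiliary: the part of `η (a, c)` coming from the leaves of `a`, as a function of the Lie
element represented by `c`. -/
def etaAux : FreeMagma H → L k H → H ⊗[k] L k H
  | .of v, x => v ⊗ₜ[k] x
  | .mul a b, x => etaAux a ⁅lieOf k b, x⁆ + etaAux b ⁅x, lieOf k a⁆

@[simp] theorem etaAux_of (v : H) (x : L k H) : etaAux k (.of v) x = v ⊗ₜ[k] x := rfl
@[simp] theorem etaAux_mul (a b : FreeMagma H) (x : L k H) : etaAux k (a * b) x =
    etaAux k a ⁅lieOf k b, x⁆ + etaAux k b ⁅x, lieOf k a⁆ := rfl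

theorem etaAux_add (a : FreeMagma H) (x y : L k H) :
    etaAux k a (x + y) = etaAux k a x + etaAux k a y := by
  induction a generalizing x y with
  | ih1 v => simp [TensorProduct.tmul_add]
  | ih2 a b ha hb => simp only [etaAux_mul, lie_add, add_lie, ha, hb]; abel

theorem etaAux_smul (r : k) (a : FreeMagma H) (x : L k H) :
    etaAux k a (r • x) = r • etaAux k a x := by
  induction a generalizing x with
  | ih1 v => simp
  | ih2 a b ha hb => simp only [etaAux_mul, lie_smul, smul_lie, ha, hb, smul_add]

theorem etaAux_zero (a : FreeMagma H) : etaAux k a 0 = 0 := by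
  simpa using etaAux_smul k 0 a 0

theorem etaAux_skew (a : FreeMagma H) (x y : L k H) :
    etaAux k a ⁅x, y⁆ + etaAux k a ⁅y, x⁆ = 0 := by
  rw [← etaAux_add, ← lie_skew, neg_add_cancel, etaAux_zero]

theorem sum_rootingsR (a c : FreeMagma H) :
    ((rootingsR a c).map fun p => p.1 ⊗ₜ[k] lieOf k p.2).sum = etaAux k a (lieOf k c) := by
  induction a generalizing c with
  | ih1 v => simp
  | ih2 a b ha hb => simp [ha, hb]

theorem etaTree_eq (a b : FreeMagma H) :
    etaTree k (a, b) = etaAux k a (lieOf k b) + etaAux k b (lieOf k a) := by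
  simp [etaTree, rootings, sum_rootingsR]

variable (H) in
/-- `η : 𝒯(H) → H ⊗ L(H)`, `η(t) = ∑_x ℓ(x) ⊗ t_x`. -/
def etaLin : T k H →ₗ[k] H ⊗[k] L k H :=
  treeLift k id (etaTree k)
    (fun a b => by rw [etaTree_eq, etaTree_eq, add_comm])
    (fun a b c => by simp only [etaTree_eq, etaAux_mul, lieOf_mul, add_assoc])
    (fun a b c => by
      simp only [etaTree_eq, etaAux_mul, lieOf_mul]
      have := congrArg₂ (· + ·) (etaAux_skew k a (lieOf k b) (lieOf k c)) (congrArg₂ (· + ·)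
        (etaAux_skew k b (lieOf k c) (lieOf k a)) (etaAux_skew k c (lieOf k a) (lieOf k b)))
      simp only [add_zero] at this
      rw [← this]
      abel)
    (fun a b c d => by
      simp only [etaTree_eq, etaAux_mul, lieOf_mul]
      have h0 : ⁅⁅lieOf k b, lieOf k c⁆, lieOf k d⁆ + ⁅⁅lieOf k c, lieOf k d⁆, lieOf k b⁆
        + ⁅⁅lieOf k d, lieOf k b⁆, lieOf k c⁆ = 0 := by
        have := lie_jacobi (lieOf k b) (lieOf k c) (lieOf k d)
        rw [← lie_skew (lieOf k d) ⁅lieOf k b, _⁆, ← lie_skew (lieOf k b) ⁅lieOf k c, _⁆,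
          ← lie_skew (lieOf k c) ⁅lieOf k d, _⁆, ← neg_add, ← neg_add, neg_eq_zero] at this
        rw [← this]; abel
      have key : ∀ x y z : L k H, ⁅x, ⁅y, z⁆⁆ + ⁅z, ⁅x, y⁆⁆ + ⁅⁅x, z⁆, y⁆ = 0 := by
        intro x y z
        rw [← lie_skew ⁅x, z⁆ y, ← lie_skew x z, lie_neg, neg_neg, ← lie_jacobi x y z]
        abel
      have hb := key (lieOf k c) (lieOf k d) (lieOf k a)
      have hc := key (lieOf k d) (lieOf k b) (lieOf k a)
      have hd := key (lieOf k b) (lieOf k c) (lieOf k a)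
      have e0 := congrArg (etaAux k a) h0
      have eb := congrArg (etaAux k b) hb
      have ec := congrArg (etaAux k c) hc
      have ed := congrArg (etaAux k d) hd
      simp only [etaAux_add, etaAux_zero] at e0 eb ec ed
      have := congrArg₂ (· + ·) (congrArg₂ (· + ·) e0 eb) (congrArg₂ (· + ·) ec ed)
      simp only [add_zero] at this
      rw [← this]
      abel)
    (fun r v w a => by
      simp only [etaTree_eq, etaAux_of, lieOf_of, id, map_add, map_smul, etaAux_add, etaAux_smul,
        TensorProduct.add_tmul, TensorProduct.smul_tmul', smul_add]
      abel)

theorem bracketing_etaAux (a : FreeMagma H) (x : L k H) :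
    bracketing k H (etaAux k a x) = ⁅lieOf k a, x⁆ := by
  induction a generalizing x with
  | ih1 v => simp
  | ih2 a b ha hb =>
    simp only [etaAux_mul, map_add, ha, hb, lieOf_mul]
    rw [← lie_skew x, lie_neg, lie_lie]; abel

theorem etaLin_mem (s : ℕ) (x : T k H) (hx : x ∈ TDeg k H s) : etaLin k H x ∈ D k H s := by
  refine (Submodule.span_le (p := (D k H s).comap (etaLin k H))).2 ?_ hx
  rintro _ ⟨t, ht, rfl⟩
  simp only [Submodule.comap_coe, Set.mem_preimage, SetLike.mem_coe, etaLin, treeLift_mk]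
  refine ⟨?_, ?_⟩
  · refine list_sum_mem fun y hy => ?_
    obtain ⟨p, hp, rfl⟩ := List.mem_map.1 hy
    refine ⟨p.1 ⊗ₜ ⟨lieOf k p.2, Submodule.subset_span ⟨p.2, ?_, rfl⟩⟩, by simp⟩
    rw [leavesR_length, rootings_nodes t p hp, ht]
  · rw [SetLike.mem_coe, LinearMap.mem_ker, ← Prod.mk.eta (p := t), etaTree_eq, map_add, bracketing_etaAux,
      bracketing_etaAux, ← lie_skew, neg_add_cancel]

variable (H) in
/-- `η_s : 𝒯_s(H) → D_s(H)`. -/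
def eta (s : ℕ) : TDeg k H s →ₗ[k] D k H s :=
  (etaLin k H).restrict (etaLin_mem k s)

end Eta

/-! ### Cyclic and dihedral coinvariants of `H^{⊗s}` -/

/-- The cyclic rotation `v₁ ⊗ ⋯ ⊗ v_s ↦ v_s ⊗ v₁ ⊗ ⋯ ⊗ v_{s-1}`, a generator of `ℤ_s`. -/
def rot (s : ℕ) : (⨂[k]^s H) ≃ₗ[k] (⨂[k]^s H) := PiTensorProduct.reindex k (fun _ => H) (finRotate s)

/-- The reversal map `b(v₁ ⊗ ⋯ ⊗ v_s) = (-1)^{s+1} v_s ⊗ ⋯ ⊗ v₁`. -/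
def rev (s : ℕ) : (⨂[k]^s H) →ₗ[k] (⨂[k]^s H) :=
  (-1 : k) ^ (s + 1) • (PiTensorProduct.reindex k (fun _ => H) (Fin.revPerm (n := s))).toLinearMap

/-- `[H^{⊗s}]_{ℤ_s}`, where the generator of `ℤ_s` acts by `rot`. -/
abbrev CycCoinv (s : ℕ) :=
  (⨂[k]^s H) ⧸ LinearMap.range ((rot k H s).toLinearMap - LinearMap.id)

/-- `[H^{⊗s}]_{D_{2s}}`, where the two generators of `D_{2s}` act by `rot` and `rev`. -/
abbrev DihCoinv (s : ℕ) :=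
  (⨂[k]^s H) ⧸ (LinearMap.range ((rot k H s).toLinearMap - LinearMap.id) ⊔
    LinearMap.range (rev k H s - LinearMap.id))

theorem rot_rev_rot (s : ℕ) (x : ⨂[k]^s H) : rot k H s (rev k H s (rot k H s x)) = rev k H s x := by
  have key : (rot k H s).toLinearMap ∘ₗ rev k H s ∘ₗ (rot k H s).toLinearMap = rev k H s := by
    ext v
    simp only [rot, rev, LinearMap.compMultilinearMap_apply, LinearMap.comp_apply,
      LinearMap.smul_apply, map_smul, LinearEquiv.coe_coe, PiTensorProduct.reindex_tprod]
    congr 2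
    funext i
    congr 1
    obtain ⟨j, rfl⟩ := (finRotate s).surjective i
    rw [Equiv.symm_apply_apply, Equiv.symm_apply_eq]
    rcases s with _ | s
    · exact j.elim0
    · ext
      simp only [Fin.revPerm_symm, Fin.revPerm_apply, coe_finRotate, Fin.ext_iff, Fin.val_rev,
        Fin.val_last]
      split_ifs <;> omega
  exact LinearMap.congr_fun key x

/-- The involution induced by the reversal map on `[H^{⊗s}]_{ℤ_s}`. -/
def revCyc (s : ℕ) : CycCoinv k H s →ₗ[k] CycCoinv k H s :=
  Submodule.mapQ _ _ (rev k H s) <| by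
    rintro _ ⟨x, rfl⟩
    refine ⟨-rev k H s (rot k H s x), ?_⟩
    simp only [LinearMap.sub_apply, LinearEquiv.coe_coe, map_neg, rot_rev_rot, LinearMap.id_apply,
      map_sub]
    abel

/-- The natural projection `[H^{⊗s}]_{ℤ_s} → [H^{⊗s}]_{D_{2s}}`. -/
def cycToDih (s : ℕ) : CycCoinv k H s →ₗ[k] DihCoinv k H s :=
  Submodule.mapQ _ _ LinearMap.id (by rw [Submodule.comap_id]; exact le_sup_left)

/-! ### The Enomoto–Satoh trace -/

section ES

attribute [local instance] LieRing.ofAssociativeRing LieAlgebra.ofAssociativeAlgebra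

/-- The canonical map from the free Lie algebra to the tensor algebra,
`⁅x, y⁆ ↦ x ⊗ y - y ⊗ x`. -/
def lieToTensor : L k H →ₗ[k] TensorAlgebra k H :=
  Submodule.liftQ (linIdeal k H).toSubmodule
    (FreeLieAlgebra.lift k (TensorAlgebra.ι k : H → TensorAlgebra k H) :
      FreeLieAlgebra k H →ₗ[k] TensorAlgebra k H) <| by
    have : linIdeal k H ≤
        (FreeLieAlgebra.lift k (TensorAlgebra.ι k : H → TensorAlgebra k H)).ker := by
      refine LieSubmodule.lieSpan_le.2 ?_
      rintro _ ⟨r, v, w, rfl⟩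
      simp
    intro x hx
    exact LieHom.mem_ker.1 (this hx)

end ES

/-- The embedding of `L_n(H)` in `H^{⊗n}`, extended by zero to the other degrees. -/
def lieToPower (n : ℕ) : L k H →ₗ[k] ⨂[k]^n H :=
  DirectSum.component k ℕ (fun n => ⨂[k]^n H) n ∘ₗ
    (TensorAlgebra.toDirectSum (R := k) (M := H)).toLinearMap ∘ₗ lieToTensor k H

variable {k H}

/-- Contraction of the first two factors: `v ⊗ (v₀ ⊗ v₁ ⊗ ⋯ ⊗ v_s) ↦ ⟨v, v₀⟩ v₁ ⊗ ⋯ ⊗ v_s`. -/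
def contract (ω : LinearMap.BilinForm k H) (s : ℕ) : H ⊗[k] (⨂[k]^(s + 1) H) →ₗ[k] ⨂[k]^s H :=
  TensorProduct.lift <|
    { toFun := fun v => PiTensorProduct.lift
        (((ω v).smulRight (PiTensorProduct.tprod k (s := fun _ : Fin s => H))).uncurryLeft)
      map_add' := fun v w => by
        ext x
        simp [add_smul]
      map_smul' := fun r v => by
        ext x
        simp [mul_smul] }

/-- The Enomoto–Satoh trace `D_s(H) → [H^{⊗s}]_{ℤ_s}`: embed `D_s(H)` in `H ⊗ H^{⊗(s+1)}`, contract
the first two factors, project to the cyclic coinvariants. -/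
def trES (ω : LinearMap.BilinForm k H) (s : ℕ) : D k H s →ₗ[k] CycCoinv k H s :=
  Submodule.mkQ _ ∘ₗ contract ω s ∘ₗ (lieToPower k H (s + 1)).lTensor H ∘ₗ (D k H s).subtype

/-! ### Hairy graphs

The ends of the external edges are leaves of the trees: `tail e` and `head e` are the two ends of
the external edge named `e`, which is directed from `tail e` to `head e`. -/

/-- The leaves of a hairy graph: hairs labelled by `H`, and ends of external edges. -/
inductive Leaf (H : Type v) : Type v
  | hair (v : H)
  | tail (e : ℕ)
  | head (e : ℕ)

/-- The label of a hair. -/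
def Leaf.hair? : Leaf H → Option H
  | .hair v => some v
  | _ => none

/-- The external edge that starts at a given leaf. -/
def Leaf.tail? : Leaf H → Option ℕ
  | .tail e => some e
  | _ => none

/-- The external edge that ends at a given leaf. -/
def Leaf.head? : Leaf H → Option ℕ
  | .head e => some e
  | _ => none

/-- Among the given leaves, the ends of external edges are matched in pairs: each name of an edge
occurs exactly once as a tail and exactly once as a head, or not at all. -/
def Matched (l : List (Leaf H)) : Prop :=
  (l.filterMap Leaf.tail?).Nodup ∧ (l.filterMap Leaf.head?).Perm (l.filterMap Leaf.tail?)

/-- The number of hairs. -/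
def numHairs (l : List (Leaf H)) : ℕ := (l.filterMap Leaf.hair?).length

/-- The number of external edges (for matched leaves). -/
def numEdges (l : List (Leaf H)) : ℕ := (l.filterMap Leaf.tail?).length

/-- A hairy graph with one tree. -/
def IsHairy (t : UTree (Leaf H)) : Prop := Matched (leaves t)

/-- Relabelling the leaves of a tree. -/
def relabel {X Y : Type v} (f : X → Y) (t : UTree X) : UTree Y :=
  (FreeMagma.map f t.1, FreeMagma.map f t.2)

/-- Renaming of the external edges. -/
def Leaf.rename (f : ℕ → ℕ) : Leaf H → Leaf H
  | .hair v => .hair v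
  | .tail e => .tail (f e)
  | .head e => .head (f e)

/-- Switching the direction of the external edge `e`. -/
def Leaf.switch (e : ℕ) : Leaf H → Leaf H
  | .hair v => .hair v
  | .tail e' => if e' = e then .head e' else .tail e'
  | .head e' => if e' = e then .tail e' else .head e'

variable (k H)

/-- Trees with leaves in `Leaf H`, modulo IHX, AS, and multilinearity on labels of hairs. -/
abbrev PreGraph := TreeSpace k (Leaf.hair : H → Leaf H)

variable {H} in
/-- The class of a tree with leaves in `Leaf H`. -/
def gr (t : UTree (Leaf H)) : PreGraph k H := treeMk k Leaf.hair t

/-- The span of all hairy graphs with one tree, the external edges having names. -/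
def PreC₁ : Submodule k (PreGraph k H) := Submodule.span k {x | ∃ t, IsHairy t ∧ x = gr k t}

/-- The span of all hairy graphs with one tree, `r` external edges and `s` hairs.  A graph formed
by one tree and `r` external edges has first Betti number `r`. -/
def PreC₁Part (s r : ℕ) : Submodule k (PreGraph k H) :=
  Submodule.span k {x | ∃ t, IsHairy t ∧ numEdges (leaves t) = r ∧ numHairs (leaves t) = s ∧
    x = gr k t}

/-- The relations on external edges: switching the direction of an external edge gives a minus
sign, and external edges have no names. -/
def edgeRel : Submodule k (PreGraph k H) :=
  Submodule.span k (
    {x | ∃ t e, IsHairy t ∧ e ∈ (leaves t).filterMap Leaf.tail? ∧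
      x = gr k t + gr k (relabel (Leaf.switch e) t)} ∪
    {x | ∃ t f, IsHairy t ∧ Function.Injective f ∧ x = gr k t - gr k (relabel (Leaf.rename f) t)})

/-- The space `C₁ℋ(H)` of hairy graphs with one tree. -/
abbrev C₁ := PreC₁ k H ⧸ (edgeRel k H).submoduleOf (PreC₁ k H)

variable {k H}

/-! ### The boundary on graphs with two trees and the relators `∂S₂` -/

/-- The leaves of a graph with two trees, numbered in this order. -/
def leaves₂ (Γ : UTree (Leaf H) × UTree (Leaf H)) : List (Leaf H) := leaves Γ.1 ++ leaves Γ.2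

variable (k) in
/-- The sign with which an external edge between a leaf `x` of the first tree and a leaf `y` of the
second tree is contracted: `1` if it is directed from `x` to `y`, `-1` if it is directed from `y` to
`x`, and `0` if the two leaves are not joined by an external edge. -/
def joinSign : Leaf H → Leaf H → k
  | .tail e, .head e' => if e = e' then 1 else 0
  | .head e, .tail e' => if e = e' then -1 else 0
  | _, _ => 0

variable (k) in
/-- The boundary of a hairy graph with two trees: the sum over all external edges between the first
and the second tree of the graphs in which the two trees are joined along this edge to form one
tree. -/
def boundary (Γ : UTree (Leaf H) × UTree (Leaf H)) : PreGraph k H :=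
  ((rootings Γ.1).map fun p =>
    ((rootings Γ.2).map fun q => joinSign k p.1 q.1 • gr k (p.2, q.2)).sum).sum

/-- The leaf `x` is joined by an external edge to a leaf of the tree `t`. -/
def JoinedTo (x : Leaf H) (t : UTree (Leaf H)) : Prop :=
  ∃ e, (x = .tail e ∧ .head e ∈ leaves t) ∨ (x = .head e ∧ .tail e ∈ leaves t)

/-- The graphs that span `S₂`: the first tree is a tripod, and either two or three of its leaves are
joined to the second tree, or two of its leaves are joined to each other and the third one is
joined to the second tree.  The second tree may have external edges joining it to itself.  Rotating
the tripod gives the same graph, and exchanging two of its leaves, switching an edge, or exchanging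
the numbers of the trees only changes the sign, so this list is complete up to sign. -/
inductive IsS₂ : UTree (Leaf H) × UTree (Leaf H) → Prop
  | slide (x y z : Leaf H) (t : UTree (Leaf H)) (hy : JoinedTo y t) (hz : JoinedTo z t)
      (hΓ : Matched (leaves₂ ((.of x, .of y * .of z), t))) : IsS₂ ((.of x, .of y * .of z), t)
  | loop (x : Leaf H) (e : ℕ) (t : UTree (Leaf H)) (hx : JoinedTo x t)
      (hΓ : Matched (leaves₂ ((.of x, .of (.tail e) * .of (.head e)), t))) :
      IsS₂ ((.of x, .of (.tail e) * .of (.head e)), t)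

variable (k H)

/-- `∂S₂`, as a space of representatives. -/
def bdS₂ : Submodule k (PreGraph k H) := Submodule.span k {x | ∃ Γ, IsS₂ Γ ∧ x = boundary k Γ}

/-- `∂S_{2,r,s}`: the boundaries of the graphs in `S₂` with `s` hairs and first Betti number `r`.  A
connected graph formed by two trees and `r + 1` external edges has first Betti number `r`. -/
def bdS₂Part (s r : ℕ) : Submodule k (PreGraph k H) :=
  Submodule.span k {x | ∃ Γ, IsS₂ Γ ∧ numEdges (leaves₂ Γ) = r + 1 ∧ numHairs (leaves₂ Γ) = s ∧
    x = boundary k Γ}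

/-- The inclusion `𝒯(H) → C₁ℋ(H)` of trees as hairy graphs without external edges, as a map to
representatives. -/
def inclT : T k H →ₗ[k] PreGraph k H :=
  treeLift k id (fun t => gr k (relabel Leaf.hair t))
    (fun a b => treeMk_flip k _ _ _)
    (fun a b c => treeMk_move k _ _ _ _)
    (fun a b c => treeMk_antisymm k _ _ _ _)
    (fun a b c d => treeMk_ihx k _ _ _ _ _)
    (fun r v w a => treeMk_linear k _ r v w _)

variable {H} in
theorem inclT_mk (t : UTree H) : inclT k H (treeMk k id t) = gr k (relabel Leaf.hair t) :=
  treeLift_mk k _ _ _ _ _ _ _ t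

/-- The target `Ω(H) = C₁ℋ(H) / (∂S₂ + ι(𝒯(H)))`; the quotient by `edgeRel` that gives `C₁ℋ(H)` is
taken at the same time. -/
abbrev Omega := PreC₁ k H ⧸
  (edgeRel k H ⊔ bdS₂ k H ⊔ LinearMap.range (inclT k H)).submoduleOf (PreC₁ k H)

/-- `Ω_{s,r}(H) = C_{1,r,s}ℋ(H) / ∂S_{2,r,s}`, with `s` hairs and rank `r`. -/
abbrev OmegaPart (s r : ℕ) := PreC₁Part k H s r ⧸
  (edgeRel k H ⊔ bdS₂Part k H s r).submoduleOf (PreC₁Part k H s r)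

section Projection

variable {k H}

theorem leaves_relabel {X Y : Type v} (f : X → Y) (t : UTree X) :
    leaves (relabel f t) = (leaves t).map f := by
  have key : ∀ a : FreeMagma X, leavesR (FreeMagma.map f a) = (leavesR a).map f := by
    intro a
    induction a with
    | ih1 x => simp
    | ih2 a b ha hb => simp [ha, hb]
  simp [leaves, relabel, key]

theorem numHairs_perm {l l' : List (Leaf H)} (h : l.Perm l') : numHairs l = numHairs l' :=
  (h.filterMap _).length_eq

theorem numEdges_perm {l l' : List (Leaf H)} (h : l.Perm l') : numEdges l = numEdges l' :=
  (h.filterMap _).length_eq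

theorem Matched.perm {l l' : List (Leaf H)} (h : l.Perm l') (hl : Matched l) : Matched l' :=
  ⟨(h.filterMap _).nodup_iff.1 hl.1, (h.filterMap _).symm.trans (hl.2.trans (h.filterMap _))⟩

variable (k) in
/-- The part of a tree that has `r` external edges and `s` hairs. -/
def partTree (s r : ℕ) (t : UTree (Leaf H)) : PreGraph k H :=
  if numEdges (leaves t) = r ∧ numHairs (leaves t) = s then gr k t else 0

variable (k H) in
/-- The projection onto the part with `r` external edges and `s` hairs. -/
def prePart (s r : ℕ) : PreGraph k H →ₗ[k] PreGraph k H :=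
  treeLift k Leaf.hair (partTree k s r)
    (fun a b => by
      have h : (leaves (a, b)).Perm (leaves (b, a)) := List.perm_append_comm
      simp only [partTree, numEdges_perm h, numHairs_perm h]
      split_ifs
      · exact treeMk_flip k _ _ _
      · rfl)
    (fun a b c => by
      have h : (leaves (a * b, c)).Perm (leaves (a, b * c)) := by simp [leaves]
      simp only [partTree, numEdges_perm h, numHairs_perm h]
      split_ifs
      · exact treeMk_move k _ _ _ _
      · rfl)
    (fun a b c => by
      have h : (leaves (a, b * c)).Perm (leaves (a, c * b)) :=
        List.perm_append_comm.append_left _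
      simp only [partTree, numEdges_perm h, numHairs_perm h]
      split_ifs
      · exact treeMk_antisymm k _ _ _ _
      · simp)
    (fun a b c d => by
      have h : (leaves (a, c * d * b)).Perm (leaves (a, b * c * d)) := by
        refine List.Perm.append_left _ ?_
        simp only [leavesR_mul]
        exact List.perm_append_comm.trans (by simp)
      have h' : (leaves (a, d * b * c)).Perm (leaves (a, b * c * d)) := by
        refine List.Perm.append_left _ ?_
        simp only [leavesR_mul]
        rw [List.append_assoc]
        exact List.perm_append_comm
      simp only [partTree, numEdges_perm h, numHairs_perm h, numEdges_perm h', numHairs_perm h']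
      split_ifs
      · exact treeMk_ihx k _ _ _ _ _
      · simp)
    (fun r v w a => by
      have hE : ∀ u : H, numEdges (leaves (.of (.hair u), a)) = numEdges (leavesR a) := fun u => rfl
      have hH : ∀ u : H, numHairs (leaves (.of (.hair u), a)) = numHairs (leavesR a) + 1 :=
        fun u => rfl
      simp only [partTree, hE, hH]
      split_ifs
      · exact treeMk_linear k _ r v w _
      · simp)

theorem prePart_gr (s r : ℕ) (t : UTree (Leaf H)) :
    prePart k H s r (gr k t) =
      if numEdges (leaves t) = r ∧ numHairs (leaves t) = s then gr k t else 0 :=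
  treeLift_mk k _ _ _ _ _ _ _ t

theorem prePart_mem (s r : ℕ) (x : PreGraph k H) (hx : x ∈ PreC₁ k H) :
    prePart k H s r x ∈ PreC₁Part k H s r := by
  refine (Submodule.span_le (p := (PreC₁Part k H s r).comap (prePart k H s r))).2 ?_ hx
  rintro _ ⟨t, ht, rfl⟩
  simp only [Submodule.comap_coe, Set.mem_preimage, SetLike.mem_coe, prePart_gr]
  split_ifs with h
  · exact Submodule.subset_span ⟨t, ht, h.1, h.2, rfl⟩
  · exact zero_mem _

theorem filterMap_hair_rename (f : ℕ → ℕ) (l : List (Leaf H)) :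
    (l.map (Leaf.rename f)).filterMap Leaf.hair? = l.filterMap Leaf.hair? := by
  rw [List.filterMap_map]
  congr 1
  funext x
  cases x <;> rfl

theorem filterMap_tail_rename (f : ℕ → ℕ) (l : List (Leaf H)) :
    (l.map (Leaf.rename f)).filterMap Leaf.tail? = (l.filterMap Leaf.tail?).map f := by
  rw [List.filterMap_map, List.map_filterMap]
  congr 1
  funext x
  cases x <;> rfl

theorem filterMap_head_rename (f : ℕ → ℕ) (l : List (Leaf H)) :
    (l.map (Leaf.rename f)).filterMap Leaf.head? = (l.filterMap Leaf.head?).map f := by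
  rw [List.filterMap_map, List.map_filterMap]
  congr 1
  funext x
  cases x <;> rfl

theorem filterMap_hair_switch (e : ℕ) (l : List (Leaf H)) :
    (l.map (Leaf.switch e)).filterMap Leaf.hair? = l.filterMap Leaf.hair? := by
  rw [List.filterMap_map]
  congr 1
  funext x
  cases x <;> simp only [Function.comp, Leaf.switch] <;> (try split_ifs) <;> rfl

theorem numEdges_switch (e : ℕ) (l : List (Leaf H)) :
    numEdges (l.map (Leaf.switch e)) + (l.filterMap Leaf.tail?).count e
      = numEdges l + (l.filterMap Leaf.head?).count e := by
  induction l with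
  | nil => rfl
  | cons x l ih =>
    unfold numEdges at ih ⊢
    cases x with
    | hair v => simpa [-List.filterMap_map, List.filterMap_cons, Leaf.switch, Leaf.tail?, Leaf.head?] using ih
    | tail e' =>
      by_cases h : e' = e
      · subst h
        simp [-List.filterMap_map, List.filterMap_cons, Leaf.switch, Leaf.tail?, Leaf.head?]
        omega
      · simp [-List.filterMap_map, List.filterMap_cons, Leaf.switch, Leaf.tail?, Leaf.head?, h]
        omega
    | head e' =>
      by_cases h : e' = e
      · subst h
        simp [-List.filterMap_map, List.filterMap_cons, Leaf.switch, Leaf.tail?, Leaf.head?]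
        omega
      · simp [-List.filterMap_map, List.filterMap_cons, Leaf.switch, Leaf.tail?, Leaf.head?, h]
        omega

theorem prePart_edgeRel (s r : ℕ) (x : PreGraph k H) (hx : x ∈ edgeRel k H) :
    prePart k H s r x ∈ edgeRel k H := by
  refine (Submodule.span_le (p := (edgeRel k H).comap (prePart k H s r))).2 ?_ hx
  rintro _ (⟨t, e, ht, he, rfl⟩ | ⟨t, f, ht, hf, rfl⟩)
  · have hE : numEdges (leaves (relabel (Leaf.switch e) t)) = numEdges (leaves t) := by
      have := numEdges_switch e (leaves t)
      rw [ht.2.count_eq] at this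
      rw [leaves_relabel]
      omega
    have hH : numHairs (leaves (relabel (Leaf.switch e) t)) = numHairs (leaves t) := by
      rw [leaves_relabel, numHairs, filterMap_hair_switch, numHairs]
    simp only [Submodule.comap_coe, Set.mem_preimage, SetLike.mem_coe, map_add, prePart_gr, hE, hH]
    split_ifs with h
    · exact Submodule.subset_span (Or.inl ⟨t, e, ht, he, rfl⟩)
    · simp
  · have hE : numEdges (leaves (relabel (Leaf.rename f) t)) = numEdges (leaves t) := by
      rw [leaves_relabel, numEdges, filterMap_tail_rename, List.length_map, numEdges]
    have hH : numHairs (leaves (relabel (Leaf.rename f) t)) = numHairs (leaves t) := by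
      rw [leaves_relabel, numHairs, filterMap_hair_rename, numHairs]
    simp only [Submodule.comap_coe, Set.mem_preimage, SetLike.mem_coe, map_sub, prePart_gr, hE, hH]
    split_ifs with h
    · exact Submodule.subset_span (Or.inr ⟨t, f, ht, hf, rfl⟩)
    · simp

theorem joinSign_ne_zero {x y : Leaf H} (h : joinSign k x y ≠ 0) (l l' : List (Leaf H)) :
    numEdges (x :: l) + numEdges (y :: l') = numEdges l + numEdges l' + 1 ∧
    numHairs (x :: l) + numHairs (y :: l') = numHairs l + numHairs l' := by
  cases x <;> cases y <;>
    simp [joinSign, numEdges, numHairs, List.filterMap_cons, Leaf.tail?, Leaf.hair?] at h ⊢ <;>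
    omega

theorem prePart_boundary (s r : ℕ) (Γ : UTree (Leaf H) × UTree (Leaf H)) :
    prePart k H s r (boundary k Γ) =
      if numEdges (leaves₂ Γ) = r + 1 ∧ numHairs (leaves₂ Γ) = s then boundary k Γ else 0 := by
  have key : ∀ p ∈ rootings Γ.1, ∀ q ∈ rootings Γ.2,
      prePart k H s r (joinSign k p.1 q.1 • gr k (p.2, q.2)) =
        if numEdges (leaves₂ Γ) = r + 1 ∧ numHairs (leaves₂ Γ) = s then
          joinSign k p.1 q.1 • gr k (p.2, q.2) else 0 := by
    intro p hp q hq
    by_cases h : joinSign k p.1 q.1 = 0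
    · simp [h]
    · have h1 := joinSign_ne_zero h (leavesR p.2) (leavesR q.2)
      have hE : ∀ l l' : List (Leaf H), numEdges (l ++ l') = numEdges l + numEdges l' := by
        intro l l'; simp [numEdges]
      have hH : ∀ l l' : List (Leaf H), numHairs (l ++ l') = numHairs l + numHairs l' := by
        intro l l'; simp [numHairs]
      rw [numEdges_perm (rootings_perm _ p hp), numEdges_perm (rootings_perm _ q hq),
        numHairs_perm (rootings_perm _ p hp), numHairs_perm (rootings_perm _ q hq),
        ← hE, ← hE, ← hH, ← hH] at h1
      change numEdges (leaves₂ Γ) = numEdges (leaves (p.2, q.2)) + 1 ∧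
        numHairs (leaves₂ Γ) = numHairs (leaves (p.2, q.2)) at h1
      rw [map_smul, prePart_gr, h1.1, h1.2]
      simp only [add_left_inj]
      split_ifs <;> simp
  have hsum : prePart k H s r (boundary k Γ) =
      ((rootings Γ.1).map fun p => ((rootings Γ.2).map fun q =>
        if numEdges (leaves₂ Γ) = r + 1 ∧ numHairs (leaves₂ Γ) = s then
          joinSign k p.1 q.1 • gr k (p.2, q.2) else 0).sum).sum := by
    rw [boundary, map_list_sum, List.map_map]
    congr 1
    refine List.map_congr_left fun p hp => ?_
    rw [Function.comp, map_list_sum, List.map_map]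
    congr 1
    exact List.map_congr_left fun q hq => key p hp q hq
  rw [hsum]
  split_ifs
  · rfl
  · simp

theorem prePart_bdS₂ (s r : ℕ) (x : PreGraph k H) (hx : x ∈ bdS₂ k H) :
    prePart k H s r x ∈ bdS₂Part k H s r := by
  refine (Submodule.span_le (p := (bdS₂Part k H s r).comap (prePart k H s r))).2 ?_ hx
  rintro _ ⟨Γ, hΓ, rfl⟩
  simp only [Submodule.comap_coe, Set.mem_preimage, SetLike.mem_coe, prePart_boundary]
  split_ifs with h
  · exact Submodule.subset_span ⟨Γ, hΓ, h.1, h.2, rfl⟩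
  · exact zero_mem _

theorem tails_hair (t : UTree H) :
    (leaves (relabel Leaf.hair t)).filterMap Leaf.tail? = [] := by
  rw [leaves_relabel, List.filterMap_map]
  simp [Function.comp_def, Leaf.tail?]

theorem heads_hair (t : UTree H) :
    (leaves (relabel Leaf.hair t)).filterMap Leaf.head? = [] := by
  rw [leaves_relabel, List.filterMap_map]
  simp [Function.comp_def, Leaf.head?]

theorem prePart_inclT (s r : ℕ) (hr : 1 ≤ r) : prePart k H s r ∘ₗ inclT k H = 0 := by
  apply treeSpace_ext
  intro t
  rw [LinearMap.comp_apply, inclT_mk, prePart_gr, if_neg, LinearMap.zero_apply]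
  rintro ⟨h, -⟩
  rw [numEdges, tails_hair, List.length_nil] at h
  omega

variable (k H) in
/-- The projection `Ω(H) → Ω_{s,r}(H)`, for `r ≥ 1`. -/
def projOmega (s r : ℕ) (hr : 1 ≤ r) : Omega k H →ₗ[k] OmegaPart k H s r :=
  Submodule.mapQ _ _ ((prePart k H s r).restrict (prePart_mem s r)) <| by
    rintro ⟨x, hx⟩ hx'
    change x ∈ edgeRel k H ⊔ bdS₂ k H ⊔ LinearMap.range (inclT k H) at hx'
    change prePart k H s r x ∈ edgeRel k H ⊔ bdS₂Part k H s r
    obtain ⟨y, hy, z, ⟨w, rfl⟩, rfl⟩ := Submodule.mem_sup.1 hx'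
    obtain ⟨y, hy', z, hz, rfl⟩ := Submodule.mem_sup.1 hy
    have h0 : prePart k H s r (inclT k H w) = 0 :=
      LinearMap.congr_fun (prePart_inclT (k := k) (H := H) s r hr) w
    have h1 : prePart k H s r (y + z + inclT k H w) = prePart k H s r y + prePart k H s r z := by
      rw [map_add, map_add, h0, add_zero]
    rw [h1]
    exact add_mem (Submodule.mem_sup_left (prePart_edgeRel s r y hy'))
      (Submodule.mem_sup_right (prePart_bdS₂ s r z hz))

end Projection

/-! ### The trace maps `Tr^{CKV}` and `Tr^C` -/

section Trace

variable {k H}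

/-- For every hair of `a`, the pair of its label `v` and the tree obtained from `a` by replacing
this hair by the leaf `ℓ`. -/
def replaceR (ℓ : Leaf H) : FreeMagma (Leaf H) → List (H × FreeMagma (Leaf H))
  | .of (.hair v) => [(v, .of ℓ)]
  | .of (.tail _) => []
  | .of (.head _) => []
  | .mul a b => (replaceR ℓ a).map (fun p => (p.1, p.2 * b)) ++
      (replaceR ℓ b).map (fun p => (p.1, a * p.2))

/-- For every hair of `t`, the pair of its label `v` and the tree obtained from `t` by replacing
this hair by the leaf `ℓ`. -/
def replace (ℓ : Leaf H) (t : UTree (Leaf H)) : List (H × UTree (Leaf H)) :=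
  (replaceR ℓ t.1).map (fun p => (p.1, (p.2, t.2))) ++
    (replaceR ℓ t.2).map (fun p => (p.1, (t.1, p.2)))

@[simp] theorem replaceR_mul (ℓ : Leaf H) (a b : FreeMagma (Leaf H)) :
    replaceR ℓ (a * b) = (replaceR ℓ a).map (fun p => (p.1, p.2 * b)) ++
      (replaceR ℓ b).map (fun p => (p.1, a * p.2)) := rfl

theorem replaceR_perm (ℓ : Leaf H) (a : FreeMagma (Leaf H)) (p : H × FreeMagma (Leaf H))
    (hp : p ∈ replaceR ℓ a) :
    ∃ l, (leavesR a).Perm (.hair p.1 :: l) ∧ (leavesR p.2).Perm (ℓ :: l) := by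
  induction a generalizing p with
  | ih1 x =>
    cases x <;> simp only [replaceR, List.mem_singleton, List.not_mem_nil] at hp
    subst hp
    exact ⟨[], by simp, by simp⟩
  | ih2 a b ha hb =>
    simp only [replaceR_mul, List.mem_append, List.mem_map] at hp
    rcases hp with ⟨q, hq, rfl⟩ | ⟨q, hq, rfl⟩
    · obtain ⟨l, h1, h2⟩ := ha q hq
      exact ⟨l ++ leavesR b, h1.append_right _, h2.append_right _⟩
    · obtain ⟨l, h1, h2⟩ := hb q hq
      exact ⟨leavesR a ++ l, (h1.append_left _).trans List.perm_middle,
        (h2.append_left _).trans List.perm_middle⟩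

theorem replace_perm (ℓ : Leaf H) (t : UTree (Leaf H)) (p : H × UTree (Leaf H))
    (hp : p ∈ replace ℓ t) :
    ∃ l, (leaves t).Perm (.hair p.1 :: l) ∧ (leaves p.2).Perm (ℓ :: l) := by
  simp only [replace, List.mem_append, List.mem_map] at hp
  rcases hp with ⟨q, hq, rfl⟩ | ⟨q, hq, rfl⟩
  · obtain ⟨l, h1, h2⟩ := replaceR_perm ℓ _ q hq
    exact ⟨l ++ leavesR t.2, h1.append_right _, h2.append_right _⟩
  · obtain ⟨l, h1, h2⟩ := replaceR_perm ℓ _ q hq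
    exact ⟨leavesR t.1 ++ l, (h1.append_left _).trans List.perm_middle,
      (h2.append_left _).trans List.perm_middle⟩

/-- Auxiliary: a sum over the hairs of a rooted tree. -/
def hairSum {M : Type*} [AddCommGroup M] (ℓ : Leaf H) (a : FreeMagma (Leaf H))
    (f : H → FreeMagma (Leaf H) → M) : M :=
  ((replaceR ℓ a).map fun p => f p.1 p.2).sum

theorem hairSum_mul {M : Type*} [AddCommGroup M] (ℓ : Leaf H) (a b : FreeMagma (Leaf H))
    (f : H → FreeMagma (Leaf H) → M) :
    hairSum ℓ (a * b) f = hairSum ℓ a (fun v c => f v (c * b)) +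
      hairSum ℓ b (fun v c => f v (a * c)) := by
  simp [hairSum, Function.comp_def]

theorem hairSum_add {M : Type*} [AddCommGroup M] (ℓ : Leaf H) (a : FreeMagma (Leaf H))
    (f g : H → FreeMagma (Leaf H) → M) :
    hairSum ℓ a f + hairSum ℓ a g = hairSum ℓ a (fun v c => f v c + g v c) := by
  simp [hairSum, List.sum_map_add]

theorem hairSum_eq_zero {M : Type*} [AddCommGroup M] (ℓ : Leaf H) (a : FreeMagma (Leaf H))
    (f : H → FreeMagma (Leaf H) → M) (h : ∀ v c, f v c = 0) : hairSum ℓ a f = 0 := by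
  simp [hairSum, h]

theorem hairSum_smul {M : Type*} [AddCommGroup M] [Module k M] (r : k) (ℓ : Leaf H)
    (a : FreeMagma (Leaf H)) (f : H → FreeMagma (Leaf H) → M) :
    r • hairSum ℓ a f = hairSum ℓ a (fun v c => r • f v c) := by
  simp [hairSum, List.smul_sum, Function.comp_def]

variable (k) in
/-- `∑ v ⊗ t'`, where the sum runs over the hairs of `t`, `v` is the label of the hair, and in `t'`
the hair is replaced by the leaf `ℓ`. -/
def detachTree (ℓ : Leaf H) (t : UTree (Leaf H)) : H ⊗[k] PreGraph k H :=
  ((replace ℓ t).map fun p => p.1 ⊗ₜ[k] gr k p.2).sum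

theorem detachTree_eq (ℓ : Leaf H) (a b : FreeMagma (Leaf H)) :
    detachTree k ℓ (a, b) = hairSum ℓ a (fun v c => v ⊗ₜ[k] gr k (c, b)) +
      hairSum ℓ b (fun v c => v ⊗ₜ[k] gr k (a, c)) := by
  simp [detachTree, replace, hairSum, Function.comp_def]

theorem gr_flip (a b : FreeMagma (Leaf H)) : gr k (a, b) = gr k (b, a) := treeMk_flip k _ a b
theorem gr_move (a b c : FreeMagma (Leaf H)) : gr k (a * b, c) = gr k (a, b * c) :=
  treeMk_move k _ a b c
theorem gr_antisymm (a b c : FreeMagma (Leaf H)) : gr k (a, b * c) + gr k (a, c * b) = 0 :=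
  treeMk_antisymm k _ a b c
theorem gr_ihx (a b c d : FreeMagma (Leaf H)) :
    gr k (a, b * c * d) + gr k (a, c * d * b) + gr k (a, d * b * c) = 0 := treeMk_ihx k _ a b c d

variable (k) in
/-- The linear map `t ↦ ∑ v ⊗ t'`, where the sum runs over the hairs of `t`, `v` is the label of
the hair, and in `t'` the hair is replaced by the leaf `ℓ`. -/
def detach (ℓ : Leaf H) : PreGraph k H →ₗ[k] H ⊗[k] PreGraph k H :=
  treeLift k Leaf.hair (detachTree k ℓ)
    (fun a b => by
      simp only [detachTree_eq, gr_flip _ b, gr_flip _ a]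
      rw [add_comm])
    (fun a b c => by
      simp only [detachTree_eq, hairSum_mul, gr_move, add_assoc])
    (fun a b c => by
      simp only [detachTree_eq, hairSum_mul]
      have key : ∀ (e : FreeMagma (Leaf H)) (f g : FreeMagma (Leaf H) → UTree (Leaf H)),
          (∀ x, gr k (f x) + gr k (g x) = 0) →
          hairSum ℓ e (fun v x => v ⊗ₜ[k] gr k (f x)) + hairSum ℓ e (fun v x => v ⊗ₜ[k] gr k (g x))
            = 0 := by
        intro e f g hz
        rw [hairSum_add]
        refine hairSum_eq_zero _ _ _ fun v x => ?_
        rw [← TensorProduct.tmul_add, hz, TensorProduct.tmul_zero]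
      have h1 := key a (fun x => (x, b * c)) (fun x => (x, c * b)) fun x => gr_antisymm _ _ _
      have h2 := key b (fun x => (a, x * c)) (fun x => (a, c * x)) fun x => gr_antisymm _ _ _
      have h3 := key c (fun x => (a, b * x)) (fun x => (a, x * b)) fun x => gr_antisymm _ _ _
      have := congrArg₂ (· + ·) h1 (congrArg₂ (· + ·) h2 h3)
      simp only [add_zero] at this
      rw [← this]
      abel)
    (fun a b c d => by
      simp only [detachTree_eq, hairSum_mul]
      have key : ∀ (e : FreeMagma (Leaf H)) (f g h : FreeMagma (Leaf H) → UTree (Leaf H)),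
          (∀ x, gr k (f x) + gr k (g x) + gr k (h x) = 0) →
          hairSum ℓ e (fun v x => v ⊗ₜ[k] gr k (f x)) + hairSum ℓ e (fun v x => v ⊗ₜ[k] gr k (g x))
            + hairSum ℓ e (fun v x => v ⊗ₜ[k] gr k (h x)) = 0 := by
        intro e f g h hz
        rw [hairSum_add, hairSum_add]
        refine hairSum_eq_zero _ _ _ fun v x => ?_
        rw [← TensorProduct.tmul_add, ← TensorProduct.tmul_add, hz, TensorProduct.tmul_zero]
      have h1 := key a (fun x => (x, b * c * d)) (fun x => (x, c * d * b))
        (fun x => (x, d * b * c)) fun x => gr_ihx _ _ _ _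
      have h2 := key b (fun x => (a, x * c * d)) (fun x => (a, c * d * x))
        (fun x => (a, d * x * c)) fun x => gr_ihx _ _ _ _
      have h3 := key c (fun x => (a, b * x * d)) (fun x => (a, x * d * b))
        (fun x => (a, d * b * x)) fun x => gr_ihx _ _ _ _
      have h4 := key d (fun x => (a, b * c * x)) (fun x => (a, c * x * b))
        (fun x => (a, x * b * c)) fun x => gr_ihx _ _ _ _
      have := congrArg₂ (· + ·) (congrArg₂ (· + ·) h1 h2) (congrArg₂ (· + ·) h3 h4)
      simp only [add_zero] at this
      rw [← this]
      abel)
    (fun r v w a => by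
      have h0 : ∀ u : H, hairSum ℓ (.of (.hair u)) (fun v c => v ⊗ₜ[k] gr k (c, a)) =
          u ⊗ₜ[k] gr k (.of ℓ, a) := fun u => by simp [hairSum, replaceR]
      have h1 : ∀ c : FreeMagma (Leaf H), gr k (.of (.hair (r • v + w)), c) =
          r • gr k (.of (.hair v), c) + gr k (.of (.hair w), c) :=
        fun c => treeMk_linear k _ r v w c
      simp only [detachTree_eq, h0, h1, TensorProduct.tmul_add, TensorProduct.tmul_smul,
        ← hairSum_add, ← hairSum_smul, smul_add]
      rw [TensorProduct.add_tmul, TensorProduct.smul_tmul']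
      abel)

theorem detach_gr (ℓ : Leaf H) (t : UTree (Leaf H)) :
    detach k ℓ (gr k t) = ((replace ℓ t).map fun p => p.1 ⊗ₜ[k] gr k p.2).sum :=
  treeLift_mk k _ _ _ _ _ _ _ t

variable (k H) in
/-- Renaming the external edges from `0, 1, …` to `1, 2, …`. -/
def shift : PreGraph k H →ₗ[k] PreGraph k H :=
  treeLift k Leaf.hair (fun t => gr k (relabel (Leaf.rename Nat.succ) t))
    (fun a b => treeMk_flip k _ _ _)
    (fun a b c => treeMk_move k _ _ _ _)
    (fun a b c => treeMk_antisymm k _ _ _ _)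
    (fun a b c d => treeMk_ihx k _ _ _ _ _)
    (fun r v w a => treeMk_linear k _ r v w _)

theorem shift_gr (t : UTree (Leaf H)) :
    shift k H (gr k t) = gr k (relabel (Leaf.rename Nat.succ) t) :=
  treeLift_mk k _ _ _ _ _ _ _ t

/-- The operator `T`: sum over all pairs of hairs of a hairy graph, joining the two hairs by a new
external edge and multiplying by the contraction `⟨v, w⟩` of the two labels, where the edge is
directed from the hair labelled `v` to the hair labelled `w`.

The two directions of the new edge give the same element of `C₁ℋ(H)`.  Instead of choosing one of
them, the operator takes one half of the sum over all ordered pairs of distinct hairs; see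
`addEdge_gr`.  The other edges are renamed so that the new edge can be named `0`. -/
def addEdge (ω : LinearMap.BilinForm k H) : Module.End k (PreGraph k H) :=
  (2⁻¹ : k) • ((TensorProduct.lid k (PreGraph k H)).toLinearMap ∘ₗ
    (TensorProduct.lift ω).rTensor (PreGraph k H) ∘ₗ
    (TensorProduct.assoc k H H (PreGraph k H)).symm.toLinearMap ∘ₗ
    (detach k (.head 0)).lTensor H ∘ₗ detach k (.tail 0) ∘ₗ shift k H)

theorem addEdge_gr (ω : LinearMap.BilinForm k H) (t : UTree (Leaf H)) :
    addEdge ω (gr k t) = (2⁻¹ : k) •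
      ((replace (.tail 0) (relabel (Leaf.rename Nat.succ) t)).map fun p =>
        ((replace (.head 0) p.2).map fun q => ω p.1 q.1 • gr k q.2).sum).sum := by
  simp only [addEdge, LinearMap.smul_apply, LinearMap.comp_apply, shift_gr, detach_gr,
    map_list_sum, List.map_map, Function.comp_def, LinearMap.lTensor_tmul]
  congr 3
  funext p
  have h : ∀ l : List (H ⊗[k] PreGraph k H),
      p.1 ⊗ₜ[k] l.sum = (l.map fun y => p.1 ⊗ₜ[k] y).sum := fun l =>
    map_list_sum (TensorProduct.mk k H (H ⊗[k] PreGraph k H) p.1) l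
  rw [h]
  simp [map_list_sum, List.map_map, Function.comp_def]

theorem replace_replace (t : UTree (Leaf H)) (p q : H × UTree (Leaf H))
    (hp : p ∈ replace (.tail 0) (relabel (Leaf.rename Nat.succ) t))
    (hq : q ∈ replace (.head 0) p.2) :
    numHairs (leaves q.2) + 2 = numHairs (leaves t) ∧ (IsHairy t → IsHairy q.2) := by
  obtain ⟨l, h1, h2⟩ := replace_perm _ _ p hp
  obtain ⟨l', h3, h4⟩ := replace_perm _ _ q hq
  rw [leaves_relabel] at h1
  have h5 := h2.symm.trans h3
  have hH1 := h1.filterMap Leaf.hair?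
  have hH2 := h5.filterMap Leaf.hair?
  have hH3 := h4.filterMap Leaf.hair?
  have hT1 := h1.filterMap Leaf.tail?
  have hT2 := h5.filterMap Leaf.tail?
  have hT3 := h4.filterMap Leaf.tail?
  have hD1 := h1.filterMap Leaf.head?
  have hD2 := h5.filterMap Leaf.head?
  have hD3 := h4.filterMap Leaf.head?
  rw [filterMap_hair_rename] at hH1
  rw [filterMap_tail_rename] at hT1
  rw [filterMap_head_rename] at hD1
  simp only [List.filterMap_cons, Leaf.hair?, Leaf.tail?] at hH1 hH2 hH3 hT1 hT2 hT3
  simp only [List.filterMap_cons, Leaf.head?] at hD1 hD2 hD3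
  constructor
  · have e1 := hH1.length_eq
    have e2 := hH2.length_eq
    have e3 := hH3.length_eq
    simp only [List.length_cons] at e1 e2 e3
    simp only [numHairs]
    omega
  · rintro ⟨hn, hm⟩
    have hT : (List.filterMap Leaf.tail? (leaves q.2)).Perm
        (0 :: (List.filterMap Leaf.tail? (leaves t)).map Nat.succ) :=
      hT3.trans (hT2.symm.trans (hT1.symm.cons 0))
    have hD : (List.filterMap Leaf.head? (leaves q.2)).Perm
        (0 :: (List.filterMap Leaf.head? (leaves t)).map Nat.succ) :=
      hD3.trans ((hD2.symm.trans hD1.symm).cons 0)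
    refine ⟨hT.nodup_iff.2 ?_, hD.trans (((hm.map _).cons 0).trans hT.symm)⟩
    rw [List.nodup_cons]
    exact ⟨by simp, hn.map Nat.succ_injective⟩

theorem addEdge_mem (ω : LinearMap.BilinForm k H) (x : PreGraph k H) (hx : x ∈ PreC₁ k H) :
    addEdge ω x ∈ PreC₁ k H := by
  refine (Submodule.span_le (p := (PreC₁ k H).comap (addEdge ω))).2 ?_ hx
  rintro _ ⟨t, ht, rfl⟩
  simp only [Submodule.comap_coe, Set.mem_preimage, SetLike.mem_coe, addEdge_gr]
  refine Submodule.smul_mem _ _ (list_sum_mem fun y hy => ?_)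
  obtain ⟨p, hp, rfl⟩ := List.mem_map.1 hy
  refine list_sum_mem fun y hy => ?_
  obtain ⟨q, hq, rfl⟩ := List.mem_map.1 hy
  exact Submodule.smul_mem _ _ (Submodule.subset_span
    ⟨q.2, (replace_replace t p q hp hq).2 ht, rfl⟩)

theorem addEdge_pow_gr (ω : LinearMap.BilinForm k H) (n : ℕ) (t : UTree (Leaf H))
    (ht : numHairs (leaves t) ≤ n) : (addEdge ω ^ (n + 1)) (gr k t) = 0 := by
  induction n using Nat.strong_induction_on generalizing t with
  | _ n ih =>
    rw [pow_succ, Module.End.mul_apply, addEdge_gr, map_smul, map_list_sum, List.map_map]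
    rw [List.sum_eq_zero, smul_zero]
    intro y hy
    obtain ⟨p, hp, rfl⟩ := List.mem_map.1 hy
    rw [Function.comp, map_list_sum, List.map_map]
    refine List.sum_eq_zero fun y hy => ?_
    obtain ⟨q, hq, rfl⟩ := List.mem_map.1 hy
    have h := (replace_replace t p q hp hq).1
    rw [Function.comp, map_smul]
    obtain ⟨m, rfl⟩ : ∃ m, n = m + 1 := ⟨n - 1, by omega⟩
    rw [ih m (by omega) q.2 (by omega), smul_zero]

theorem addEdge_locallyNilpotent (ω : LinearMap.BilinForm k H) (x : PreGraph k H) :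
    ∃ N, ∀ n, N ≤ n → (addEdge ω ^ n) x = 0 := by
  refine Submodule.span_induction ?_ ?_ ?_ ?_ (span_treeMk k Leaf.hair x)
  · rintro _ ⟨t, rfl⟩
    refine ⟨numHairs (leaves t) + 1, fun n hn => ?_⟩
    obtain ⟨m, rfl⟩ : ∃ m, n = m + 1 := ⟨n - 1, by omega⟩
    exact addEdge_pow_gr ω m t (by omega)
  · exact ⟨0, fun n _ => map_zero _⟩
  · rintro x y - - ⟨N, hN⟩ ⟨M, hM⟩
    exact ⟨max N M, fun n hn => by
      rw [map_add, hN n (le_trans (le_max_left _ _) hn), hM n (le_trans (le_max_right _ _) hn),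
        add_zero]⟩
  · rintro r x - ⟨N, hN⟩
    exact ⟨N, fun n hn => by rw [map_smul, hN n hn, smul_zero]⟩

theorem finite_support_exp (ω : LinearMap.BilinForm k H) (x : PreGraph k H) :
    (Function.support fun n : ℕ => ((n.factorial : k)⁻¹) • (addEdge ω ^ n) x).Finite := by
  obtain ⟨N, hN⟩ := addEdge_locallyNilpotent ω x
  refine (Set.finite_Iio N).subset fun n hn => ?_
  by_contra h
  exact hn (by simp [hN n (not_lt.1 h)])

/-- `exp(T) = ∑_n Tⁿ / n!`, a finite sum on every element. -/
def expAddEdge (ω : LinearMap.BilinForm k H) : PreGraph k H →ₗ[k] PreGraph k H where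
  toFun x := ∑ᶠ n : ℕ, ((n.factorial : k)⁻¹) • (addEdge ω ^ n) x
  map_add' x y := by
    rw [← finsum_add_distrib (finite_support_exp ω x) (finite_support_exp ω y)]
    simp only [map_add, smul_add]
  map_smul' r x := by
    rw [RingHom.id_apply, smul_finsum' r (finite_support_exp ω x)]
    simp only [map_smul, smul_comm r]

theorem addEdge_pow_mem (ω : LinearMap.BilinForm k H) (n : ℕ) (x : PreGraph k H)
    (hx : x ∈ PreC₁ k H) : (addEdge ω ^ n) x ∈ PreC₁ k H := by
  induction n with
  | zero => exact hx
  | succ n ih => rw [pow_succ', Module.End.mul_apply]; exact addEdge_mem ω _ ih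

theorem inclT_mem (x : T k H) : inclT k H x ∈ PreC₁ k H := by
  refine Submodule.span_induction ?_ ?_ ?_ ?_ (span_treeMk k id x)
  · rintro _ ⟨t, rfl⟩
    rw [inclT_mk]
    refine Submodule.subset_span ⟨_, ⟨?_, ?_⟩, rfl⟩
    · rw [tails_hair]; exact List.nodup_nil
    · rw [tails_hair, heads_hair]
  · rw [map_zero]; exact zero_mem _
  · rintro x y - - hx hy
    rw [map_add]; exact add_mem hx hy
  · rintro r x - hx
    rw [map_smul]; exact Submodule.smul_mem _ _ hx

/-- `Tr^{CKV} = exp(T) ∘ ι` on `𝒯(H)`, as a map to representatives of elements of `C₁ℋ(H)`. -/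
def trCKV (ω : LinearMap.BilinForm k H) : T k H →ₗ[k] PreC₁ k H :=
  (expAddEdge ω ∘ₗ inclT k H).codRestrict (PreC₁ k H) fun x =>
    finsum_induction (· ∈ PreC₁ k H) (zero_mem _) (fun _ _ => add_mem) fun n =>
      Submodule.smul_mem _ _ (addEdge_pow_mem ω n _ (inclT_mem x))

/-- `Tr^C : 𝒯(H) → Ω(H)`, the composition of `Tr^{CKV}` with the projection to `Ω(H)`. -/
def trC (ω : LinearMap.BilinForm k H) : T k H →ₗ[k] Omega k H :=
  Submodule.mkQ _ ∘ₗ trCKV ω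

end Trace

/-! ### Loops with hairs -/

section Loop

variable {k H}

/-- The loop with hairs `v₁, …, v_s`: the tree `⟦⋯⟦⟦•, v₁⟧, v₂⟧⋯, v_s⟧`, whose root is joined to
the leaf `•` by an external edge directed from the root to `•`.  When one goes around the loop in
the direction of this edge, one meets `v₁, …, v_s` in this order. -/
def loopTree {s : ℕ} (v : Fin s → H) : UTree (Leaf H) :=
  (.of (.tail 0), (List.ofFn v).foldl (fun a x => a * .of (.hair x)) (.of (.head 0)))

theorem leaves_loopTree {s : ℕ} (v : Fin s → H) :
    leaves (loopTree v) = .tail 0 :: .head 0 :: (List.ofFn v).map Leaf.hair := by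
  have key : ∀ (l : List H) (a : FreeMagma (Leaf H)),
      leavesR (l.foldl (fun a x => a * .of (.hair x)) a) = leavesR a ++ l.map Leaf.hair := by
    intro l
    induction l with
    | nil => simp
    | cons x l ih => intro a; simp [ih]
  simp [leaves, loopTree, key]

theorem loopTree_mem {s : ℕ} (v : Fin s → H) : gr k (loopTree v) ∈ PreC₁Part k H s 1 := by
  have h1 : ∀ l : List H, (l.map Leaf.hair).filterMap Leaf.tail? = [] := fun l => by
    rw [List.filterMap_map]; simp [Function.comp_def, Leaf.tail?]
  have h2 : ∀ l : List H, (l.map Leaf.hair).filterMap Leaf.head? = [] := fun l => by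
    rw [List.filterMap_map]; simp [Function.comp_def, Leaf.head?]
  have h3 : ∀ l : List H, (l.map Leaf.hair).filterMap Leaf.hair? = l := fun l => by
    rw [List.filterMap_map]; simp [Function.comp_def, Leaf.hair?]
  refine Submodule.subset_span ⟨_, ⟨?_, ?_⟩, ?_, ?_, rfl⟩ <;>
  simp [leaves_loopTree, numEdges, numHairs, -List.filterMap_map, -List.map_ofFn, List.filterMap_cons,
    h1, h2, h3,
    Leaf.tail?, Leaf.head?, Leaf.hair?]

variable (k) in
/-- The class in `Ω_{s,1}(H)` of the loop with hairs `v₁, …, v_s`. -/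
def loopClass {s : ℕ} (v : Fin s → H) : OmegaPart k H s 1 :=
  Submodule.mkQ _ ⟨gr k (loopTree v), loopTree_mem v⟩

end Loop

end Johnson

end

open Johnson

/-!
Putting the label of a leaf back at the root from which it was detached recovers the tree, so on
`𝒯_s(H)` this operation inverts `η` up to the factor `s + 2`, the number of leaves. Conversely, on
`H ⊗ L(H)` the tensor algebra acts by the adjoint action, corrected by a term that records which
letter has been split off; as in the Dynkin–Specht–Wever theorem, it follows that applying `η` after
putting the label back is multiplication by `s + 2` up to a term that factors through the bracketing
map. On `D_s(H)` this term vanishes.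

The commutator of a rooted tree, expanded with respect to its first letter, shows that
`Tr^ES (η t)` is a sum over ordered pairs of leaves of `t`: the labels of the two leaves are
contracted, and one multiplies the commutators that hang on the path between them. The
anti-automorphism of the tensor algebra that negates the letters reverses the path, and the form is
antisymmetric; this is the invariance under `b`.

The same sum over pairs of leaves, with the two ends of the external edge in place of the contracted
labels, is a trace on the graphs with one external edge. It vanishes on `∂S₂` up to the dihedral
relations, and takes a loop to the word formed by its hairs. Loops span, because a tree with two
marked leaves is a combination of trees in which single hairs hang on the path between them, and the
tripods in `S₂` rotate loops; so the trace is an isomorphism. Only the linear term of `exp T`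
creates exactly one external edge, and it runs over unordered pairs of hairs, whence the factor
`1/2`.
-/

noncomputable section

namespace Johnson

universe u v

section TreeSpace

variable (k : Type u) [Field k] {H : Type v} [AddCommGroup H] [Module k H] {X : Type v}
  (lab : H → X)

theorem length_rootings (t : UTree X) : (rootings t).length = trivalent t + 2 := by
  have length_rootingsR (a c : FreeMagma X) : (rootingsR a c).length = nodesR a + 1 := by
    induction a generalizing c with
    | ih1 x => rfl
    | ih2 a b iha ihb =>
      simp only [rootingsR_mul, List.length_append, iha, ihb, nodesR_mul]
      omega
  simp only [rootings, List.length_append, length_rootingsR, trivalent]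
  omega

theorem treeMk_eq_of_mem_rootingsR (a c : FreeMagma X) {p : X × FreeMagma X}
    (hp : p ∈ rootingsR a c) : treeMk k lab (a, c) = treeMk k lab (.of p.1, p.2) := by
  induction a generalizing c with
  | ih1 x => rw [List.mem_singleton.1 hp]
  | ih2 a b iha ihb =>
    rcases List.mem_append.1 hp with hp | hp
    · rw [treeMk_move, iha _ hp]
    · rw [treeMk_flip, ← treeMk_move, treeMk_flip, ihb _ hp]

theorem treeMk_eq_of_mem_rootings (t : UTree X) {p : X × FreeMagma X} (hp : p ∈ rootings t) :
    treeMk k lab t = treeMk k lab (.of p.1, p.2) := by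
  rcases List.mem_append.1 hp with hp | hp
  · exact treeMk_eq_of_mem_rootingsR k lab _ _ hp
  · exact (treeMk_flip k lab t.1 t.2).trans (treeMk_eq_of_mem_rootingsR k lab _ _ hp)

theorem treeMk_rotate (a b c : FreeMagma X) :
    treeMk k lab (a * b, c) = treeMk k lab (b, c * a) := by
  rw [treeMk_flip, ← treeMk_move, treeMk_flip]

theorem treeMk_swap (a b c : FreeMagma X) :
    treeMk k lab (a, b * c) = -treeMk k lab (a, c * b) :=
  eq_neg_of_add_eq_zero_left (treeMk_antisymm k lab a b c)

theorem treeMk_leibniz (x a b c : FreeMagma X) :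
    treeMk k lab (x, a * (b * c)) =
      treeMk k lab (x, a * b * c) + treeMk k lab (x, b * (a * c)) := by
  have hswap : treeMk k lab (x, c * a * b) = treeMk k lab (x, b * (a * c)) := by
    rw [treeMk_swap, ← treeMk_move, treeMk_swap, neg_neg, treeMk_move]
  rw [treeMk_swap k lab x a, ← hswap, neg_eq_iff_add_eq_zero, ← treeMk_ihx k lab x a b c]
  abel

/-- The tree obtained by putting a vector at the root of the rooted tree `a`, as a linear function
of the vector. -/
def treeMkLabel (a : FreeMagma X) : H →ₗ[k] TreeSpace k lab where
  toFun v := treeMk k lab (.of (lab v), a)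
  map_add' v w := by simpa only [one_smul] using treeMk_linear k lab 1 v w a
  map_smul' r v := by
    have hzero : treeMk k lab (.of (lab (0 : H)), a) = 0 := by
      simpa only [smul_zero, add_zero, one_smul, left_eq_add] using treeMk_linear k lab 1 0 0 a
    simpa only [add_zero, hzero, RingHom.id_apply] using treeMk_linear k lab r v 0 a

end TreeSpace

/-! ### Gluing rooted trees -/

section Glue

variable (k : Type u) [Field k] {H : Type v} [AddCommGroup H] [Module k H] {X : Type v}
  (lab : H → X)

/-- Gluing the root of a linear combination of rooted trees to the root of a rooted tree. -/
def glue : FreeNonUnitalNonAssocAlgebra k X →ₗ[k] FreeMagma X → TreeSpace k lab :=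
  (Finsupp.linearCombination k fun a c => treeMk k lab (a, c)) ∘ₗ
    (MonoidAlgebra.coeffLinearEquiv k).toLinearMap

theorem glue_single (a c : FreeMagma X) (r : k) :
    glue k lab (MonoidAlgebra.single a r) c = r • treeMk k lab (a, c) := by
  simp [glue]

theorem glue_single_mul (a c : FreeMagma X) (r : k) (x : FreeNonUnitalNonAssocAlgebra k X) :
    glue k lab (MonoidAlgebra.single a r * x) c = r • glue k lab x (c * a) := by
  induction x using MonoidAlgebra.induction_linear with
  | zero => simp
  | add x y hx hy => simp only [mul_add, map_add, Pi.add_apply, hx, hy, smul_add]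
  | single b t =>
    rw [MonoidAlgebra.single_mul_single, glue_single, glue_single, treeMk_rotate, mul_smul]

theorem glue_antisymm (x y : FreeNonUnitalNonAssocAlgebra k X) :
    glue k lab (x * y) = -glue k lab (y * x) := by
  induction x using MonoidAlgebra.induction_linear with
  | zero => simp
  | add x x' hx hx' => simp only [add_mul, mul_add, map_add, neg_add, hx, hx']
  | single a r =>
    induction y using MonoidAlgebra.induction_linear with
    | zero => simp
    | add y y' hy hy' => simp only [add_mul, mul_add, map_add, neg_add, hy, hy']
    | single b t =>
      funext c
      rw [MonoidAlgebra.single_mul_single, MonoidAlgebra.single_mul_single, Pi.neg_apply,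
        glue_single, glue_single, mul_comm t r, treeMk_flip, treeMk_swap, smul_neg, treeMk_flip]

theorem glue_leibniz (x y z : FreeNonUnitalNonAssocAlgebra k X) :
    glue k lab (x * (y * z)) = glue k lab (x * y * z + y * (x * z)) := by
  induction x using MonoidAlgebra.induction_linear with
  | zero => simp
  | add x x' hx hx' =>
    simp only [map_add] at hx hx'
    simp only [add_mul, mul_add, map_add, hx, hx']
    abel
  | single a r =>
    induction y using MonoidAlgebra.induction_linear with
    | zero => simp
    | add y y' hy hy' =>
      simp only [map_add] at hy hy'
      simp only [add_mul, mul_add, map_add, hy, hy']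
      abel
    | single b t =>
      induction z using MonoidAlgebra.induction_linear with
      | zero => simp
      | add z z' hz hz' =>
        simp only [map_add] at hz hz'
        simp only [mul_add, map_add, hz, hz']
        abel
      | single d q =>
        funext c
        simp only [MonoidAlgebra.single_mul_single, map_add, Pi.add_apply, glue_single]
        rw [treeMk_flip, treeMk_leibniz, treeMk_flip k lab c, treeMk_flip k lab c]
        module

theorem glue_mul_congr (x : FreeNonUnitalNonAssocAlgebra k X)
    {y z : FreeNonUnitalNonAssocAlgebra k X} (h : glue k lab y = glue k lab z) :
    glue k lab (x * y) = glue k lab (x * z) := by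
  induction x using MonoidAlgebra.induction_linear with
  | zero => simp
  | add x x' hx hx' => simp only [add_mul, map_add, hx, hx']
  | single a r => funext c; rw [glue_single_mul, glue_single_mul, h]

theorem glue_eq_of_rel [NeZero (2 : k)] {x y : FreeNonUnitalNonAssocAlgebra k X}
    (h : FreeLieAlgebra.Rel k X x y) : glue k lab x = glue k lab y := by
  induction h with
  | lie_self a =>
    have hdouble : (2 : k) • glue k lab (a * a) = 0 := by
      rw [two_smul, ← eq_neg_iff_add_eq_zero]
      exact glue_antisymm k lab a a
    rw [(smul_eq_zero.1 hdouble).resolve_left two_ne_zero, map_zero]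
  | leibniz_lie a b c => exact glue_leibniz k lab a b c
  | smul t _ ih => rw [map_smul, map_smul, ih]
  | add_right c _ ih => rw [map_add, map_add, ih]
  | mul_left a _ ih => exact glue_mul_congr k lab a ih
  | @mul_right a b c _ ih =>
    rw [glue_antisymm k lab a c, glue_antisymm k lab b c, glue_mul_congr k lab c ih]

/-- The map induced by `glue` on the free Lie algebra on the set `X`. -/
def glueFree [NeZero (2 : k)] : FreeLieAlgebra k X →ₗ[k] FreeMagma X → TreeSpace k lab where
  toFun x := Quot.liftOn x (glue k lab) fun _ _ h => glue_eq_of_rel k lab h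
  map_add' := by rintro ⟨x⟩ ⟨y⟩; exact map_add (glue k lab) x y
  map_smul' := by rintro r ⟨x⟩; exact map_smul (glue k lab) r x

theorem glueFree_of [NeZero (2 : k)] (x : X) (c : FreeMagma X) :
    glueFree k lab (FreeLieAlgebra.of k x) c = treeMk k lab (.of x, c) :=
  (glue_single k lab (.of x) c 1).trans (one_smul k _)

theorem linIdeal_le_ker_glueFree [NeZero (2 : k)] :
    (linIdeal k H).toSubmodule ≤ LinearMap.ker (glueFree k (id : H → H)) := by
  let kerIdeal : LieIdeal k (FreeLieAlgebra k H) :=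
    { LinearMap.ker (glueFree k id) with
      lie_mem := by
        rintro ⟨x⟩ ⟨y⟩ (hy : glue k id y = 0)
        change glue k id (x * y) = 0
        rw [glue_mul_congr k id x (hy.trans (map_zero _).symm), mul_zero, map_zero] }
  suffices h : linIdeal k H ≤ kerIdeal from h
  refine LieSubmodule.lieSpan_le.2 ?_
  rintro _ ⟨r, v, w, rfl⟩
  change glueFree k id _ = 0
  funext c
  simp only [map_sub, map_add, map_smul, Pi.sub_apply, Pi.add_apply, Pi.smul_apply, Pi.zero_apply,
    glueFree_of]
  exact sub_eq_zero.2 (treeMk_linear k id r v w c)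

variable (H) in
/-- The map induced by `glue` on the free Lie algebra on the vector space `H`. -/
def glueLie [NeZero (2 : k)] : L k H →ₗ[k] FreeMagma H → T k H :=
  Submodule.liftQ (linIdeal k H).toSubmodule (glueFree k id) (linIdeal_le_ker_glueFree k)

theorem lieOf_eq_mk_single (a : FreeMagma H) :
    lieOf k a = LieSubmodule.Quotient.mk (N := linIdeal k H)
      (Quot.mk (FreeLieAlgebra.Rel k H) (MonoidAlgebra.single a 1) : FreeLieAlgebra k H) := by
  induction a with
  | ih1 v => rfl
  | ih2 a b iha ihb =>
    rw [lieOf_mul, iha, ihb, ← mul_one (1 : k), ← MonoidAlgebra.single_mul_single, mul_one]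
    rfl

theorem glueLie_lieOf [NeZero (2 : k)] (a c : FreeMagma H) :
    glueLie k H (lieOf k a) c = treeMk k id (a, c) := by
  rw [lieOf_eq_mk_single]
  exact (glue_single k id a c 1).trans (one_smul k _)

theorem span_range_lieOf : Submodule.span k (Set.range (lieOf k (H := H))) = ⊤ := by
  refine (Submodule.eq_top_iff').2 fun x => ?_
  obtain ⟨⟨z⟩, rfl⟩ := Submodule.mkQ_surjective _ x
  induction z using MonoidAlgebra.induction_linear with
  | zero => exact zero_mem _
  | add f g hf hg => exact add_mem hf hg
  | single a r =>
    rw [← mul_one r, ← smul_eq_mul, ← MonoidAlgebra.smul_single]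
    have hmem := Submodule.smul_mem _ r
      (Submodule.subset_span (R := k) (Set.mem_range_self (f := lieOf k) a))
    rwa [lieOf_eq_mk_single] at hmem

variable {k} in
theorem linearMap_ext_lieOf {M : Type*} [AddCommGroup M] [Module k M] {f g : L k H →ₗ[k] M}
    (h : ∀ a, f (lieOf k a) = g (lieOf k a)) : f = g :=
  LinearMap.ext_on_range (span_range_lieOf k) h

variable (H) in
/-- The map `H ⊗ L(H) → 𝒯(H)` that puts the label `v` at the root of a rooted tree. -/
def labelRoot [NeZero (2 : k)] : H ⊗[k] L k H →ₗ[k] T k H :=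
  TensorProduct.lift
    { toFun := fun v => LinearMap.proj (.of v) ∘ₗ glueLie k H
      map_add' := fun v w => linearMap_ext_lieOf fun a => by
        simp only [glueLie_lieOf, treeMk_flip k id a, LinearMap.comp_apply, LinearMap.proj_apply,
          LinearMap.add_apply]
        exact (treeMkLabel k id a).map_add v w
      map_smul' := fun r v => linearMap_ext_lieOf fun a => by
        simp only [glueLie_lieOf, treeMk_flip k id a, LinearMap.comp_apply, LinearMap.proj_apply,
          LinearMap.smul_apply]
        exact (treeMkLabel k id a).map_smul r v }

theorem labelRoot_tmul [NeZero (2 : k)] (v : H) (a : FreeMagma H) :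
    labelRoot k H (v ⊗ₜ lieOf k a) = treeMk k id (.of v, a) :=
  (glueLie_lieOf k a (.of v)).trans (treeMk_flip k id a (.of v))

theorem etaLin_treeMk (t : UTree H) : etaLin k H (treeMk k id t) = etaTree k t :=
  treeLift_mk ..

theorem labelRoot_etaLin [NeZero (2 : k)] {s : ℕ} {x : T k H} (hx : x ∈ TDeg k H s) :
    labelRoot k H (etaLin k H x) = ((s : k) + 2) • x := by
  induction hx using Submodule.span_induction with
  | mem x hx =>
    obtain ⟨t, rfl, rfl⟩ := hx
    have hroot : (rootings t).map (labelRoot k H ∘ fun p => p.1 ⊗ₜ[k] lieOf k p.2) =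
        (rootings t).map fun _ => treeMk k id t :=
      List.map_congr_left fun p hp =>
        (labelRoot_tmul k p.1 p.2).trans (treeMk_eq_of_mem_rootings k id t hp).symm
    rw [etaLin_treeMk, etaTree, map_list_sum, List.map_map, hroot, List.map_const',
      List.sum_replicate, length_rootings, ← Nat.cast_smul_eq_nsmul k, Nat.cast_add, Nat.cast_ofNat]
  | zero => simp only [map_zero, smul_zero]
  | add x y _ _ hx hy => simp only [map_add, hx, hy, smul_add]
  | smul r x _ hx => simp only [map_smul, hx, smul_comm r]

end Glue

/-! ### The inverse of `η` -/

section Eta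

variable (k : Type u) [Field k] {H : Type v} [AddCommGroup H] [Module k H]

attribute [local instance] LieRing.ofAssociativeRing LieAlgebra.ofAssociativeAlgebra

theorem lieToTensor_ι (v : H) : lieToTensor k H (L.ι k H v) = TensorAlgebra.ι k v :=
  FreeLieAlgebra.lift_of_apply _ _

theorem lieToTensor_lie (x y : L k H) :
    lieToTensor k H ⁅x, y⁆ = ⁅lieToTensor k H x, lieToTensor k H y⁆ := by
  obtain ⟨x, rfl⟩ := Submodule.mkQ_surjective _ x
  obtain ⟨y, rfl⟩ := Submodule.mkQ_surjective _ y
  exact LieHom.map_lie (FreeLieAlgebra.lift k (TensorAlgebra.ι k : H → TensorAlgebra k H)) x y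

variable (H) in
/-- The action of the tensor algebra on `(H ⊗ L(H)) × L(H) × k` in which a vector `v` sends
`(m, x, c)` to `(v ⊗ x, ⁅v, x⁆ + c v, 0)`. On the middle factor it combines the adjoint action with
right-normed bracketing, and the first factor records the first letter of a word. -/
def splitAct : TensorAlgebra k H →ₐ[k] Module.End k ((H ⊗[k] L k H) × L k H × k) :=
  TensorAlgebra.lift k
    { toFun := fun v =>
        LinearMap.prod
          (TensorProduct.mk k H (L k H) v ∘ₗ LinearMap.fst k _ _ ∘ₗ LinearMap.snd k _ _)
          (LinearMap.prod
            ((LieModule.toEnd k (L k H) (L k H) (L.ι k H v)) ∘ₗ LinearMap.fst k _ _ ∘ₗ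
                LinearMap.snd k _ _ +
              (LinearMap.snd k _ _ ∘ₗ LinearMap.snd k _ _).smulRight (L.ι k H v)) 0)
      map_add' := fun v w => by
        refine LinearMap.ext fun ⟨m, x, c⟩ => ?_
        simp only [map_add, LinearMap.prod_apply, LinearMap.coe_comp, LinearMap.coe_fst,
          LinearMap.coe_snd, Function.prod_apply, Function.comp_apply, LinearMap.add_apply,
          TensorProduct.mk_apply, LieModule.toEnd_apply_apply, LinearMap.coe_smulRight, smul_add,
          LinearMap.zero_apply, Prod.mk_add_mk, add_zero, Prod.mk.injEq, and_true, true_and]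
        abel
      map_smul' := fun r v => by
        refine LinearMap.ext fun ⟨m, x, c⟩ => ?_
        simp [TensorProduct.smul_tmul', smul_comm c r] }

theorem splitAct_ι (v : H) (m : H ⊗[k] L k H) (x : L k H) (c : k) :
    splitAct k H (TensorAlgebra.ι k v) (m, x, c) =
      (v ⊗ₜ x, ⁅L.ι k H v, x⁆ + c • L.ι k H v, 0) := by
  simp [splitAct]

/-- The first component of the action of the rooted tree `a` on `(0, 0, 1)` under `splitAct`. -/
def splitTree : FreeMagma H → H ⊗[k] L k H
  | .of _ => 0
  | .mul a b => ((leavesR b).length : k) • etaAux k a (lieOf k b) -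
      ((leavesR a).length : k) • etaAux k b (lieOf k a)

theorem splitTree_mul (a b : FreeMagma H) : splitTree k (a * b) =
    ((leavesR b).length : k) • etaAux k a (lieOf k b) -
      ((leavesR a).length : k) • etaAux k b (lieOf k a) := rfl

theorem splitAct_lieOf (a : FreeMagma H) (m : H ⊗[k] L k H) (x : L k H) (c : k) :
    splitAct k H (lieToTensor k H (lieOf k a)) (m, x, c) =
      (etaAux k a x + c • splitTree k a,
        ⁅lieOf k a, x⁆ + (c * (leavesR a).length) • lieOf k a, 0) := by
  induction a generalizing m x c with
  | ih1 v => simp [lieToTensor_ι, splitAct_ι, splitTree]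
  | ih2 a b iha ihb =>
    rw [lieOf_mul, lieToTensor_lie, LieRing.of_associative_ring_bracket, map_sub, map_mul, map_mul,
      LinearMap.sub_apply, Module.End.mul_apply, Module.End.mul_apply, iha, ihb, iha, ihb]
    simp only [zero_smul, add_zero, zero_mul, Prod.mk_sub_mk, etaAux_add, etaAux_smul, lie_add,
      lie_smul, etaAux_mul, leavesR_mul, List.length_append, sub_self, splitTree_mul]
    refine Prod.ext ?_ (Prod.ext ?_ rfl)
    · simp only [eq_neg_of_add_eq_zero_left (etaAux_skew k b x (lieOf k a))]
      module
    · rw [lie_lie, ← lie_skew (lieOf k a) (lieOf k b)]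
      push_cast
      module

variable (H) in
/-- The linear extension of `splitTree` to the free Lie algebra. -/
def splitLie : L k H →ₗ[k] H ⊗[k] L k H :=
  LinearMap.fst k _ _ ∘ₗ LinearMap.applyₗ (0, 0, 1) ∘ₗ (splitAct k H).toLinearMap ∘ₗ
    lieToTensor k H

theorem splitLie_lieOf (a : FreeMagma H) : splitLie k H (lieOf k a) = splitTree k a := by
  change (splitAct k H (lieToTensor k H (lieOf k a)) (0, 0, 1)).1 = _
  rw [splitAct_lieOf, etaAux_zero, zero_add, one_smul]

theorem splitLie_ι_lie (v : H) (a : FreeMagma H) :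
    splitLie k H ⁅L.ι k H v, lieOf k a⁆ =
      ((leavesR a).length : k) • v ⊗ₜ lieOf k a - etaAux k a (L.ι k H v) := by
  rw [← lieOf_of, ← lieOf_mul, splitLie_lieOf, splitTree_mul]
  simp only [etaAux_of, leavesR_of, List.length_singleton, Nat.cast_one, one_smul]

variable (H) in
theorem range_lTensor_LDeg (n : ℕ) : LinearMap.range ((LDeg k H n).subtype.lTensor H) =
    Submodule.span k {y | ∃ (v : H) (a : FreeMagma H), (leavesR a).length = n ∧
      v ⊗ₜ lieOf k a = y} := by
  refine le_antisymm ?_ (Submodule.span_le.2 ?_)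
  · rintro _ ⟨y, rfl⟩
    induction y using TensorProduct.induction_on with
    | zero => rw [map_zero]; exact zero_mem _
    | add y z hy hz => rw [map_add]; exact add_mem hy hz
    | tmul v y =>
      obtain ⟨y, hy⟩ := y
      refine (Submodule.span_le
        (p := (Submodule.span k _).comap (TensorProduct.mk k H _ v))).2 ?_ hy
      rintro _ ⟨a, ha, rfl⟩
      exact Submodule.subset_span ⟨v, a, ha, rfl⟩
  · rintro _ ⟨v, a, ha, rfl⟩
    exact ⟨v ⊗ₜ ⟨lieOf k a, Submodule.subset_span ⟨a, ha, rfl⟩⟩, rfl⟩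

theorem labelRoot_mem_TDeg [NeZero (2 : k)] {s : ℕ} {y : H ⊗[k] L k H}
    (hy : y ∈ LinearMap.range ((LDeg k H (s + 1)).subtype.lTensor H)) :
    labelRoot k H y ∈ TDeg k H s := by
  rw [range_lTensor_LDeg] at hy
  refine (Submodule.span_le (p := (TDeg k H s).comap (labelRoot k H))).2 ?_ hy
  rintro _ ⟨v, a, ha, rfl⟩
  refine Submodule.subset_span ⟨(.of v, a), ?_, labelRoot_tmul k v a⟩
  rw [leavesR_length] at ha
  simpa [trivalent] using ha

theorem etaLin_labelRoot [NeZero (2 : k)] {s : ℕ} {y : H ⊗[k] L k H}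
    (hy : y ∈ LinearMap.range ((LDeg k H (s + 1)).subtype.lTensor H)) :
    etaLin k H (labelRoot k H y) = ((s : k) + 2) • y - splitLie k H (bracketing k H y) := by
  rw [range_lTensor_LDeg] at hy
  induction hy using Submodule.span_induction with
  | mem y hy =>
    obtain ⟨v, a, ha, rfl⟩ := hy
    rw [labelRoot_tmul, etaLin_treeMk, etaTree_eq, bracketing_tmul, splitLie_ι_lie, ha, etaAux_of,
      lieOf_of]
    push_cast
    module
  | zero => simp only [map_zero, smul_zero, sub_zero]
  | add y z _ _ hy hz => simp only [map_add, hy, hz]; module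
  | smul r y _ hy => simp only [map_smul, hy]; module

variable (H) in
theorem eta_bijective [CharZero k] (s : ℕ) : Function.Bijective (eta k H s) := by
  have hs : (s : k) + 2 ≠ 0 := by
    exact_mod_cast (Nat.cast_ne_zero (R := k)).2 (Nat.succ_ne_zero (s + 1))
  constructor
  · rintro ⟨x, hx⟩ ⟨y, hy⟩ hxy
    have hlabel := congrArg (labelRoot k H) (congrArg Subtype.val hxy)
    change labelRoot k H (etaLin k H x) = labelRoot k H (etaLin k H y) at hlabel
    rw [labelRoot_etaLin k hx, labelRoot_etaLin k hy] at hlabel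
    exact Subtype.ext (smul_right_injective _ hs hlabel)
  · rintro ⟨y, hy, hbr⟩
    refine ⟨⟨((s : k) + 2)⁻¹ • labelRoot k H y, Submodule.smul_mem _ _ (labelRoot_mem_TDeg k hy)⟩,
      Subtype.ext ?_⟩
    change etaLin k H (((s : k) + 2)⁻¹ • labelRoot k H y) = y
    rw [map_smul, etaLin_labelRoot k hy, LinearMap.mem_ker.1 hbr, map_zero, sub_zero,
      inv_smul_smul₀ hs]

end Eta

/-! ### Sums over the leaves of a tree as roots -/

section RootSum

variable {X : Type v} {𝔤 : Type*} [LieRing 𝔤] (p : X → 𝔤)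

/-- The iterated bracket represented by a rooted tree, for leaves evaluated by `p`. -/
def evalTree : FreeMagma X → 𝔤
  | .of x => p x
  | .mul a b => ⁅evalTree a, evalTree b⁆

@[simp] theorem evalTree_of (x : X) : evalTree p (.of x) = p x := rfl
@[simp] theorem evalTree_mul (a b : FreeMagma X) :
    evalTree p (a * b) = ⁅evalTree p a, evalTree p b⁆ := rfl

variable {k : Type u} [Field k] [LieAlgebra k 𝔤] {M : Type*} [AddCommGroup M] [Module k M]
  (ψ : X → 𝔤 →ₗ[k] M)

/-- The sum over the leaves `x` of `a` of the values of `ψ x` at the tree rooted at `x` which is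
obtained by gluing to the root of `a` a tree representing the given element of `𝔤`. -/
def rootSum : FreeMagma X → 𝔤 →ₗ[k] M
  | .of x => ψ x
  | .mul a b =>
    rootSum a ∘ₗ (LieAlgebra.ad k 𝔤 (evalTree p b)) -
      rootSum b ∘ₗ (LieAlgebra.ad k 𝔤 (evalTree p a))

@[simp] theorem rootSum_of (x : X) : rootSum p ψ (.of x) = ψ x := rfl
@[simp] theorem rootSum_mul (a b : FreeMagma X) (z : 𝔤) :
    rootSum p ψ (a * b) z =
      rootSum p ψ a ⁅evalTree p b, z⁆ + rootSum p ψ b ⁅z, evalTree p a⁆ := by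
  rw [← lie_skew z, map_neg, ← sub_eq_add_neg]
  rfl

/-- The sum over all leaves `x` of the tree `t` of the values of `ψ x` at the tree rooted at `x`. -/
def treeSum (t : UTree X) : M :=
  rootSum p ψ t.1 (evalTree p t.2) + rootSum p ψ t.2 (evalTree p t.1)

theorem treeSum_flip (a b : FreeMagma X) : treeSum p ψ (a, b) = treeSum p ψ (b, a) :=
  add_comm _ _

theorem treeSum_move (a b c : FreeMagma X) :
    treeSum p ψ (a * b, c) = treeSum p ψ (a, b * c) := by
  simp only [treeSum, rootSum_mul, evalTree_mul, add_assoc]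

theorem treeSum_antisymm (a b c : FreeMagma X) :
    treeSum p ψ (a, b * c) + treeSum p ψ (a, c * b) = 0 := by
  have rootSum_skew (a : FreeMagma X) (x y : 𝔤) :
      rootSum p ψ a ⁅x, y⁆ = -rootSum p ψ a ⁅y, x⁆ := by rw [← map_neg, lie_skew]
  simp only [treeSum, rootSum_mul, evalTree_mul]
  rw [rootSum_skew a, rootSum_skew b, rootSum_skew c]
  abel

theorem treeSum_ihx (a b c d : FreeMagma X) :
    treeSum p ψ (a, b * c * d) + treeSum p ψ (a, c * d * b) + treeSum p ψ (a, d * b * c) =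
      0 := by
  have hroot (a : FreeMagma X) (x y z : 𝔤) : rootSum p ψ a ⁅⁅x, y⁆, z⁆ +
      rootSum p ψ a ⁅⁅y, z⁆, x⁆ + rootSum p ψ a ⁅⁅z, x⁆, y⁆ = 0 := by
    rw [← map_add, ← map_add, ← lie_skew ⁅x, y⁆ z, ← lie_skew ⁅y, z⁆ x, ← lie_skew ⁅z, x⁆ y,
      ← neg_add, ← neg_add, lie_jacobi, neg_zero, map_zero]
  have hleaf (a : FreeMagma X) (x y z : 𝔤) : rootSum p ψ a ⁅x, ⁅y, z⁆⁆ +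
      rootSum p ψ a ⁅z, ⁅x, y⁆⁆ + rootSum p ψ a ⁅⁅x, z⁆, y⁆ = 0 := by
    rw [← map_add, ← map_add, ← lie_skew ⁅x, z⁆ y, ← lie_skew x z, lie_neg, neg_neg,
      add_right_comm, lie_jacobi, map_zero]
  have hsum := congrArg₂ (· + ·)
    (congrArg₂ (· + ·) (hroot a (evalTree p b) (evalTree p c) (evalTree p d))
      (hleaf b (evalTree p c) (evalTree p d) (evalTree p a)))
    (congrArg₂ (· + ·) (hleaf c (evalTree p d) (evalTree p b) (evalTree p a))
      (hleaf d (evalTree p b) (evalTree p c) (evalTree p a)))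
  simp only [add_zero] at hsum
  simp only [treeSum, rootSum_mul, evalTree_mul]
  rw [← hsum]
  abel

/-- `treeSum` as a linear map on the space of trees. -/
def treeSumLin {H : Type v} [AddCommGroup H] [Module k H] (lab : H → X)
    (hp : ∀ (r : k) v w, p (lab (r • v + w)) = r • p (lab v) + p (lab w))
    (hψ : ∀ (r : k) v w a, ψ (lab (r • v + w)) (evalTree p a) =
      r • ψ (lab v) (evalTree p a) + ψ (lab w) (evalTree p a)) :
    TreeSpace k lab →ₗ[k] M :=
  treeLift k lab (treeSum p ψ) (treeSum_flip p ψ) (treeSum_move p ψ)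
    (treeSum_antisymm p ψ) (treeSum_ihx p ψ) fun r v w a => by
      simp only [treeSum, rootSum_of, evalTree_of, hp, hψ, map_add, map_smul]
      module

theorem treeSumLin_mk {H : Type v} [AddCommGroup H] [Module k H] (lab : H → X)
    (hp : ∀ (r : k) v w, p (lab (r • v + w)) = r • p (lab v) + p (lab w))
    (hψ : ∀ (r : k) v w a, ψ (lab (r • v + w)) (evalTree p a) =
      r • ψ (lab v) (evalTree p a) + ψ (lab w) (evalTree p a)) (t : UTree X) :
    treeSumLin p ψ lab hp hψ (treeMk k lab t) = treeSum p ψ t :=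
  treeLift_mk ..

end RootSum

/-! ### Traces of trees with values in an associative algebra -/

section AlgTrace

variable {k : Type u} [Field k] {X : Type v} {A : Type*} [Ring A] [Algebra k A] (p : X → A)

attribute [local instance] LieRing.ofAssociativeRing in
/-- The iterated commutator represented by a rooted tree. -/
def comm : FreeMagma X → A := evalTree p

/-- The first letter of the commutator `comm p a`, evaluated by `φ` and removed. -/
def firstLetter (φ : X → k) : FreeMagma X → A
  | .of x => algebraMap k A (φ x)
  | .mul a b => firstLetter φ a * comm p b - firstLetter φ b * comm p a

@[simp] theorem comm_of (x : X) : comm p (.of x) = p x := rfl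
@[simp] theorem comm_mul (a b : FreeMagma X) :
    comm p (a * b) = comm p a * comm p b - comm p b * comm p a := rfl
@[simp] theorem firstLetter_of (φ : X → k) (x : X) :
    firstLetter p φ (.of x) = algebraMap k A (φ x) := rfl
@[simp] theorem firstLetter_mul (φ : X → k) (a b : FreeMagma X) : firstLetter p φ (a * b) =
    firstLetter p φ a * comm p b - firstLetter p φ b * comm p a := rfl

theorem firstLetter_congr {φ ψ : X → k} (a : FreeMagma X) (h : ∀ x ∈ leavesR a, φ x = ψ x) :
    firstLetter p φ a = firstLetter p ψ a := by
  induction a with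
  | ih1 x => rw [firstLetter_of, firstLetter_of, h x (by simp)]
  | ih2 a b ha hb =>
    simp only [leavesR_mul, List.mem_append] at h
    rw [firstLetter_mul, firstLetter_mul, ha fun x hx => h x (Or.inl hx),
      hb fun x hx => h x (Or.inr hx)]

theorem firstLetter_zero (a : FreeMagma X) : firstLetter p (fun _ => (0 : k)) a = 0 := by
  induction a with
  | ih1 x => simp
  | ih2 a b ha hb => simp [ha, hb]

theorem firstLetter_eq_zero {φ : X → k} (a : FreeMagma X) (h : ∀ x ∈ leavesR a, φ x = 0) :
    firstLetter p φ a = 0 :=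
  (firstLetter_congr p a h).trans (firstLetter_zero p a)

theorem firstLetter_neg (φ : X → k) (a : FreeMagma X) :
    firstLetter p (fun x => -φ x) a = -firstLetter p φ a := by
  induction a with
  | ih1 x => simp
  | ih2 a b ha hb => rw [firstLetter_mul, firstLetter_mul, ha, hb]; noncomm_ring

theorem comm_map {Y : Type v} (f : Y → X) (a : FreeMagma Y) :
    comm p (FreeMagma.map f a) = comm (p ∘ f) a := by
  induction a with
  | ih1 x => rfl
  | ih2 a b ha hb => simp [ha, hb]

theorem firstLetter_map {Y : Type v} (f : Y → X) (φ : X → k) (a : FreeMagma Y) :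
    firstLetter p φ (FreeMagma.map f a) = firstLetter (p ∘ f) (φ ∘ f) a := by
  induction a with
  | ih1 x => rfl
  | ih2 a b ha hb => simp [ha, hb, comm_map]

/-- The part of `algTrace` that comes from the leaves of `a` as roots. -/
def algTraceR (β : X → X → k) (a c : FreeMagma X) : A :=
  ((rootingsR a c).map fun q => firstLetter p (β q.1) q.2).sum

/-- The sum over all leaves `x` of the tree `t`, regarded as roots: the first letter of the
commutator represented by `t_x` is contracted with `x`. -/
def algTrace (β : X → X → k) (t : UTree X) : A :=
  ((rootings t).map fun q => firstLetter p (β q.1) q.2).sum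

theorem algTrace_eq (β : X → X → k) (a b : FreeMagma X) :
    algTrace p β (a, b) = algTraceR p β a b + algTraceR p β b a := by
  simp [algTrace, algTraceR, rootings]

@[simp] theorem algTraceR_of (β : X → X → k) (x : X) (c : FreeMagma X) :
    algTraceR p β (.of x) c = firstLetter p (β x) c := by
  simp [algTraceR]

@[simp] theorem algTraceR_mul (β : X → X → k) (a b c : FreeMagma X) :
    algTraceR p β (a * b) c = algTraceR p β a (b * c) + algTraceR p β b (c * a) := by
  simp [algTraceR]

theorem algTraceR_eq_zero {β : X → X → k} {a : FreeMagma X}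
    (h : ∀ x ∈ leavesR a, β x = fun _ => 0) (c : FreeMagma X) : algTraceR p β a c = 0 := by
  induction a generalizing c with
  | ih1 x => rw [algTraceR_of, h x (by simp), firstLetter_zero]
  | ih2 a b ha hb =>
    simp only [leavesR_mul, List.mem_append] at h
    rw [algTraceR_mul, ha fun x hx => h x (Or.inl hx), hb fun x hx => h x (Or.inr hx), add_zero]

theorem rootingsR_map {Y : Type v} (f : Y → X) (a c : FreeMagma Y) :
    rootingsR (FreeMagma.map f a) (FreeMagma.map f c) =
      (rootingsR a c).map (Prod.map f (FreeMagma.map f)) := by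
  induction a generalizing c with
  | ih1 x => rfl
  | ih2 a b ha hb => simp only [map_mul, rootingsR_mul, List.map_append, ← ha, ← hb]

theorem rootings_relabel {Y : Type v} (f : Y → X) (t : UTree Y) :
    rootings (relabel f t) = (rootings t).map (Prod.map f (FreeMagma.map f)) := by
  simp [rootings, relabel, rootingsR_map]

theorem algTrace_relabel {Y : Type v} (f : Y → X) (β : X → X → k) (t : UTree Y) :
    algTrace p β (relabel f t) = algTrace (p ∘ f) (fun x y => β (f x) (f y)) t := by
  rw [algTrace, rootings_relabel, List.map_map]
  exact congrArg List.sum (List.map_congr_left fun q _ => firstLetter_map p f _ q.2)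

theorem algTrace_congr {β γ : X → X → k} (t : UTree X)
    (h : ∀ x ∈ leaves t, ∀ y ∈ leaves t, β x y = γ x y) : algTrace p β t = algTrace p γ t := by
  refine congrArg List.sum (List.map_congr_left fun q hq => ?_)
  have hperm := rootings_perm t q hq
  exact firstLetter_congr p _ fun y hy =>
    h _ (hperm.subset List.mem_cons_self) y (hperm.subset (List.mem_cons_of_mem _ hy))

theorem algTrace_neg (β : X → X → k) (t : UTree X) :
    algTrace p (fun x y => -β x y) t = -algTrace p β t := by
  simp only [algTrace, firstLetter_neg, List.sum_neg, List.map_map, Function.comp_def]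

/-! ### Compatibility of the traces with the relations between trees -/

/-- Pairs of a value in `A` and its first letters, the letter `x` being removed by `β x`. This is
the commutator Lie algebra of the product `(w, f) * (w', f') = (w * w', fun x => f x * w')`. -/
def FirstLetters (X A : Type*) := A × (X → A)

instance : AddCommGroup (FirstLetters X A) := inferInstanceAs (AddCommGroup (A × (X → A)))

instance : Module k (FirstLetters X A) := inferInstanceAs (Module k (A × (X → A)))

instance : LieRing (FirstLetters X A) where
  bracket e f := (e.1 * f.1 - f.1 * e.1, fun x => e.2 x * f.1 - f.2 x * e.1)
  add_lie e f g := Prod.ext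
    (show (e.1 + f.1) * g.1 - g.1 * (e.1 + f.1) = _ + _ by noncomm_ring)
    (funext fun x => show (e.2 x + f.2 x) * g.1 - g.2 x * (e.1 + f.1) = _ + _ by noncomm_ring)
  lie_add e f g := Prod.ext
    (show e.1 * (f.1 + g.1) - (f.1 + g.1) * e.1 = _ + _ by noncomm_ring)
    (funext fun x => show e.2 x * (f.1 + g.1) - (f.2 x + g.2 x) * e.1 = _ + _ by noncomm_ring)
  lie_self e := Prod.ext (sub_self _) (funext fun _ => sub_self _)
  leibniz_lie e f g := Prod.ext
    (show e.1 * (f.1 * g.1 - g.1 * f.1) - (f.1 * g.1 - g.1 * f.1) * e.1 =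
      ((e.1 * f.1 - f.1 * e.1) * g.1 - g.1 * (e.1 * f.1 - f.1 * e.1)) +
        (f.1 * (e.1 * g.1 - g.1 * e.1) - (e.1 * g.1 - g.1 * e.1) * f.1) by noncomm_ring)
    (funext fun x => show
      e.2 x * (f.1 * g.1 - g.1 * f.1) - (f.2 x * g.1 - g.2 x * f.1) * e.1 =
      ((e.2 x * f.1 - f.2 x * e.1) * g.1 - g.2 x * (e.1 * f.1 - f.1 * e.1)) +
        (f.2 x * (e.1 * g.1 - g.1 * e.1) - (e.2 x * g.1 - g.2 x * e.1) * f.1) by noncomm_ring)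

instance : LieAlgebra k (FirstLetters X A) where
  lie_smul r e f := Prod.ext
    (show e.1 * r • f.1 - r • f.1 * e.1 = r • (e.1 * f.1 - f.1 * e.1) by
      rw [mul_smul_comm, smul_mul_assoc, smul_sub])
    (funext fun x => show e.2 x * r • f.1 - r • f.2 x * e.1 = r • (e.2 x * f.1 - f.2 x * e.1) by
      rw [mul_smul_comm, smul_mul_assoc, smul_sub])

variable (β : X → X → k)

/-- The value and the first letters of a single letter. -/
def firstLettersOf (y : X) : FirstLetters X A := (p y, fun x => algebraMap k A (β x y))

theorem evalTree_firstLettersOf (a : FreeMagma X) :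
    evalTree (firstLettersOf p β) a = (comm p a, fun x => firstLetter p (β x) a) := by
  induction a with
  | ih1 y => rfl
  | ih2 a b ha hb => rw [evalTree_mul, ha, hb]; rfl

/-- The component of the first letter `x`. -/
def FirstLetters.component (x : X) : FirstLetters X A →ₗ[k] A :=
  LinearMap.proj x ∘ₗ LinearMap.snd k A (X → A)

theorem component_evalTree (x : X) (a : FreeMagma X) :
    FirstLetters.component (k := k) x (evalTree (firstLettersOf p β) a) =
      firstLetter p (β x) a := by
  rw [evalTree_firstLettersOf]
  rfl

theorem algTraceR_eq_rootSum (a c : FreeMagma X) : algTraceR p β a c =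
    rootSum (firstLettersOf p β) (FirstLetters.component (k := k)) a
      (evalTree (firstLettersOf p β) c) := by
  induction a generalizing c with
  | ih1 x => rw [algTraceR_of, rootSum_of, component_evalTree]
  | ih2 a b ha hb => rw [algTraceR_mul, ha, hb, rootSum_mul, evalTree_mul, evalTree_mul]

theorem algTrace_eq_treeSum (t : UTree X) :
    algTrace p β t = treeSum (firstLettersOf p β) (FirstLetters.component (k := k)) t := by
  rw [treeSum, ← algTraceR_eq_rootSum, ← algTraceR_eq_rootSum, ← algTrace_eq]

/-- The trace as a linear map on the space of trees. -/
def algTraceLin {H : Type v} [AddCommGroup H] [Module k H] (lab : H → X)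
    (hp : ∀ (r : k) v w, p (lab (r • v + w)) = r • p (lab v) + p (lab w))
    (hβ : ∀ v, β (lab v) = fun _ => 0) (hβ' : ∀ x v, β x (lab v) = 0) :
    TreeSpace k lab →ₗ[k] A :=
  treeSumLin (firstLettersOf p β) (FirstLetters.component (k := k)) lab
    (fun r v w => Prod.ext (hp r v w) (funext fun x => show algebraMap k A (β x _) =
      r • algebraMap k A (β x _) + algebraMap k A (β x _) by simp [hβ']))
    fun r v w a => by simp only [component_evalTree, hβ, firstLetter_zero, smul_zero, add_zero]

theorem algTraceLin_mk {H : Type v} [AddCommGroup H] [Module k H] (lab : H → X)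
    (hp : ∀ (r : k) v w, p (lab (r • v + w)) = r • p (lab v) + p (lab w))
    (hβ : ∀ v, β (lab v) = fun _ => 0) (hβ' : ∀ x v, β x (lab v) = 0) (t : UTree X) :
    algTraceLin p β lab hp hβ hβ' (treeMk k lab t) = algTrace p β t :=
  (treeSumLin_mk ..).trans (algTrace_eq_treeSum p β t).symm

end AlgTrace

/-! ### Reversal -/

section Reverse

variable {k : Type u} [Field k] {X : Type v} {A : Type*} [Ring A] [Algebra k A] (p : X → A)
  (β : X → X → k)

open MulOpposite

/-- The contribution to `algTrace` of the pairs of a leaf `x` of `a` and a leaf `y` of `b`, with a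
factor `m` inserted: the sum of the products `β x y • w' * m * w`, where `y w'` is a term of
`comm p b` and `w` is the signed reversal of a word `u` such that `x u` is a term of `comm p a`. -/
def pairing : FreeMagma X → A → FreeMagma X → A
  | .of x, m, b => firstLetter p (β x) b * m
  | .mul a₁ a₂, m, b => pairing a₂ (m * comm p a₁) b - pairing a₁ (m * comm p a₂) b

@[simp] theorem pairing_of (x : X) (m : A) (b : FreeMagma X) :
    pairing p β (.of x) m b = firstLetter p (β x) b * m := rfl
@[simp] theorem pairing_mul (a₁ a₂ : FreeMagma X) (m : A) (b : FreeMagma X) :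
    pairing p β (a₁ * a₂) m b =
      pairing p β a₂ (m * comm p a₁) b - pairing p β a₁ (m * comm p a₂) b := rfl

theorem pairing_neg (a : FreeMagma X) (m : A) (b : FreeMagma X) :
    pairing p β a (-m) b = -pairing p β a m b := by
  induction a generalizing m with
  | ih1 x => simp
  | ih2 a₁ a₂ h₁ h₂ => simp only [pairing_mul, neg_mul, h₁, h₂]; abel

theorem pairing_mul_right (a : FreeMagma X) (m : A) (b c : FreeMagma X) :
    pairing p β a m (b * c) =
      pairing p β a (comm p c * m) b - pairing p β a (comm p b * m) c := by
  induction a generalizing m with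
  | ih1 x => simp only [pairing_of, firstLetter_mul]; noncomm_ring
  | ih2 a₁ a₂ h₁ h₂ => simp only [pairing_mul, h₁, h₂, mul_assoc]; abel

/-- The contribution to `algTraceR p β a c` of the pairs of leaves of `a`. -/
def innerTrace (a c : FreeMagma X) : A := algTraceR p β a c - pairing p β a 1 c

theorem innerTrace_mul (a b c : FreeMagma X) : innerTrace p β (a * b) c =
    innerTrace p β a (b * c) + innerTrace p β b (c * a) +
      (pairing p β a (comm p c) b - pairing p β b (comm p c) a) := by
  simp only [innerTrace, algTraceR_mul, pairing_mul, pairing_mul_right, one_mul, mul_one]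
  abel

theorem algTrace_eq_innerTrace (a b : FreeMagma X) : algTrace p β (a, b) =
    innerTrace p β a b + innerTrace p β b a + (pairing p β a 1 b + pairing p β b 1 a) := by
  rw [algTrace_eq, innerTrace, innerTrace]
  abel

variable (S : A →ₐ[k] Aᵐᵒᵖ) (hS : ∀ x, S (p x) = op (-p x))

include hS

theorem reverse_comm (a : FreeMagma X) : S (comm p a) = op (-comm p a) := by
  induction a with
  | ih1 x => exact hS x
  | ih2 a b ha hb =>
    rw [comm_mul, map_sub, map_mul, map_mul, ha, hb, ← op_mul, ← op_mul, ← op_sub]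
    congr 1
    noncomm_ring

theorem reverse_firstLetter (x : X) (b : FreeMagma X) (n : A) :
    S (firstLetter p (β x) b) * op n = op (pairing p (fun x y => β y x) b n (.of x)) := by
  induction b generalizing n with
  | ih1 y =>
    rw [firstLetter_of, pairing_of, firstLetter_of, AlgHom.commutes, MulOpposite.algebraMap_apply,
      ← op_mul, Algebra.commutes]
  | ih2 b₁ b₂ h₁ h₂ =>
    rw [pairing_mul, op_sub, ← h₁, ← h₂, firstLetter_mul, map_sub, map_mul, map_mul,
      reverse_comm p S hS, reverse_comm p S hS, sub_mul, mul_assoc, mul_assoc, ← op_mul, ← op_mul,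
      mul_neg, mul_neg, op_neg, op_neg, mul_neg, mul_neg]
    abel

theorem reverse_pairing (a : FreeMagma X) (m : A) (b : FreeMagma X) :
    S (pairing p β a m b) = op (pairing p (fun x y => β y x) b (unop (S m)) a) := by
  induction a generalizing m with
  | ih1 x => rw [pairing_of, map_mul, ← reverse_firstLetter p β S hS, op_unop]
  | ih2 a₁ a₂ h₁ h₂ =>
    rw [pairing_mul, map_sub, h₁, h₂, map_mul, map_mul, reverse_comm p S hS, reverse_comm p S hS,
      unop_mul, unop_mul, unop_op, unop_op, neg_mul, neg_mul, pairing_neg, pairing_neg,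
      pairing_mul_right, ← op_sub]
    congr 1
    abel

theorem reverse_innerTrace (a c : FreeMagma X) :
    S (innerTrace p β a c) = op (innerTrace p (fun x y => β y x) a c) := by
  induction a generalizing c with
  | ih1 x => simp [innerTrace]
  | ih2 a b ha hb =>
    rw [innerTrace_mul, innerTrace_mul, map_add, map_add, ha, hb, map_sub, reverse_pairing p β S hS,
      reverse_pairing p β S hS, reverse_comm p S hS, unop_op, pairing_neg, pairing_neg, ← op_sub,
      ← op_add, ← op_add]
    congr 1
    abel

/-- The reversal exchanges the two ends of the path between any two leaves, so it transposes the
form. -/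
theorem reverse_algTrace (t : UTree X) :
    S (algTrace p β t) = op (algTrace p (fun x y => β y x) t) := by
  obtain ⟨a, b⟩ := t
  simp only [algTrace_eq_innerTrace, map_add, reverse_innerTrace p β S hS,
    reverse_pairing p β S hS, map_one, unop_one, op_add]
  abel

end Reverse

/-! ### Words and their coinvariants -/

section Words

open MulOpposite

variable (k : Type u) [Field k] {H : Type v} [AddCommGroup H] [Module k H]

/-- The product of vectors in the tensor algebra. -/
def word (l : List H) : TensorAlgebra k H := (l.map (TensorAlgebra.ι k)).prod

@[simp] theorem word_nil : word k ([] : List H) = 1 := rfl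

@[simp] theorem word_cons (v : H) (l : List H) :
    word k (v :: l) = TensorAlgebra.ι k v * word k l := by simp [word]

theorem ι_mul_word_ofFn (v : H) {n : ℕ} (x : Fin n → H) :
    TensorAlgebra.ι k v * word k (List.ofFn x) =
      word k (List.ofFn (Fin.cons (α := fun _ => H) v x)) := by
  rw [List.ofFn_cons, word_cons]

theorem word_append (l l' : List H) : word k (l ++ l') = word k l * word k l' := by simp [word]

theorem span_word : Submodule.span k (Set.range (word k (H := H))) = ⊤ := by
  rw [eq_top_iff]
  rintro x -
  induction x using TensorAlgebra.induction with
  | algebraMap r =>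
    rw [Algebra.algebraMap_eq_smul_one, ← word_nil k (H := H)]
    exact Submodule.smul_mem _ _ (Submodule.subset_span ⟨_, rfl⟩)
  | ι v => exact Submodule.subset_span ⟨[v], by simp⟩
  | mul a b ha hb =>
    have hab := Submodule.mul_mem_mul ha hb
    rw [Submodule.span_mul_span] at hab
    refine Submodule.span_mono ?_ hab
    rintro _ ⟨_, ⟨l, rfl⟩, _, ⟨l', rfl⟩, rfl⟩
    exact ⟨l ++ l', word_append k l l'⟩
  | add a b ha hb => exact add_mem ha hb

theorem linearMap_ext_word {M : Type*} [AddCommGroup M] [Module k M]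
    {f g : TensorAlgebra k H →ₗ[k] M}
    (h : ∀ (n : ℕ) (x : Fin n → H), f (word k (List.ofFn x)) = g (word k (List.ofFn x))) :
    f = g :=
  LinearMap.ext_on_range (span_word k) fun l => by simpa only [List.ofFn_get] using h _ l.get

variable (H) in
/-- The projection of the tensor algebra onto a tensor power. -/
def tensorPart (s : ℕ) : TensorAlgebra k H →ₗ[k] ⨂[k]^s H :=
  DirectSum.component k ℕ (fun n => ⨂[k]^n H) s ∘ₗ
    (TensorAlgebra.toDirectSum (R := k) (M := H)).toLinearMap

theorem toDirectSum_word {n : ℕ} (x : Fin n → H) :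
    TensorAlgebra.toDirectSum (word k (List.ofFn x)) =
      DirectSum.of (fun n => ⨂[k]^n H) n (PiTensorProduct.tprod k x) := by
  rw [← TensorAlgebra.toDirectSum_tensorPower_tprod, TensorAlgebra.tprod_apply, word,
    List.map_ofFn]
  rfl

theorem tensorPart_word {n : ℕ} (x : Fin n → H) :
    tensorPart k H n (word k (List.ofFn x)) = PiTensorProduct.tprod k x := by
  change (TensorAlgebra.toDirectSum (word k (List.ofFn x))) n = _
  rw [toDirectSum_word, DirectSum.of_eq_same]

theorem tensorPart_word_of_ne {n s : ℕ} (h : n ≠ s) (x : Fin n → H) :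
    tensorPart k H s (word k (List.ofFn x)) = 0 := by
  change (TensorAlgebra.toDirectSum (word k (List.ofFn x))) s = _
  rw [toDirectSum_word, DirectSum.of_eq_of_ne _ _ _ h.symm]

variable (H) in
/-- The antipode of the tensor algebra, as a homomorphism to the opposite algebra. -/
def antipode : TensorAlgebra k H →ₐ[k] (TensorAlgebra k H)ᵐᵒᵖ :=
  TensorAlgebra.lift k (-((opLinearEquiv k).toLinearMap ∘ₗ TensorAlgebra.ι k (M := H)))

theorem antipode_ι (v : H) : antipode k H (TensorAlgebra.ι k v) = op (-TensorAlgebra.ι k v) := by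
  simp [antipode]

theorem antipode_word (l : List H) :
    antipode k H (word k l) = op ((-1 : k) ^ l.length • word k l.reverse) := by
  induction l with
  | nil => simp
  | cons v l ih =>
    rw [word_cons, map_mul, ih, antipode_ι, List.reverse_cons, word_append, word_cons, word_nil,
      mul_one, List.length_cons, pow_succ, ← op_mul]
    simp

theorem reverse_ofFn {α : Type*} {n : ℕ} (x : Fin n → α) :
    (List.ofFn x).reverse = List.ofFn (x ∘ Fin.rev) := by
  refine List.ext_getElem (by simp) fun i hi hi' => ?_
  simp only [List.getElem_reverse, List.getElem_ofFn, List.length_ofFn, Function.comp_apply]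
  congr 1
  ext
  simp only [Fin.val_rev]
  omega

theorem rev_tensorPart (s : ℕ) (x : TensorAlgebra k H) :
    rev k H s (tensorPart k H s x) = -tensorPart k H s (unop (antipode k H x)) := by
  suffices h : rev k H s ∘ₗ tensorPart k H s = -(tensorPart k H s ∘ₗ
      (opLinearEquiv k).symm.toLinearMap ∘ₗ (antipode k H).toLinearMap) from LinearMap.congr_fun h x
  refine linearMap_ext_word k fun n x => ?_
  change rev k H s (tensorPart k H s _) = -tensorPart k H s (unop (antipode k H _))
  rw [antipode_word, unop_op, map_smul, reverse_ofFn, List.length_ofFn]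
  by_cases hn : n = s
  · subst hn
    rw [tensorPart_word, tensorPart_word, rev, LinearMap.smul_apply, LinearEquiv.coe_coe,
      PiTensorProduct.reindex_tprod, pow_succ, mul_neg_one, neg_smul]
    rfl
  · rw [tensorPart_word_of_ne k hn, tensorPart_word_of_ne k hn, map_zero, smul_zero, neg_zero]

variable (H) in
/-- The class of an element of the tensor algebra in the cyclic coinvariants. -/
def cyc (s : ℕ) : TensorAlgebra k H →ₗ[k] CycCoinv k H s := Submodule.mkQ _ ∘ₗ tensorPart k H s

variable (H) in
/-- The class of an element of the tensor algebra in the dihedral coinvariants. -/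
def dih (s : ℕ) : TensorAlgebra k H →ₗ[k] DihCoinv k H s := Submodule.mkQ _ ∘ₗ tensorPart k H s

theorem cycToDih_cyc (s : ℕ) (x : TensorAlgebra k H) :
    cycToDih k H s (cyc k H s x) = dih k H s x := rfl

theorem revCyc_cyc (s : ℕ) (x : TensorAlgebra k H) :
    revCyc k H s (cyc k H s x) = -cyc k H s (unop (antipode k H x)) := by
  change Submodule.mkQ _ (rev k H s (tensorPart k H s x)) = _
  rw [rev_tensorPart, map_neg]
  rfl

theorem cyc_mul_ι (s : ℕ) (x : TensorAlgebra k H) (v : H) :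
    cyc k H s (x * TensorAlgebra.ι k v) = cyc k H s (TensorAlgebra.ι k v * x) := by
  suffices h : cyc k H s ∘ₗ LinearMap.mulRight k (TensorAlgebra.ι k v) =
      cyc k H s ∘ₗ LinearMap.mulLeft k (TensorAlgebra.ι k v) from LinearMap.congr_fun h x
  refine linearMap_ext_word k fun n x => ?_
  have hsnoc : word k (List.ofFn x) * TensorAlgebra.ι k v =
      word k (List.ofFn (Fin.snoc (α := fun _ => H) x v)) := by
    rw [List.ofFn_succ', List.concat_eq_append, word_append]
    simp
  simp only [LinearMap.comp_apply, LinearMap.mulRight_apply, LinearMap.mulLeft_apply, cyc]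
  rw [hsnoc, ι_mul_word_ofFn]
  by_cases hn : n + 1 = s
  · subst hn
    rw [tensorPart_word, tensorPart_word, eq_comm, ← sub_eq_zero, ← map_sub]
    refine (Submodule.Quotient.mk_eq_zero _).2 ⟨PiTensorProduct.tprod k (Fin.snoc x v), ?_⟩
    rw [LinearMap.sub_apply, LinearMap.id_apply, LinearEquiv.coe_coe, rot,
      PiTensorProduct.reindex_tprod, Fin.snoc_eq_cons_rotate]
    simp
  · rw [tensorPart_word_of_ne k hn, tensorPart_word_of_ne k hn]

theorem cyc_mul_comm (s : ℕ) (x y : TensorAlgebra k H) :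
    cyc k H s (x * y) = cyc k H s (y * x) := by
  induction y using TensorAlgebra.induction generalizing x with
  | algebraMap r => rw [Algebra.commutes]
  | ι v => exact cyc_mul_ι k s x v
  | mul a b ha hb => rw [← mul_assoc, hb, ← mul_assoc, ha, mul_assoc]
  | add a b ha hb => rw [mul_add, add_mul, map_add, map_add, ha, hb]

theorem dih_mul_comm (s : ℕ) (x y : TensorAlgebra k H) :
    dih k H s (x * y) = dih k H s (y * x) :=
  congrArg (cycToDih k H s) (cyc_mul_comm k s x y)

theorem revCyc_revCyc (s : ℕ) (x : CycCoinv k H s) : revCyc k H s (revCyc k H s x) = x := by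
  obtain ⟨x, rfl⟩ := Submodule.mkQ_surjective _ x
  change Submodule.mkQ _ (rev k H s (rev k H s x)) = _
  congr 1
  suffices h : rev k H s ∘ₗ rev k H s = LinearMap.id from LinearMap.congr_fun h x
  ext v
  simp only [rev, LinearMap.compMultilinearMap_apply, LinearMap.comp_apply,
    LinearMap.smul_apply, map_smul, LinearEquiv.coe_coe, PiTensorProduct.reindex_tprod, smul_smul,
    ← mul_pow, Fin.revPerm_symm, mul_neg, mul_one, neg_neg, one_pow, one_smul, LinearMap.id_apply]
  exact congrArg _ (funext fun i => congrArg v (Fin.rev_rev i))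

theorem cycToDih_revCyc (s : ℕ) (x : CycCoinv k H s) :
    cycToDih k H s (revCyc k H s x) = cycToDih k H s x := by
  obtain ⟨x, rfl⟩ := Submodule.mkQ_surjective _ x
  rw [← sub_eq_zero, ← map_sub]
  exact (Submodule.Quotient.mk_eq_zero _).2 (Submodule.mem_sup_right ⟨x, rfl⟩)

theorem dih_antipode (s : ℕ) (x : TensorAlgebra k H) :
    dih k H s (unop (antipode k H x)) = -dih k H s x := by
  rw [← neg_eq_iff_eq_neg, ← cycToDih_cyc, ← map_neg, ← revCyc_cyc, cycToDih_revCyc, cycToDih_cyc]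

theorem exists_of_cycToDih_eq_zero (s : ℕ) (x : CycCoinv k H s) (hx : cycToDih k H s x = 0) :
    ∃ y, x = revCyc k H s y - y := by
  obtain ⟨x, rfl⟩ := Submodule.mkQ_surjective _ x
  obtain ⟨y, hy, z, ⟨w, rfl⟩, rfl⟩ := Submodule.mem_sup.1 ((Submodule.Quotient.mk_eq_zero _).1 hx)
  refine ⟨Submodule.mkQ _ w, ?_⟩
  rw [map_add, Submodule.mkQ_apply, (Submodule.Quotient.mk_eq_zero _).2 hy, zero_add]
  rfl

theorem cycToDih_bijective [NeZero (2 : k)] (s : ℕ) :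
    Function.Bijective ((cycToDih k H s).domRestrict
      (LinearMap.ker (revCyc k H s - LinearMap.id))) := by
  constructor
  · rw [← LinearMap.ker_eq_bot, LinearMap.ker_eq_bot']
    rintro ⟨x, hx⟩ h
    obtain ⟨y, rfl⟩ := exists_of_cycToDih_eq_zero k s x h
    rw [LinearMap.mem_ker, LinearMap.sub_apply, LinearMap.id_apply, map_sub, revCyc_revCyc,
      sub_sub_sub_comm, ← neg_sub _ y, ← neg_add', neg_eq_zero, ← two_smul k, smul_eq_zero] at hx
    exact Subtype.ext (hx.resolve_left two_ne_zero)
  · intro y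
    obtain ⟨x, rfl⟩ : ∃ x, cycToDih k H s x = y := by
      obtain ⟨x, rfl⟩ := Submodule.mkQ_surjective _ y
      exact ⟨Submodule.mkQ _ x, rfl⟩
    refine ⟨⟨(2⁻¹ : k) • (x + revCyc k H s x), ?_⟩, ?_⟩
    · rw [LinearMap.mem_ker, LinearMap.sub_apply, LinearMap.id_apply, map_smul, map_add,
        revCyc_revCyc, add_comm, sub_self]
    · rw [LinearMap.domRestrict_apply, map_smul, map_add, cycToDih_revCyc, ← two_smul k, smul_smul,
        inv_mul_cancel₀ two_ne_zero, one_smul]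

/-! ### The Enomoto–Satoh trace of a tree -/

theorem contract_mul (ω : LinearMap.BilinForm k H) (s : ℕ) (v w : H) (x : TensorAlgebra k H) :
    contract ω s (v ⊗ₜ tensorPart k H (s + 1) (TensorAlgebra.ι k w * x)) =
      ω v w • tensorPart k H s x := by
  suffices h : contract ω s ∘ₗ TensorProduct.mk k H _ v ∘ₗ tensorPart k H (s + 1) ∘ₗ
      LinearMap.mulLeft k (TensorAlgebra.ι k w) = ω v w • tensorPart k H s from
    LinearMap.congr_fun h x
  refine linearMap_ext_word k fun n x => ?_
  simp only [LinearMap.comp_apply, LinearMap.mulLeft_apply, ι_mul_word_ofFn,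
    TensorProduct.mk_apply, LinearMap.smul_apply]
  by_cases hn : n = s
  · subst hn
    rw [tensorPart_word, tensorPart_word]
    simp [contract, LinearMap.uncurryLeft_apply]
  · rw [tensorPart_word_of_ne k hn, tensorPart_word_of_ne k (mt Nat.succ_injective.eq_iff.1 hn),
      TensorProduct.tmul_zero, map_zero, smul_zero]

theorem contract_comm_mul (ω : LinearMap.BilinForm k H) (s : ℕ) (v : H) (a : FreeMagma H)
    (x : TensorAlgebra k H) :
    contract ω s (v ⊗ₜ tensorPart k H (s + 1) (comm (TensorAlgebra.ι k) a * x)) =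
      tensorPart k H s (firstLetter (TensorAlgebra.ι k) (ω v) a * x) := by
  induction a generalizing x with
  | ih1 w => rw [comm_of, contract_mul, firstLetter_of, ← Algebra.smul_def, map_smul]
  | ih2 a b ha hb =>
    simp only [comm_mul, firstLetter_mul, sub_mul, mul_assoc, map_sub, TensorProduct.tmul_sub, ha,
      hb]

theorem lieToTensor_lieOf (a : FreeMagma H) :
    lieToTensor k H (lieOf k a) = comm (TensorAlgebra.ι k) a := by
  induction a with
  | ih1 v => exact lieToTensor_ι k v
  | ih2 a b ha hb => rw [lieOf_mul, lieToTensor_lie, ha, hb]; rfl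

theorem contract_lieOf (ω : LinearMap.BilinForm k H) (s : ℕ) (v : H) (a : FreeMagma H) :
    contract ω s (v ⊗ₜ lieToPower k H (s + 1) (lieOf k a)) =
      tensorPart k H s (firstLetter (TensorAlgebra.ι k) (ω v) a) := by
  have hpower : lieToPower k H (s + 1) (lieOf k a) =
      tensorPart k H (s + 1) (lieToTensor k H (lieOf k a)) := rfl
  rw [hpower, lieToTensor_lieOf, ← mul_one (comm _ a), contract_comm_mul, mul_one]

/-- The map on `𝒯(H)` that corresponds to the Enomoto–Satoh trace under `η`. -/
def trTree (ω : LinearMap.BilinForm k H) (s : ℕ) : T k H →ₗ[k] CycCoinv k H s :=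
  Submodule.mkQ _ ∘ₗ contract ω s ∘ₗ (lieToPower k H (s + 1)).lTensor H ∘ₗ etaLin k H

theorem trTree_mk (ω : LinearMap.BilinForm k H) (s : ℕ) (t : UTree H) :
    trTree k ω s (treeMk k id t) =
      cyc k H s (algTrace (TensorAlgebra.ι k) (fun x y => ω x y) t) := by
  simp only [trTree, LinearMap.comp_apply, etaLin_treeMk, etaTree, algTrace, map_list_sum,
    List.map_map, cyc, Function.comp_def, LinearMap.lTensor_tmul, contract_lieOf]

theorem trES_eta (ω : LinearMap.BilinForm k H) (s : ℕ) (t : TDeg k H s) :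
    trES ω s (eta k H s t) = trTree k ω s t := rfl

theorem revCyc_trES [CharZero k] (ω : LinearMap.BilinForm k H) (hω : ω.IsAlt) (s : ℕ)
    (d : D k H s) : revCyc k H s (trES ω s d) = trES ω s d := by
  obtain ⟨⟨t, ht⟩, rfl⟩ := (eta_bijective k H s).surjective d
  rw [trES_eta]
  suffices h : revCyc k H s ∘ₗ trTree k ω s = trTree k ω s from LinearMap.congr_fun h t
  refine treeSpace_ext k id fun t => ?_
  rw [LinearMap.comp_apply, trTree_mk, revCyc_cyc,
    reverse_algTrace (TensorAlgebra.ι k) _ (antipode k H) (antipode_ι k), unop_op, ← map_neg,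
    ← algTrace_neg]
  simp only [hω.neg_eq]

end Words

/-! ### Leaves of hairy graphs -/

section Leaves

variable {H : Type v}

theorem mem_tails {l : List (Leaf H)} {e : ℕ} : e ∈ l.filterMap Leaf.tail? ↔ .tail e ∈ l := by
  refine List.mem_filterMap.trans ⟨?_, fun h => ⟨_, h, rfl⟩⟩
  rintro ⟨_ | _ | _, hx, h⟩ <;> cases h
  exact hx

theorem mem_heads {l : List (Leaf H)} {e : ℕ} : e ∈ l.filterMap Leaf.head? ↔ .head e ∈ l := by
  refine List.mem_filterMap.trans ⟨?_, fun h => ⟨_, h, rfl⟩⟩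
  rintro ⟨_ | _ | _, hx, h⟩ <;> cases h
  exact hx

@[simp] theorem hairs_map_hair (l : List H) : (l.map Leaf.hair).filterMap Leaf.hair? = l := by
  rw [List.filterMap_map]
  exact List.filterMap_some

@[simp] theorem tails_map_hair (l : List H) : (l.map Leaf.hair).filterMap Leaf.tail? = [] := by
  simp [Leaf.tail?]

@[simp] theorem heads_map_hair (l : List H) : (l.map Leaf.hair).filterMap Leaf.head? = [] := by
  simp [Leaf.head?]

theorem numHairs_map_hair (l : List H) : numHairs (l.map Leaf.hair) = l.length := by
  rw [numHairs, hairs_map_hair]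

theorem exists_eq_map_hair {l : List (Leaf H)} (h : ∀ x ∈ l, ∃ v, x = .hair v) :
    ∃ hs : List H, l = hs.map Leaf.hair := by
  have hl : l ∈ Set.range (List.map (Leaf.hair : H → Leaf H)) := by
    rw [Set.range_list_map]
    exact fun x hx => (h x hx).imp fun _ => Eq.symm
  exact hl.imp fun _ => Eq.symm

theorem exists_eq_map_hair_of_numHairs_eq_length {l : List (Leaf H)} (h : numHairs l = l.length) :
    ∃ hs : List H, l = hs.map Leaf.hair := by
  refine exists_eq_map_hair fun x hx => ?_
  have hsome := List.filterMap_length_eq_length.1 h x hx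
  cases x with
  | hair v => exact ⟨v, rfl⟩
  | _ => cases hsome

theorem numHairs_cons_of_hair?_eq_none {x : Leaf H} (hx : x.hair? = none) (l : List (Leaf H)) :
    numHairs (x :: l) = numHairs l := by
  rw [numHairs, List.filterMap_cons_none hx, numHairs]

theorem length_eq_numHairs_add (l : List (Leaf H)) : l.length =
    numHairs l + (l.filterMap Leaf.tail?).length + (l.filterMap Leaf.head?).length := by
  induction l with
  | nil => rfl
  | cons x l ih =>
    rw [numHairs] at ih ⊢
    cases x <;>
      simp only [List.filterMap_cons, Leaf.hair?, Leaf.tail?, Leaf.head?, List.length_cons] <;>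
      omega

theorem Matched.length_eq {l : List (Leaf H)} (h : Matched l) :
    l.length = numHairs l + 2 * numEdges l := by
  rw [length_eq_numHairs_add, h.2.length_eq, numEdges, two_mul, add_assoc]

theorem Matched.notMem_of_hair?_eq_none {l : List (Leaf H)} {x : Leaf H} (h : Matched (x :: l))
    (hx : x.hair? = none) : x ∉ l := by
  intro hm
  cases x with
  | hair v => cases hx
  | tail e => exact (List.nodup_cons.1 h.1).1 (mem_tails.2 hm)
  | head e => exact (List.nodup_cons.1 (h.2.nodup_iff.2 h.1)).1 (mem_heads.2 hm)

theorem exists_perm_cons {α : Type*} {a : α} {l : List α} (h : a ∈ l) :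
    ∃ l', l.Perm (a :: l') := by
  obtain ⟨l₁, l₂, rfl⟩ := List.append_of_mem h
  exact ⟨l₁ ++ l₂, List.perm_middle⟩

/-- The other end of the external edge that ends at a leaf; hairs are fixed. -/
def Leaf.opp : Leaf H → Leaf H
  | .hair v => .hair v
  | .tail e => .head e
  | .head e => .tail e

theorem Leaf.opp_injective : Function.Injective (Leaf.opp : Leaf H → Leaf H) := by
  rintro (_ | _ | _) (_ | _ | _) h <;> cases h <;> rfl

theorem joinSign_eq_zero (k : Type u) [Field k] {x y : Leaf H} (h : y ≠ x.opp) :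
    joinSign k x y = 0 := by
  cases x <;> cases y <;> simp_all [joinSign, Leaf.opp, eq_comm]

theorem JoinedTo.hair?_eq_none {x : Leaf H} {t : UTree (Leaf H)} (h : JoinedTo x t) :
    x.hair? = none := by
  obtain ⟨e, ⟨rfl, -⟩ | ⟨rfl, -⟩⟩ := h <;> rfl

theorem JoinedTo.hair?_opp_eq_none {x : Leaf H} {t : UTree (Leaf H)} (h : JoinedTo x t) :
    x.opp.hair? = none := by
  obtain ⟨e, ⟨rfl, -⟩ | ⟨rfl, -⟩⟩ := h <;> rfl

theorem JoinedTo.opp_mem {x : Leaf H} {t : UTree (Leaf H)} (h : JoinedTo x t) :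
    x.opp ∈ leaves t := by
  obtain ⟨e, ⟨rfl, h⟩ | ⟨rfl, h⟩⟩ := h <;> exact h

variable [AddCommGroup H]

theorem IsHairy.leaves_perm {t : UTree (Leaf H)} (ht : IsHairy t)
    (hedges : numEdges (leaves t) = 1) :
    ∃ e, ∃ hs : List H, (leaves t).Perm (.tail e :: .head e :: hs.map Leaf.hair) := by
  obtain ⟨e, he⟩ := List.length_eq_one_iff.1 hedges
  obtain ⟨l, hl⟩ := exists_perm_cons (mem_tails.1 (he ▸ List.mem_singleton_self e))
  have hhead : .head e ∈ leaves t := mem_heads.1 (ht.2.mem_iff.2 (he ▸ List.mem_singleton_self e))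
  obtain ⟨l', hl'⟩ := exists_perm_cons (show .head e ∈ l by simpa using hl.subset hhead)
  have hperm := hl.trans (hl'.cons _)
  have hlen := Matched.length_eq ht
  rw [hedges, numHairs_perm hperm, hperm.length_eq, numHairs_cons_of_hair?_eq_none rfl,
    numHairs_cons_of_hair?_eq_none rfl, List.length_cons, List.length_cons] at hlen
  obtain ⟨hs, rfl⟩ := exists_eq_map_hair_of_numHairs_eq_length (l := l') (by omega)
  exact ⟨e, hs, hperm⟩

theorem numEdges_relabel_switch {t : UTree (Leaf H)} (ht : IsHairy t) (e : ℕ) :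
    numEdges (leaves (relabel (Leaf.switch e) t)) = numEdges (leaves t) := by
  have hswitch := numEdges_switch e (leaves t)
  rw [ht.2.count_eq] at hswitch
  rw [leaves_relabel]
  omega

theorem numHairs_relabel_switch (t : UTree (Leaf H)) (e : ℕ) :
    numHairs (leaves (relabel (Leaf.switch e) t)) = numHairs (leaves t) := by
  rw [leaves_relabel, numHairs, filterMap_hair_switch, numHairs]

theorem numEdges_relabel_rename (t : UTree (Leaf H)) (f : ℕ → ℕ) :
    numEdges (leaves (relabel (Leaf.rename f) t)) = numEdges (leaves t) := by
  rw [leaves_relabel, numEdges, filterMap_tail_rename, List.length_map, numEdges]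

theorem numHairs_relabel_rename (t : UTree (Leaf H)) (f : ℕ → ℕ) :
    numHairs (leaves (relabel (Leaf.rename f) t)) = numHairs (leaves t) := by
  rw [leaves_relabel, numHairs, filterMap_hair_rename, numHairs]

theorem leaves_of_slide {x y z : Leaf H} {t : UTree (Leaf H)} (hy : JoinedTo y t)
    (hz : JoinedTo z t) (hΓ : Matched (leaves₂ ((.of x, .of y * .of z), t)))
    (hedges : numEdges (leaves₂ ((.of x, .of y * .of z), t)) = 2) :
    ∃ v, x = .hair v ∧ ∃ hs : List H, (leaves t).Perm (y.opp :: z.opp :: hs.map Leaf.hair) := by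
  change Matched (x :: y :: z :: leaves t) at hΓ
  change numEdges (x :: y :: z :: leaves t) = 2 at hedges
  have hyz : z.opp ≠ y.opp := Leaf.opp_injective.ne <| by
    rintro rfl
    exact (hΓ.perm (List.Perm.swap _ _ _)).notMem_of_hair?_eq_none hy.hair?_eq_none (by simp)
  obtain ⟨l, hl⟩ := exists_perm_cons hy.opp_mem
  obtain ⟨l', hl'⟩ := exists_perm_cons
    ((List.mem_cons.1 (hl.subset hz.opp_mem)).resolve_left hyz)
  have hperm : (leaves t).Perm (y.opp :: z.opp :: l') := hl.trans (hl'.cons _)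
  have hall : (x :: y :: z :: leaves t).Perm (y :: z :: y.opp :: z.opp :: x :: l') :=
    (((hperm.cons z).cons y).cons x).trans
      (List.perm_middle (l₁ := [y, z, y.opp, z.opp]) (l₂ := l')).symm
  have hlen := hΓ.length_eq
  rw [hedges, numHairs_perm hall, hall.length_eq,
    numHairs_cons_of_hair?_eq_none hy.hair?_eq_none,
    numHairs_cons_of_hair?_eq_none hz.hair?_eq_none,
    numHairs_cons_of_hair?_eq_none hy.hair?_opp_eq_none,
    numHairs_cons_of_hair?_eq_none hz.hair?_opp_eq_none] at hlen
  simp only [List.length_cons] at hlen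
  obtain ⟨hs, hx⟩ := exists_eq_map_hair_of_numHairs_eq_length (l := x :: l') (by
    rw [List.length_cons]; omega)
  obtain ⟨v, hs, -, rfl, rfl⟩ := List.map_eq_cons_iff.1 hx.symm
  exact ⟨v, rfl, hs, hperm⟩

theorem leaves_of_loop {x : Leaf H} {e : ℕ} {t : UTree (Leaf H)} (hx : JoinedTo x t)
    (hΓ : Matched (leaves₂ ((.of x, .of (.tail e) * .of (.head e)), t)))
    (hedges : numEdges (leaves₂ ((.of x, .of (.tail e) * .of (.head e)), t)) = 2) :
    ∃ hs : List H, (leaves t).Perm (x.opp :: hs.map Leaf.hair) ∧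
      hs.length = numHairs (leaves₂ ((.of x, .of (.tail e) * .of (.head e)), t)) := by
  obtain ⟨l, hl⟩ := exists_perm_cons hx.opp_mem
  have hall : (leaves₂ ((.of x, .of (.tail e) * .of (.head e)), t)).Perm
      (x :: .tail e :: .head e :: x.opp :: l) := ((hl.cons _).cons _).cons x
  have hhairs : numHairs (x :: .tail e :: .head e :: x.opp :: l) = numHairs l := by
    rw [numHairs_cons_of_hair?_eq_none hx.hair?_eq_none, numHairs_cons_of_hair?_eq_none rfl,
      numHairs_cons_of_hair?_eq_none rfl, numHairs_cons_of_hair?_eq_none hx.hair?_opp_eq_none]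
  have hlen := hΓ.length_eq
  rw [hedges, numHairs_perm hall, hall.length_eq, hhairs] at hlen
  simp only [List.length_cons] at hlen
  obtain ⟨hs, rfl⟩ := exists_eq_map_hair_of_numHairs_eq_length (l := l) (by omega)
  exact ⟨hs, hl, by rw [numHairs_perm hall, hhairs, numHairs_map_hair]⟩

theorem notMem_leaves_of_loop {x : Leaf H} {e : ℕ} {t : UTree (Leaf H)}
    (hΓ : Matched (leaves₂ ((.of x, .of (.tail e) * .of (.head e)), t))) :
    .tail e ∉ leaves t ∧ .head e ∉ leaves t := by
  change Matched (x :: .tail e :: .head e :: leaves t) at hΓ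
  have htail := (hΓ.perm (List.Perm.swap _ _ _)).notMem_of_hair?_eq_none rfl
  have hhead := (hΓ.perm (List.perm_middle (l₁ := [x, .tail e]))).notMem_of_hair?_eq_none rfl
  exact ⟨fun h => htail (by simp [h]), fun h => hhead (by simp [h])⟩

end Leaves

/-! ### The trace of graphs with one external edge -/

section LeafForm

variable (k : Type u) [Field k] {H : Type v}

/-- The function on leaves with the value `1` at `a` and `0` elsewhere. -/
def leafIndicator (a : Leaf H) : Leaf H → k := Set.indicator {a} 1

/-- The form on leaves with the value `1` at `(a, b)` and `0` elsewhere. -/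
def leafForm (a b : Leaf H) : Leaf H → Leaf H → k := Set.indicator {a} fun _ => leafIndicator k b

@[simp] theorem leafIndicator_self (a : Leaf H) : leafIndicator k a a = 1 :=
  Set.indicator_of_mem (Set.mem_singleton a) _

theorem leafIndicator_of_ne {a x : Leaf H} (h : x ≠ a) : leafIndicator k a x = 0 :=
  Set.indicator_of_notMem (Set.mem_singleton_iff.not.2 h) _

theorem leafIndicator_hair {a : Leaf H} (ha : a.hair? = none) (v : H) :
    leafIndicator k a (.hair v) = 0 := by
  refine leafIndicator_of_ne k ?_
  rintro rfl
  cases ha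

theorem leafForm_self (a b : Leaf H) : leafForm k a b a = leafIndicator k b :=
  Set.indicator_of_mem (Set.mem_singleton a) _

theorem leafForm_of_ne {a x : Leaf H} (h : x ≠ a) (b : Leaf H) : leafForm k a b x = 0 :=
  Set.indicator_of_notMem (Set.mem_singleton_iff.not.2 h) _

theorem leafForm_hair {b : Leaf H} (hb : b.hair? = none) (a x : Leaf H) (v : H) :
    leafForm k a b x (.hair v) = 0 := by
  by_cases hx : x = a
  · subst hx
    rw [leafForm_self, leafIndicator_hair k hb]
  · rw [leafForm_of_ne k hx, Pi.zero_apply]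

theorem leafForm_transpose (a b : Leaf H) :
    (fun x y => leafForm k a b y x) = leafForm k b a := by
  funext x y
  by_cases hy : y = a <;> by_cases hx : x = b
  · subst hx hy; rw [leafForm_self, leafForm_self, leafIndicator_self, leafIndicator_self]
  · subst hy; rw [leafForm_self, leafForm_of_ne k hx, leafIndicator_of_ne k hx, Pi.zero_apply]
  · subst hx; rw [leafForm_self, leafForm_of_ne k hy, leafIndicator_of_ne k hy, Pi.zero_apply]
  · rw [leafForm_of_ne k hy, leafForm_of_ne k hx, Pi.zero_apply, Pi.zero_apply]

end LeafForm

section LoopTrace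

open MulOpposite

variable (k : Type u) [Field k] {H : Type v} [AddCommGroup H] [Module k H]

/-- The value of a leaf in the tensor algebra: hairs are kept, ends of edges are dropped. -/
def hairWord : Leaf H → TensorAlgebra k H
  | .hair v => TensorAlgebra.ι k v
  | _ => 0

/-- The form that pairs every tail with every head. It need not compare the names of edges, since
it is only used for graphs with a single external edge. -/
def edgeForm : Leaf H → Leaf H → k
  | .tail _, .head _ => 1
  | _, _ => 0

theorem antipode_hairWord (x : Leaf H) : antipode k H (hairWord k x) = op (-hairWord k x) := by
  cases x <;> simp [hairWord, antipode_ι]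

theorem antipode_algTrace (β : Leaf H → Leaf H → k) (t : UTree (Leaf H)) :
    antipode k H (algTrace (hairWord k) β t) =
      op (algTrace (hairWord k) (fun x y => β y x) t) :=
  reverse_algTrace _ _ _ (antipode_hairWord k) t

theorem dih_algTrace_transpose (β : Leaf H → Leaf H → k) (s : ℕ) (t : UTree (Leaf H)) :
    dih k H s (algTrace (hairWord k) (fun x y => β y x) t) =
      -dih k H s (algTrace (hairWord k) β t) := by
  rw [← dih_antipode, antipode_algTrace, unop_op]

theorem dih_algTrace_transpose_mul_ι (β : Leaf H → Leaf H → k) (s : ℕ) (t : UTree (Leaf H))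
    (v : H) : dih k H s (algTrace (hairWord k) (fun x y => β y x) t * TensorAlgebra.ι k v) =
      dih k H s (algTrace (hairWord k) β t * TensorAlgebra.ι k v) := by
  have hantipode := dih_antipode k s (TensorAlgebra.ι k v * algTrace (hairWord k) β t)
  rw [map_mul, antipode_ι, antipode_algTrace, ← op_mul, unop_op, mul_neg, map_neg, neg_inj]
    at hantipode
  rw [hantipode, dih_mul_comm]

variable (H) in
/-- The linear map that opens a graph with one external edge along this edge and multiplies what
hangs on the path from the tail to the head of the edge. -/
def loopTrace (s : ℕ) : PreGraph k H →ₗ[k] DihCoinv k H s :=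
  dih k H s ∘ₗ algTraceLin (hairWord k) (edgeForm k) Leaf.hair
    (fun r v w => by simp [hairWord]) (fun _ => rfl) (fun x _ => by cases x <;> rfl)

theorem loopTrace_gr (s : ℕ) (t : UTree (Leaf H)) :
    loopTrace k H s (gr k t) = dih k H s (algTrace (hairWord k) (edgeForm k) t) :=
  congrArg (dih k H s) (algTraceLin_mk ..)

theorem loopTrace_gr_transpose (s : ℕ) (t : UTree (Leaf H)) :
    loopTrace k H s (gr k t) =
      -dih k H s (algTrace (hairWord k) (fun x y => edgeForm k y x) t) := by
  rw [dih_algTrace_transpose, neg_neg, loopTrace_gr]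

/-! ### Invariance of the trace under the relations on external edges -/

theorem loopTrace_switch (s : ℕ) {t : UTree (Leaf H)} (ht : IsHairy t)
    (hedges : numEdges (leaves t) = 1) {e : ℕ} (he : .tail e ∈ leaves t) :
    loopTrace k H s (gr k (relabel (Leaf.switch e) t)) = -loopTrace k H s (gr k t) := by
  obtain ⟨e', hs, hperm⟩ := ht.leaves_perm hedges
  obtain rfl : e = e' := by simpa using hperm.subset he
  have hleaf (x : Leaf H) (hx : x ∈ leaves t) : (∃ v, x = .hair v) ∨ x = .tail e ∨ x = .head e := by
    have := hperm.subset hx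
    simp only [List.mem_cons, List.mem_map] at this
    grind
  have hword : hairWord k ∘ Leaf.switch e = hairWord (H := H) k := by
    funext x
    cases x <;> simp only [Function.comp_apply, Leaf.switch] <;> split_ifs <;> rfl
  rw [loopTrace_gr_transpose, neg_inj, algTrace_relabel, loopTrace_gr, hword]
  refine congrArg _ (algTrace_congr _ _ fun x hx y hy => ?_)
  rcases hleaf x hx with ⟨v, rfl⟩ | rfl | rfl <;> rcases hleaf y hy with ⟨w, rfl⟩ | rfl | rfl <;>
    simp [Leaf.switch, edgeForm]

theorem loopTrace_rename (s : ℕ) (t : UTree (Leaf H)) (f : ℕ → ℕ) :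
    loopTrace k H s (gr k (relabel (Leaf.rename f) t)) = loopTrace k H s (gr k t) := by
  rw [loopTrace_gr, loopTrace_gr, algTrace_relabel]
  congr 2
  · funext x; cases x <;> rfl
  · funext x y; cases x <;> cases y <;> rfl

theorem loopTrace_prePart_edgeRel (s : ℕ) {x : PreGraph k H} (hx : x ∈ edgeRel k H) :
    loopTrace k H s (prePart k H s 1 x) = 0 := by
  refine (Submodule.span_le (p := LinearMap.ker (loopTrace k H s ∘ₗ prePart k H s 1))).2 ?_ hx
  rintro _ (⟨t, e, ht, he, rfl⟩ | ⟨t, f, -, -, rfl⟩)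
  · rw [SetLike.mem_coe, LinearMap.mem_ker, LinearMap.comp_apply, map_add, prePart_gr, prePart_gr,
      numEdges_relabel_switch ht, numHairs_relabel_switch]
    split_ifs with h
    · rw [map_add, loopTrace_switch k s ht h.1 (mem_tails.1 he), add_neg_cancel]
    · rw [add_zero, map_zero]
  · rw [SetLike.mem_coe, LinearMap.mem_ker, LinearMap.comp_apply, map_sub, prePart_gr, prePart_gr,
      numEdges_relabel_rename, numHairs_relabel_rename]
    split_ifs with h
    · rw [map_sub, loopTrace_rename, sub_self]
    · rw [sub_zero, map_zero]

/-! ### Vanishing of the trace on `∂S₂` -/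

theorem firstLetter_mul_hair {φ : Leaf H → k} {v : H} (hφ : φ (.hair v) = 0)
    (a : FreeMagma (Leaf H)) : firstLetter (hairWord k) φ (a * .of (.hair v)) =
      firstLetter (hairWord k) φ a * TensorAlgebra.ι k v := by
  rw [firstLetter_mul, firstLetter_of, hφ, map_zero, zero_mul, sub_zero, comm_of, hairWord]

theorem algTrace_root {X : Type v} {A : Type*} [Ring A] [Algebra k A] (p : X → A)
    {β : X → X → k} {φ : X → k} {z : X} {c : FreeMagma X}
    (hz : ∀ x ∈ leavesR c, β z x = φ x) (hc : ∀ x ∈ leavesR c, β x = fun _ => 0) :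
    algTrace p β (.of z, c) = firstLetter p φ c := by
  rw [algTrace_eq, algTraceR_of, algTraceR_eq_zero _ hc, add_zero]
  exact firstLetter_congr _ _ hz

theorem loopTrace_root (s : ℕ) {z : Leaf H} (hz : z.hair? = none) {c : FreeMagma (Leaf H)}
    {hs : List H} (hc : (leavesR c).Perm (z.opp :: hs.map Leaf.hair)) :
    loopTrace k H s (gr k (.of z, c)) =
      joinSign k z z.opp • dih k H s (firstLetter (hairWord k) (leafIndicator k z.opp) c) := by
  have hleaf (x : Leaf H) (hx : x ∈ leavesR c) : x = z.opp ∨ ∃ v, x = .hair v := by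
    have := hc.subset hx
    simp only [List.mem_cons, List.mem_map] at this
    exact this.imp_right fun ⟨v, _, h⟩ => ⟨v, h.symm⟩
  cases z with
  | hair v => cases hz
  | tail e =>
    rw [loopTrace_gr, algTrace_root k _ (φ := leafIndicator k (.head e))]
    · simp [joinSign, Leaf.opp]
    · intro x hx
      obtain rfl | ⟨v, rfl⟩ := hleaf x hx
      · exact (leafIndicator_self k (Leaf.head e)).symm
      · exact (leafIndicator_hair k rfl v).symm
    · intro x hx
      obtain rfl | ⟨v, rfl⟩ := hleaf x hx <;> rfl
  | head e =>
    rw [loopTrace_gr_transpose, algTrace_root k _ (φ := leafIndicator k (.tail e))]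
    · simp [joinSign, Leaf.opp]
    · intro x hx
      obtain rfl | ⟨v, rfl⟩ := hleaf x hx
      · exact (leafIndicator_self k (Leaf.tail e)).symm
      · exact (leafIndicator_hair k rfl v).symm
    · intro x hx
      funext y
      obtain rfl | ⟨v, rfl⟩ := hleaf x hx <;> cases y <;> rfl

theorem boundary_tripod (x y z : Leaf H) (t : UTree (Leaf H)) :
    boundary k ((.of x, .of y * .of z), t) =
      ((rootings t).map fun q => joinSign k x q.1 • gr k (.of y * .of z, q.2)).sum +
      ((rootings t).map fun q => joinSign k z q.1 • gr k (.of y, q.2 * .of x)).sum -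
      ((rootings t).map fun q => joinSign k y q.1 • gr k (.of z, q.2 * .of x)).sum := by
  have hrotate (c : FreeMagma (Leaf H)) : gr k (.of x * .of y, c) = gr k (.of y, c * .of x) :=
    treeMk_rotate k _ _ _ _
  have hswap (c : FreeMagma (Leaf H)) : gr k (.of z * .of x, c) = -gr k (.of z, c * .of x) := by
    rw [gr_move, eq_neg_iff_add_eq_zero, gr_antisymm]
  have hneg (l : List (Leaf H × FreeMagma (Leaf H)))
      (f : Leaf H × FreeMagma (Leaf H) → PreGraph k H) :
      (l.map fun q => -f q).sum = -(l.map f).sum := by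
    rw [List.sum_neg, List.map_map]; rfl
  simp only [boundary, rootings, rootingsR_mul, rootingsR_of, List.map_append, List.map_cons,
    List.map_nil, List.sum_append, List.sum_cons, List.sum_nil, List.cons_append, List.nil_append,
    hrotate, hswap, smul_neg, hneg]
  abel

theorem loopTrace_joinSign_smul (s : ℕ) {x y z : Leaf H} (hz : z.hair? = none)
    {c : FreeMagma (Leaf H)} {hs : List H}
    (hc : (x :: leavesR c).Perm (y.opp :: z.opp :: hs.map Leaf.hair)) :
    loopTrace k H s (joinSign k y x • gr k (.of z, c)) =
      (joinSign k y y.opp * joinSign k z z.opp) • dih k H s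
        (firstLetter (hairWord k) (leafForm k y.opp z.opp x) c) := by
  by_cases h : x = y.opp
  · subst h
    rw [map_smul, loopTrace_root k s hz ((List.perm_cons _).1 hc), smul_smul, leafForm_self]
  · rw [joinSign_eq_zero k h, zero_smul, map_zero, leafForm_of_ne k h,
      firstLetter_eq_zero (φ := 0) _ _ fun _ _ => rfl,
      map_zero, smul_zero]

theorem loopTrace_sum_joinSign_smul (s : ℕ) {y z : Leaf H} (hz : z.hair? = none) (v : H)
    {t : UTree (Leaf H)} {hs : List H}
    (ht : (leaves t).Perm (y.opp :: z.opp :: hs.map Leaf.hair)) :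
    loopTrace k H s ((rootings t).map fun q =>
        joinSign k y q.1 • gr k (.of z, q.2 * .of (.hair v))).sum =
      (joinSign k y y.opp * joinSign k z z.opp) • dih k H s
        (algTrace (hairWord k) (leafForm k y.opp z.opp) t * TensorAlgebra.ι k v) := by
  have hz_opp : z.opp.hair? = none := by
    cases z <;> first | rfl | cases hz
  rw [map_list_sum, List.map_map, algTrace, ← List.sum_map_mul_right, map_list_sum,
    List.smul_sum, List.map_map, List.map_map]
  refine congrArg List.sum (List.map_congr_left fun q hq => ?_)
  have hperm : (q.1 :: leavesR (q.2 * .of (.hair v))).Perm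
      (y.opp :: z.opp :: (hs ++ [v]).map Leaf.hair) := by
    rw [List.map_append]
    exact ((rootings_perm t q hq).trans ht).append_right [.hair v]
  rw [Function.comp_apply, loopTrace_joinSign_smul k s hz hperm,
    firstLetter_mul_hair k (leafForm_hair k hz_opp _ _ v)]
  rfl

theorem loopTrace_boundary_slide (s : ℕ) {x y z : Leaf H} {t : UTree (Leaf H)} (hy : JoinedTo y t)
    (hz : JoinedTo z t) (hΓ : Matched (leaves₂ ((.of x, .of y * .of z), t)))
    (hedges : numEdges (leaves₂ ((.of x, .of y * .of z), t)) = 2) :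
    loopTrace k H s (boundary k ((.of x, .of y * .of z), t)) = 0 := by
  obtain ⟨v, rfl, hs, ht⟩ := leaves_of_slide hy hz hΓ hedges
  rw [boundary_tripod, List.sum_eq_zero (l := (rootings t).map _), zero_add, map_sub,
    loopTrace_sum_joinSign_smul k s hy.hair?_eq_none v (ht.trans (List.Perm.swap _ _ _)),
    loopTrace_sum_joinSign_smul k s hz.hair?_eq_none v ht, ← leafForm_transpose k y.opp z.opp,
    dih_algTrace_transpose_mul_ι, mul_comm, sub_self]
  intro w hw
  obtain ⟨q, -, rfl⟩ := List.mem_map.1 hw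
  exact zero_smul k _

theorem dih_comm_of_two_le_length {X : Type v} (p : X → TensorAlgebra k H) (s : ℕ)
    {a : FreeMagma X} (ha : 2 ≤ (leavesR a).length) : dih k H s (comm p a) = 0 := by
  cases a with
  | of x => exact absurd ha (by simp [leavesR])
  | mul a b => exact (map_sub _ _ _).trans (sub_eq_zero.2 (dih_mul_comm k s _ _))

theorem loopTrace_short_loop (s e : ℕ) {c : FreeMagma (Leaf H)} {hs : List H}
    (hc : (leavesR c).Perm (hs.map Leaf.hair)) (hlen : 2 ≤ hs.length) :
    loopTrace k H s (gr k (.of (.tail e) * .of (.head e), c)) = 0 := by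
  have hc_zero : firstLetter (hairWord k) (leafIndicator k (.head e)) c = 0 := by
    refine firstLetter_eq_zero _ _ fun y hy => leafIndicator_of_ne k ?_
    rintro rfl
    simpa using hc.subset hy
  have hperm : (leavesR (.of (.head e) * c)).Perm ((Leaf.tail e).opp :: hs.map Leaf.hair) :=
    hc.cons _
  rw [gr_move, loopTrace_root k s rfl hperm]
  rw [Leaf.opp, firstLetter_mul, hc_zero, firstLetter_of, leafIndicator_self, map_one, one_mul,
    zero_mul, sub_zero, dih_comm_of_two_le_length, smul_zero]
  rwa [hc.length_eq, List.length_map]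

theorem loopTrace_boundary_loop (s : ℕ) {x : Leaf H} {e : ℕ} {t : UTree (Leaf H)}
    (hx : JoinedTo x t) (hΓ : Matched (leaves₂ ((.of x, .of (.tail e) * .of (.head e)), t)))
    (hedges : numEdges (leaves₂ ((.of x, .of (.tail e) * .of (.head e)), t)) = 2)
    (hhairs : 2 ≤ numHairs (leaves₂ ((.of x, .of (.tail e) * .of (.head e)), t))) :
    loopTrace k H s (boundary k ((.of x, .of (.tail e) * .of (.head e)), t)) = 0 := by
  obtain ⟨hs, ht, hlen⟩ := leaves_of_loop hx hΓ hedges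
  obtain ⟨htail, hhead⟩ := notMem_leaves_of_loop hΓ
  have hzero (y : Leaf H) (hy : y.opp ∉ leaves t) (c : FreeMagma (Leaf H) → PreGraph k H) :
      ((rootings t).map fun q => joinSign k y q.1 • c q.2).sum = 0 := by
    refine List.sum_eq_zero fun w hw => ?_
    obtain ⟨q, hq, rfl⟩ := List.mem_map.1 hw
    rw [joinSign_eq_zero, zero_smul]
    rintro h
    exact hy (h ▸ (rootings_perm t q hq).subset List.mem_cons_self)
  rw [boundary_tripod, hzero (.head e) htail fun c => gr k (.of (.tail e), c * .of x),
    hzero (.tail e) hhead fun c => gr k (.of (.head e), c * .of x), add_zero, sub_zero,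
    map_list_sum, List.map_map]
  refine List.sum_eq_zero fun w hw => ?_
  obtain ⟨q, hq, rfl⟩ := List.mem_map.1 hw
  rw [Function.comp_apply, map_smul]
  by_cases h : q.1 = x.opp
  · have hc := (rootings_perm t q hq).trans ht
    rw [h, List.perm_cons] at hc
    rw [loopTrace_short_loop k s e hc (hlen ▸ hhairs), smul_zero]
  · rw [joinSign_eq_zero k h, zero_smul]

theorem loopTrace_prePart_bdS₂Part {s : ℕ} (hs : 2 ≤ s) {x : PreGraph k H}
    (hx : x ∈ bdS₂Part k H s 1) : loopTrace k H s (prePart k H s 1 x) = 0 := by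
  refine (Submodule.span_le (p := LinearMap.ker (loopTrace k H s ∘ₗ prePart k H s 1))).2 ?_ hx
  rintro _ ⟨Γ, hΓ, hedges, hhairs, rfl⟩
  rw [SetLike.mem_coe, LinearMap.mem_ker, LinearMap.comp_apply, prePart_boundary,
    if_pos ⟨hedges, hhairs⟩]
  cases hΓ with
  | slide x y z t hy hz hΓ => exact loopTrace_boundary_slide k s hy hz hΓ hedges
  | loop x e t hx hΓ => exact loopTrace_boundary_loop k s hx hΓ hedges (hhairs ▸ hs)

/-! ### The trace on `Ω_{s,1}(H)` -/

variable (H) in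
/-- The map `Ω_{s,1}(H) → [H^{⊗s}]_{D_{2s}}` induced by `loopTrace`. -/
def omegaTrace (s : ℕ) (hs : 2 ≤ s) : OmegaPart k H s 1 →ₗ[k] DihCoinv k H s :=
  Submodule.liftQ _ (loopTrace k H s ∘ₗ prePart k H s 1 ∘ₗ (PreC₁Part k H s 1).subtype) <| by
    rintro ⟨x, hx⟩ h
    obtain ⟨y, hy, z, hz, rfl⟩ := Submodule.mem_sup.1 (show x ∈ _ from h)
    rw [LinearMap.mem_ker, LinearMap.comp_apply, LinearMap.comp_apply, Submodule.subtype_apply,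
      map_add, map_add, loopTrace_prePart_edgeRel k s hy, loopTrace_prePart_bdS₂Part k hs hz,
      add_zero]

theorem prePart_of_mem {s r : ℕ} {x : PreGraph k H} (hx : x ∈ PreC₁Part k H s r) :
    prePart k H s r x = x := by
  refine (Submodule.span_le (p := LinearMap.eqLocus (prePart k H s r) LinearMap.id)).2 ?_ hx
  rintro _ ⟨t, -, hedges, hhairs, rfl⟩
  exact (prePart_gr s r t).trans (if_pos ⟨hedges, hhairs⟩)

theorem omegaTrace_mk {s : ℕ} (hs : 2 ≤ s) (x : PreC₁Part k H s 1) :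
    omegaTrace k H s hs (Submodule.mkQ _ x) = loopTrace k H s x :=
  congrArg (loopTrace k H s) (prePart_of_mem k x.2)

/-- The rooted tree `[⋯[[a, v₁], v₂], ⋯, vₙ]` obtained from `a` by attaching hairs labelled by the
entries `v₁, …, vₙ` of `l`. -/
def attach (a : FreeMagma (Leaf H)) (l : List H) : FreeMagma (Leaf H) :=
  l.foldl (fun a v => a * .of (.hair v)) a

omit [AddCommGroup H] in
theorem leavesR_attach (a : FreeMagma (Leaf H)) (l : List H) :
    leavesR (attach a l) = leavesR a ++ l.map Leaf.hair := by
  induction l generalizing a with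
  | nil => exact (List.append_nil _).symm
  | cons v l ih => exact (ih _).trans (List.append_assoc _ [_] _)

theorem firstLetter_attach {φ : Leaf H → k} (hφ : ∀ v, φ (.hair v) = 0) (a : FreeMagma (Leaf H))
    (l : List H) : firstLetter (hairWord k) φ (attach a l) =
      firstLetter (hairWord k) φ a * word k l := by
  induction l generalizing a with
  | nil => exact (mul_one _).symm
  | cons v l ih =>
    refine (ih _).trans ?_
    rw [firstLetter_mul_hair k (hφ v), mul_assoc, word_cons]

theorem omegaTrace_loopClass {s : ℕ} (hs : 2 ≤ s) (v : Fin s → H) :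
    omegaTrace k H s hs (loopClass k v) = Submodule.mkQ _ (PiTensorProduct.tprod k v) := by
  have hsign : joinSign k (.tail 0) (.head 0 : Leaf H) = 1 := by simp [joinSign]
  rw [loopClass, omegaTrace_mk]
  change loopTrace k H s (gr k (.of (.tail 0), attach (.of (.head 0)) (List.ofFn v))) = _
  rw [loopTrace_root k s rfl (hs := List.ofFn v) (by rw [leavesR_attach]; rfl),
    firstLetter_attach k (leafIndicator_hair k rfl), Leaf.opp, hsign, one_smul,
    firstLetter_of, leafIndicator_self, map_one, one_mul, dih, LinearMap.comp_apply,
    tensorPart_word]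

end LoopTrace

/-! ### Loops span the graphs with one external edge -/

section Attach

variable {H : Type v}

theorem attach_append (a : FreeMagma (Leaf H)) (l l' : List H) :
    attach a (l ++ l') = attach (attach a l) l' := List.foldl_append

theorem attach_cons (a : FreeMagma (Leaf H)) (v : H) (l : List H) :
    attach a (v :: l) = attach (a * .of (.hair v)) l := rfl

theorem attach_concat (a : FreeMagma (Leaf H)) (l : List H) (v : H) :
    attach a (l ++ [v]) = attach a l * .of (.hair v) := attach_append a l [v]

theorem map_attach {f : Leaf H → Leaf H} (hf : ∀ v, f (.hair v) = .hair v)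
    (a : FreeMagma (Leaf H)) (l : List H) :
    FreeMagma.map f (attach a l) = attach (FreeMagma.map f a) l := by
  induction l generalizing a with
  | nil => rfl
  | cons v l ih => rw [attach_cons, ih, map_mul, FreeMagma.map_of, hf, attach_cons]

theorem sum_rootingsR_attach {M : Type*} [AddCommGroup M] {F : Leaf H × FreeMagma (Leaf H) → M}
    (hF : ∀ v c, F (.hair v, c) = 0) (a : Leaf H) (l : List H) (c : FreeMagma (Leaf H)) :
    ((rootingsR (attach (.of a) l) c).map F).sum =
      F (a, l.foldr (fun v c => .of (.hair v) * c) c) := by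
  induction l using List.reverseRecOn generalizing c with
  | nil => simp [attach]
  | append_singleton l v ih =>
    rw [attach_concat, rootingsR_mul, List.map_append, List.sum_append, ih]
    simp [hF]

theorem hairs_of_append_perm {l l' : List (Leaf H)} {x : Leaf H} {hs : List H}
    (hperm : (l ++ l').Perm (x :: hs.map Leaf.hair)) (hx : x ∈ l) :
    (∃ hs' : List H, l.Perm (x :: hs'.map Leaf.hair)) ∧ ∀ y ∈ l', ∃ v, y = .hair v := by
  obtain ⟨m, hm⟩ := exists_perm_cons hx
  have hrest : (m ++ l').Perm (hs.map Leaf.hair) :=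
    (List.perm_cons x).1 ((hm.append_right _).symm.trans hperm)
  have hhair (y : Leaf H) (hy : y ∈ m ++ l') : ∃ v, y = .hair v := by
    obtain ⟨v, -, rfl⟩ := List.mem_map.1 (hrest.subset hy)
    exact ⟨v, rfl⟩
  obtain ⟨hs', rfl⟩ := exists_eq_map_hair fun y hy => hhair y (List.mem_append_left _ hy)
  exact ⟨⟨hs', hm⟩, fun y hy => hhair y (List.mem_append_right _ hy)⟩

theorem rootingsR_map_fst {X : Type v} (a c : FreeMagma X) :
    (rootingsR a c).map Prod.fst = leavesR a := by
  induction a generalizing c with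
  | ih1 x => rfl
  | ih2 a b ha hb => rw [rootingsR_mul, List.map_append, ha, hb, leavesR_mul]

theorem exists_mem_rootings {X : Type v} {t : UTree X} {x : X} (hx : x ∈ leaves t) :
    ∃ c, (x, c) ∈ rootings t := by
  have hfst : (rootings t).map Prod.fst = leaves t := by
    rw [rootings, List.map_append, rootingsR_map_fst, rootingsR_map_fst, leaves]
  obtain ⟨⟨y, c⟩, hc, rfl⟩ := List.mem_map.1 (hfst ▸ hx)
  exact ⟨c, hc⟩

end Attach

section Loops

variable (k : Type u) [Field k] {H : Type v} [AddCommGroup H] [Module k H]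

theorem gr_swap (a b c : FreeMagma (Leaf H)) : gr k (a, b * c) = -gr k (a, c * b) :=
  treeMk_swap k _ a b c

theorem gr_attach (x a : FreeMagma (Leaf H)) (l : List H) :
    gr k (x, attach a l) = (-1 : k) ^ l.length • gr k (attach x l.reverse, a) := by
  induction l using List.reverseRecOn generalizing x with
  | nil => simp [attach]
  | append_singleton l v ih =>
    rw [attach_concat, gr_swap, ← gr_move, ih, List.reverse_concat, attach_cons,
      List.length_append, List.length_singleton, pow_succ, mul_neg_one, neg_smul]

theorem gr_attach_reverse (x a : FreeMagma (Leaf H)) (l : List H) :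
    gr k (attach x l, a) = (-1 : k) ^ l.length • gr k (x, attach a l.reverse) := by
  rw [gr_flip, gr_attach, gr_flip]

theorem gr_foldr (x a : FreeMagma (Leaf H)) (l : List H) :
    gr k (x, l.foldr (fun v c => .of (.hair v) * c) a) = gr k (attach x l, a) := by
  induction l generalizing x with
  | nil => rfl
  | cons v l ih => rw [List.foldr_cons, ← gr_move, ih, attach_cons]

theorem gr_attach_linear (x a : FreeMagma (Leaf H)) (r : k) (v w : H) (l l' : List H) :
    gr k (x, attach a (l ++ (r • v + w) :: l')) =
      r • gr k (x, attach a (l ++ v :: l')) + gr k (x, attach a (l ++ w :: l')) := by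
  have hroot (u : H) : gr k (x, attach a (l ++ u :: l')) = (-1 : k) ^ l'.length •
      gr k (.of (.hair u), attach x l'.reverse * attach a l) := by
    rw [attach_append, attach_cons, gr_attach, ← gr_move, gr_flip]
  have hlinear : gr k (.of (.hair (r • v + w)), attach x l'.reverse * attach a l) =
      r • gr k (.of (.hair v), attach x l'.reverse * attach a l) +
        gr k (.of (.hair w), attach x l'.reverse * attach a l) := treeMk_linear k _ r v w _
  rw [hroot, hroot, hroot, hlinear, smul_add, smul_comm]

theorem gr_attach_smul (x a : FreeMagma (Leaf H)) (r : k) (v : H) (l l' : List H) :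
    gr k (x, attach a (l ++ (r • v) :: l')) = r • gr k (x, attach a (l ++ v :: l')) := by
  have hzero : gr k (x, attach a (l ++ 0 :: l')) = 0 := by
    simpa using gr_attach_linear k x a 1 (0 : H) 0 l l'
  simpa [hzero] using gr_attach_linear k x a r v 0 l l'

/-- Linear combinations of the graphs obtained by rooting at `x` and attaching `n` hairs to `a`. -/
def attachSpan (x a : FreeMagma (Leaf H)) (n : ℕ) : Submodule k (PreGraph k H) :=
  Submodule.span k {y | ∃ l : List H, l.length = n ∧ y = gr k (x, attach a l)}

theorem attachSpan_le {a d : FreeMagma (Leaf H)} {m : ℕ}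
    (hd : ∀ x, gr k (x, d) ∈ attachSpan k x a m) (x : FreeMagma (Leaf H)) (n : ℕ) :
    attachSpan k x d n ≤ attachSpan k x a (m + n) := by
  refine Submodule.span_le.2 ?_
  rintro _ ⟨l, rfl, rfl⟩
  rw [gr_attach]
  refine Submodule.smul_mem _ _ (Submodule.span_le.2 ?_ (hd (attach x l.reverse)))
  rintro _ ⟨l', rfl, rfl⟩
  rw [SetLike.mem_coe, gr_attach_reverse, List.reverse_reverse, ← attach_append]
  exact Submodule.smul_mem _ _ (Submodule.subset_span ⟨_, List.length_append, rfl⟩)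

theorem gr_mul_mem_attachSpan {c : FreeMagma (Leaf H)} (hc : ∀ x ∈ leavesR c, ∃ v, x = .hair v)
    (x a : FreeMagma (Leaf H)) : gr k (x, a * c) ∈ attachSpan k x a (nodesR c + 1) := by
  induction c generalizing x a with
  | ih1 y =>
    obtain ⟨v, rfl⟩ := hc y (List.mem_singleton_self y)
    exact Submodule.subset_span ⟨[v], rfl, rfl⟩
  | ih2 b c hb hc' =>
    replace hb := hb fun y hy => hc y (List.mem_append_left _ hy)
    replace hc' := hc' fun y hy => hc y (List.mem_append_right _ hy)
    have hleibniz : gr k (x, a * (b * c)) = gr k (x, a * b * c) - gr k (x, a * c * b) := by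
      rw [gr_swap k x (a * c), sub_neg_eq_add]
      exact treeMk_leibniz k _ x a b c
    rw [hleibniz]
    refine sub_mem ?_ ?_
    · have hmem := attachSpan_le k (fun x => hb x a) x _ (hc' x (a * b))
      rwa [show nodesR (b * c) + 1 = nodesR b + 1 + (nodesR c + 1) by rw [nodesR_mul]; omega]
    · have hmem := attachSpan_le k (fun x => hc' x a) x _ (hb x (a * c))
      rwa [show nodesR (b * c) + 1 = nodesR c + 1 + (nodesR b + 1) by rw [nodesR_mul]; omega]

theorem gr_mem_attachSpan {h : Leaf H} {c : FreeMagma (Leaf H)} {hs : List H}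
    (hc : (leavesR c).Perm (h :: hs.map Leaf.hair)) (x : FreeMagma (Leaf H)) :
    gr k (x, c) ∈ attachSpan k x (.of h) (nodesR c) := by
  induction c generalizing x hs with
  | ih1 y =>
    obtain ⟨rfl, -⟩ := List.cons.inj (List.singleton_perm.1 hc)
    exact Submodule.subset_span ⟨[], rfl, rfl⟩
  | ih2 a b ha hb =>
    rw [leavesR_mul] at hc
    rcases List.mem_append.1 (hc.symm.subset List.mem_cons_self) with h_mem | h_mem
    · obtain ⟨⟨hs', ha'⟩, hb'⟩ := hairs_of_append_perm hc h_mem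
      have hmem := attachSpan_le k (ha ha') x _ (gr_mul_mem_attachSpan k hb' x a)
      rwa [nodesR_mul, add_assoc]
    · obtain ⟨⟨hs', hb'⟩, ha'⟩ := hairs_of_append_perm (List.perm_append_comm.trans hc) h_mem
      have hmem := attachSpan_le k (hb hb') x _ (gr_mul_mem_attachSpan k ha' x b)
      rw [gr_swap, nodesR_mul, add_comm (nodesR a), add_assoc]
      exact neg_mem hmem

theorem gr_mem_attachSpan_of_leaves_perm {t : UTree (Leaf H)} {x y : Leaf H} {hs : List H}
    (ht : (leaves t).Perm (x :: y :: hs.map Leaf.hair)) :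
    gr k t ∈ attachSpan k (.of x) (.of y) hs.length := by
  obtain ⟨c, hc⟩ := exists_mem_rootings (ht.symm.subset List.mem_cons_self)
  have hperm : (leavesR c).Perm (y :: hs.map Leaf.hair) :=
    (List.perm_cons x).1 ((rootings_perm t _ hc).trans ht)
  have hnodes : nodesR c = hs.length := by
    simpa [leavesR_length] using hperm.length_eq
  rw [gr, treeMk_eq_of_mem_rootings k _ t hc, ← hnodes]
  exact gr_mem_attachSpan k hperm _

theorem PreC₁Part_one_le (s : ℕ) :
    PreC₁Part k H s 1 ≤ attachSpan k (.of (.tail 0)) (.of (.head 0)) s ⊔ edgeRel k H := by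
  refine Submodule.span_le.2 ?_
  rintro _ ⟨t, ht, hedges, rfl, rfl⟩
  obtain ⟨e, hs, hperm⟩ := ht.leaves_perm hedges
  have hlen : numHairs (leaves t) = hs.length := (numHairs_perm hperm).trans (numHairs_map_hair hs)
  let t' := relabel (Leaf.rename (Equiv.swap e 0)) t
  have hperm' : (leaves t').Perm (.tail 0 :: .head 0 :: hs.map Leaf.hair) := by
    rw [leaves_relabel]
    refine (hperm.map _).trans ?_
    simp [Leaf.rename, Function.comp_def]
  have hrename : gr k t - gr k t' ∈ edgeRel k H :=
    Submodule.subset_span (Or.inr ⟨t, _, ht, (Equiv.swap e 0).injective, rfl⟩)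
  rw [SetLike.mem_coe, hlen, ← sub_add_cancel (gr k t) (gr k t')]
  exact add_mem (Submodule.mem_sup_right hrename)
    (Submodule.mem_sup_left (gr_mem_attachSpan_of_leaves_perm k hperm'))

/-! ### The dihedral symmetry of loops -/

/-- The loop whose hairs are labelled by the entries of a list, as an element of `PreGraph`. -/
def loopGr (l : List H) : PreGraph k H := gr k (.of (.tail 0), attach (.of (.head 0)) l)

omit [AddCommGroup H] in
theorem leaves_loop (l : List H) (i : ℕ) :
    leaves ((.of (.tail i), attach (.of (.head i)) l) : UTree (Leaf H)) =
      .tail i :: .head i :: l.map Leaf.hair := by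
  simp [leaves, leavesR_attach]

omit [AddCommGroup H] in
theorem isHairy_loop (l : List H) :
    IsHairy ((.of (.tail 0), attach (.of (.head 0)) l) : UTree (Leaf H)) := by
  rw [IsHairy, leaves_loop, Matched]
  simp [List.filterMap_cons, Leaf.tail?, Leaf.head?, -List.filterMap_map]

theorem loopGr_reverse (l : List H) :
    loopGr k l.reverse + (-1 : k) ^ l.length • loopGr k l ∈ edgeRel k H := by
  have hswitch : gr k (relabel (Leaf.switch 0)
      (.of (.tail 0), attach (.of (.head 0)) l.reverse)) = (-1 : k) ^ l.length • loopGr k l := by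
    rw [relabel, map_attach fun v => rfl]
    simp only [FreeMagma.map_of, Leaf.switch, if_true]
    rw [gr_flip, gr_attach_reverse, List.reverse_reverse, List.length_reverse, loopGr]
  rw [← hswitch]
  refine Submodule.subset_span (Or.inl ⟨_, 0, isHairy_loop l.reverse, ?_, rfl⟩)
  rw [mem_tails, leaves_loop]
  exact List.mem_cons_self

theorem gr_foldr_mul_hair (x a : FreeMagma (Leaf H)) (l : List H) (v : H) :
    gr k (x, l.foldr (fun v c => .of (.hair v) * c) a * .of (.hair v)) =
      (-1 : k) ^ l.length • gr k (x, attach a (l.reverse ++ [v])) := by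
  rw [gr_swap, ← gr_move, gr_foldr, ← attach_cons, gr_attach_reverse, List.reverse_cons,
    List.length_cons, pow_succ, mul_neg_one, neg_smul, neg_neg]

theorem boundary_slide_loop (l : List H) (v : H) :
    boundary k ((.of (.hair v), .of (.tail 0) * .of (.tail 1)),
        (.of (.head 0), attach (.of (.head 1)) l)) =
      (-1 : k) ^ l.length • loopGr k (l.reverse ++ [v]) -
        gr k (.of (.tail 1), attach (.of (.head 1)) (l ++ [v])) := by
  have hhair : ∀ (y : Leaf H) (w : H), joinSign k y (.hair w) = 0 := by
    rintro (_ | _ | _) w <;> rfl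
  have hsum (x y : Leaf H) (c : FreeMagma (Leaf H) → PreGraph k H) (d : FreeMagma (Leaf H)) :
      ((rootingsR (attach (.of y) l) d).map fun q => joinSign k x q.1 • c q.2).sum =
        joinSign k x y • c (l.foldr (fun v c => .of (.hair v) * c) d) :=
    sum_rootingsR_attach (F := fun q => joinSign k x q.1 • c q.2)
      (fun w _ => by rw [hhair, zero_smul]) y l d
  rw [boundary_tripod, rootings]
  simp only [List.map_append, List.sum_append, rootingsR_of, List.map_singleton, List.sum_singleton]
  rw [hsum _ _ fun c => gr k (.of (.tail 0) * .of (.tail 1), c),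
    hsum _ _ fun c => gr k (.of (.tail 0), c * .of (.hair v)),
    hsum _ _ fun c => gr k (.of (.tail 1), c * .of (.hair v)), gr_foldr_mul_hair, ← attach_concat]
  simp [joinSign, loopGr]

theorem boundary_slide_loop_mem (l : List H) (v : H) :
    boundary k ((.of (.hair v), .of (.tail 0) * .of (.tail 1)),
      (.of (.head 0), attach (.of (.head 1)) l)) ∈ bdS₂Part k H (l.length + 1) 1 := by
  have hleaves : leaves₂ (((.of (.hair v), .of (.tail 0) * .of (.tail 1)),
      (.of (.head 0), attach (.of (.head 1)) l)) : UTree (Leaf H) × UTree (Leaf H)) =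
      .hair v :: .tail 0 :: .tail 1 :: .head 0 :: .head 1 :: l.map Leaf.hair := by
    simp [leaves₂, leaves, leavesR_attach]
  refine Submodule.subset_span ⟨_, IsS₂.slide _ _ _ _ ⟨0, Or.inl ⟨rfl, ?_⟩⟩
    ⟨1, Or.inl ⟨rfl, ?_⟩⟩ ?_, ?_, ?_, rfl⟩
  · simp [leaves]
  · simp [leaves, leavesR_attach]
  · rw [hleaves, Matched]
    simp [List.filterMap_cons, Leaf.tail?, Leaf.head?, -List.filterMap_map]
  · rw [hleaves, numEdges]
    simp [List.filterMap_cons, Leaf.tail?, -List.filterMap_map]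
  · rw [hleaves, numHairs]
    simp [List.filterMap_cons, Leaf.hair?, -List.filterMap_map]

theorem loopGr_slide (l : List H) (v : H) :
    loopGr k (l ++ [v]) - (-1 : k) ^ l.length • loopGr k (l.reverse ++ [v]) ∈
      edgeRel k H ⊔ bdS₂Part k H (l.length + 1) 1 := by
  have hrename : loopGr k (l ++ [v]) - gr k (.of (.tail 1), attach (.of (.head 1)) (l ++ [v])) ∈
      edgeRel k H := by
    refine Submodule.subset_span (Or.inr ⟨_, Nat.succ, isHairy_loop (l ++ [v]),
      Nat.succ_injective, ?_⟩)
    rw [relabel, map_attach fun v => rfl]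
    rfl
  have hboundary := boundary_slide_loop k l v ▸ boundary_slide_loop_mem k l v
  rw [← sub_sub_sub_cancel_right _ _ (gr k (.of (.tail 1), attach (.of (.head 1)) (l ++ [v])))]
  exact sub_mem (Submodule.mem_sup_left hrename) (Submodule.mem_sup_right hboundary)

theorem loopGr_rotate (l : List H) (v : H) :
    loopGr k (v :: l) - loopGr k (l ++ [v]) ∈ edgeRel k H ⊔ bdS₂Part k H (l.length + 1) 1 := by
  have hreverse : loopGr k (v :: l) - (-1 : k) ^ l.length • loopGr k (l.reverse ++ [v]) ∈
      edgeRel k H := by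
    have hmem := loopGr_reverse k (l.reverse ++ [v])
    rwa [List.reverse_concat, List.reverse_reverse, List.length_append, List.length_reverse,
      List.length_singleton, pow_succ, mul_neg_one, neg_smul, ← sub_eq_add_neg] at hmem
  rw [← sub_sub_sub_cancel_right _ _ ((-1 : k) ^ l.length • loopGr k (l.reverse ++ [v]))]
  exact sub_mem (Submodule.mem_sup_left hreverse) (loopGr_slide k l v)

theorem ofFn_update {α : Type*} {s : ℕ} [DecidableEq (Fin s)] (v : Fin s → α) (i : Fin s) (x : α) :
    List.ofFn (Function.update v i x) =
      (List.ofFn v).take i ++ x :: (List.ofFn v).drop (i + 1) := by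
  have hset : List.ofFn (Function.update v i x) = (List.ofFn v).set i x := by
    refine List.ext_getElem (by simp) fun j _ _ => ?_
    simp only [List.getElem_ofFn, List.getElem_set, Function.update_apply, Fin.ext_iff, eq_comm]
  rw [hset, List.set_eq_take_append_cons_drop, if_pos (by simp)]

variable (H) in
/-- The class of a loop in `Ω_{s,1}(H)`, as a multilinear map in the labels of its hairs. -/
def loopMulti (s : ℕ) : MultilinearMap k (fun _ : Fin s => H) (OmegaPart k H s 1) where
  toFun := loopClass k
  map_update_add' v i x y := by
    have hadd := gr_attach_linear k (.of (.tail 0)) (.of (.head 0)) 1 x y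
      ((List.ofFn v).take i) ((List.ofFn v).drop (i + 1))
    rw [one_smul, one_smul, ← ofFn_update, ← ofFn_update, ← ofFn_update] at hadd
    exact congrArg (Submodule.mkQ _) (Subtype.ext hadd)
  map_update_smul' v i r x := by
    have hsmul := gr_attach_smul k (.of (.tail 0)) (.of (.head 0)) r x
      ((List.ofFn v).take i) ((List.ofFn v).drop (i + 1))
    rw [← ofFn_update, ← ofFn_update] at hsmul
    exact congrArg (Submodule.mkQ _) (Subtype.ext hsmul)

theorem loopClass_eq_smul_of_mem {s : ℕ} {v w : Fin s → H} {r : k}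
    (h : loopGr k (List.ofFn v) - r • loopGr k (List.ofFn w) ∈ edgeRel k H ⊔ bdS₂Part k H s 1) :
    loopClass k v = r • loopClass k w := by
  rw [loopClass, loopClass, ← map_smul, ← sub_eq_zero, ← map_sub]
  exact (Submodule.Quotient.mk_eq_zero _).2 h

theorem loopClass_cons {s : ℕ} (a : H) (v : Fin s → H) :
    loopClass k (Fin.cons (α := fun _ => H) a v) =
      loopClass k (Fin.snoc (α := fun _ => H) v a) := by
  rw [← one_smul k (loopClass k (Fin.snoc v a))]
  refine loopClass_eq_smul_of_mem k ?_
  have hmem := loopGr_rotate k (List.ofFn v) a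
  rw [List.length_ofFn] at hmem
  have hsnoc : List.ofFn (Fin.snoc (α := fun _ => H) v a) = List.ofFn v ++ [a] := by
    rw [List.ofFn_succ', List.concat_eq_append]
    simp only [Fin.snoc_castSucc, Fin.snoc_last]
  rwa [List.ofFn_cons, hsnoc, one_smul]

theorem loopClass_rotate {s : ℕ} (v : Fin s → H) :
    loopClass k (fun i => v ((finRotate s).symm i)) = loopClass k v := by
  cases s with
  | zero => exact congrArg _ (Subsingleton.elim _ _)
  | succ n =>
    obtain ⟨a, w, rfl⟩ : ∃ a w, v = Fin.snoc (α := fun _ => H) w a :=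
      ⟨_, _, (Fin.snoc_init_self v).symm⟩
    rw [← loopClass_cons]
    refine congrArg _ (funext fun i => ?_)
    rw [Fin.snoc_eq_cons_rotate]
    exact congrArg _ (Equiv.apply_symm_apply _ i)

theorem loopClass_reverse {s : ℕ} (v : Fin s → H) : loopClass k v =
    (-1 : k) ^ (s + 1) • loopClass k (fun i => v ((Fin.revPerm (n := s)).symm i)) := by
  refine loopClass_eq_smul_of_mem k (Submodule.mem_sup_left ?_)
  have hmem := loopGr_reverse k (List.ofFn v).reverse
  rwa [List.reverse_reverse, List.length_reverse, List.length_ofFn, reverse_ofFn,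
    ← sub_neg_eq_add, ← neg_smul, ← mul_neg_one, ← pow_succ] at hmem

variable (H) in
/-- The map `[H^{⊗s}]_{D_{2s}} → Ω_{s,1}(H)` that sends a word to the loop with its letters as
hairs. -/
def omegaLoop (s : ℕ) : DihCoinv k H s →ₗ[k] OmegaPart k H s 1 :=
  Submodule.liftQ _ (PiTensorProduct.lift (loopMulti k H s)) <| by
    rw [sup_le_iff, LinearMap.range_le_ker_iff, LinearMap.range_le_ker_iff]
    constructor
    · ext v
      simp only [LinearMap.compMultilinearMap_apply, LinearMap.comp_apply, LinearMap.sub_apply,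
        LinearEquiv.coe_coe, LinearMap.id_apply, map_sub, LinearMap.zero_apply, sub_eq_zero]
      rw [rot, PiTensorProduct.reindex_tprod, PiTensorProduct.lift.tprod,
        PiTensorProduct.lift.tprod]
      exact loopClass_rotate k v
    · ext v
      simp only [LinearMap.compMultilinearMap_apply, LinearMap.comp_apply, LinearMap.sub_apply,
        LinearMap.id_apply, map_sub, LinearMap.zero_apply, sub_eq_zero]
      rw [rev, LinearMap.smul_apply, LinearEquiv.coe_coe, PiTensorProduct.reindex_tprod, map_smul,
        PiTensorProduct.lift.tprod, PiTensorProduct.lift.tprod]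
      exact (loopClass_reverse k v).symm

theorem omegaLoop_mk (s : ℕ) (v : Fin s → H) :
    omegaLoop k H s (Submodule.mkQ _ (PiTensorProduct.tprod k v)) = loopClass k v :=
  (Submodule.liftQ_apply _ _ _).trans (PiTensorProduct.lift.tprod _)

theorem omegaLoop_surjective (s : ℕ) : Function.Surjective (omegaLoop k H s) := by
  intro x
  obtain ⟨⟨x, hx⟩, rfl⟩ := Submodule.mkQ_surjective _ x
  obtain ⟨y, hy, z, hz, rfl⟩ := Submodule.mem_sup.1 (PreC₁Part_one_le k s hx)
  have hspan : attachSpan k (.of (.tail 0)) (.of (.head 0)) s ≤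
      ((LinearMap.range (omegaLoop k H s)).comap (Submodule.mkQ _)).map
        (PreC₁Part k H s 1).subtype := by
    refine Submodule.span_le.2 ?_
    rintro _ ⟨l, rfl, rfl⟩
    exact ⟨⟨gr k (loopTree l.get), loopTree_mem l.get⟩, ⟨_, omegaLoop_mk k _ l.get⟩,
      congrArg (loopGr k) (List.ofFn_get l)⟩
  obtain ⟨y, ⟨w, hw⟩, rfl⟩ := hspan hy
  refine ⟨w, hw.trans ?_⟩
  rw [eq_comm, ← sub_eq_zero, ← map_sub]
  refine (Submodule.Quotient.mk_eq_zero _).2 (Submodule.mem_sup_left ?_)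
  change (y : PreGraph k H) + z - y ∈ _
  rwa [add_sub_cancel_left]

theorem omegaTrace_comp_omegaLoop {s : ℕ} (hs : 2 ≤ s) :
    omegaTrace k H s hs ∘ₗ omegaLoop k H s = LinearMap.id := by
  refine Submodule.linearMap_qext _ (PiTensorProduct.ext (MultilinearMap.ext fun v => ?_))
  exact (congrArg _ (omegaLoop_mk k s v)).trans (omegaTrace_loopClass k hs v)

theorem omegaLoop_comp_omegaTrace {s : ℕ} (hs : 2 ≤ s) :
    omegaLoop k H s ∘ₗ omegaTrace k H s hs = LinearMap.id := by
  rw [← LinearMap.cancel_right (omegaLoop_surjective k s), LinearMap.comp_assoc,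
    omegaTrace_comp_omegaLoop, LinearMap.comp_id, LinearMap.id_comp]

variable (H) in
/-- The isomorphism `Ω_{s,1}(H) ≅ [H^{⊗s}]_{D_{2s}}`. -/
def omegaEquiv {s : ℕ} (hs : 2 ≤ s) : OmegaPart k H s 1 ≃ₗ[k] DihCoinv k H s :=
  .ofLinearMap (omegaTrace k H s hs) (omegaLoop k H s) (omegaTrace_comp_omegaLoop k hs)
    (omegaLoop_comp_omegaTrace k hs)

end Loops

/-! ### The part of rank one of `Tr^C` -/

section RankOne

variable (k : Type u) [Field k] {H : Type v} [AddCommGroup H] [Module k H]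

theorem numEdges_replace {t : UTree (Leaf H)} {p q : H × UTree (Leaf H)}
    (hp : p ∈ replace (.tail 0) (relabel (Leaf.rename Nat.succ) t))
    (hq : q ∈ replace (.head 0) p.2) : numEdges (leaves q.2) = numEdges (leaves t) + 1 := by
  obtain ⟨l, ht, hp_leaves⟩ := replace_perm _ _ p hp
  obtain ⟨l', hp_leaves', hq_leaves⟩ := replace_perm _ _ q hq
  calc numEdges (leaves q.2)
    _ = numEdges (.head 0 :: l') := numEdges_perm hq_leaves
    _ = numEdges (.hair q.1 :: l') := rfl
    _ = numEdges (.tail 0 :: l) := numEdges_perm (hp_leaves'.symm.trans hp_leaves)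
    _ = numEdges (.hair p.1 :: l) + 1 := rfl
    _ = numEdges (leaves t) + 1 := by rw [← numEdges_perm ht, numEdges_relabel_rename]

theorem map_addEdge_gr_eq_zero {M : Type*} [AddCommGroup M] [Module k M]
    (f : PreGraph k H →ₗ[k] M) (ω : LinearMap.BilinForm k H) {t : UTree (Leaf H)}
    (hf : ∀ w : UTree (Leaf H), numEdges (leaves w) = numEdges (leaves t) + 1 →
      numHairs (leaves w) + 2 = numHairs (leaves t) → f (gr k w) = 0) :
    f (addEdge ω (gr k t)) = 0 := by
  rw [addEdge_gr, map_smul, map_list_sum, List.map_map, List.sum_eq_zero, smul_zero]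
  refine List.forall_mem_map.2 fun p hp => ?_
  rw [Function.comp_apply, map_list_sum, List.map_map, List.sum_eq_zero]
  refine List.forall_mem_map.2 fun q hq => ?_
  rw [Function.comp_apply, map_smul,
    hf q.2 (numEdges_replace hp hq) (replace_replace t p q hp hq).1, smul_zero]

theorem prePart_zero_addEdge (ω : LinearMap.BilinForm k H) (s : ℕ) (x : PreGraph k H) :
    prePart k H s 0 (addEdge ω x) = 0 := by
  suffices h : prePart k H s 0 ∘ₗ addEdge ω = 0 from LinearMap.congr_fun h x
  refine treeSpace_ext k Leaf.hair fun t =>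
    map_addEdge_gr_eq_zero k (prePart k H s 0) ω fun w hedges _ => ?_
  rw [prePart_gr, if_neg (by omega)]

theorem prePart_succ_addEdge (ω : LinearMap.BilinForm k H) (s r : ℕ) (x : PreGraph k H) :
    prePart k H s (r + 1) (addEdge ω x) = addEdge ω (prePart k H (s + 2) r x) := by
  suffices h : prePart k H s (r + 1) ∘ₗ addEdge ω = addEdge ω ∘ₗ prePart k H (s + 2) r from
    LinearMap.congr_fun h x
  refine treeSpace_ext k Leaf.hair fun t => ?_
  change prePart k H s (r + 1) (addEdge ω (gr k t)) = addEdge ω (prePart k H (s + 2) r (gr k t))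
  rw [prePart_gr]
  split_ifs with ht
  · refine sub_eq_zero.1 (map_addEdge_gr_eq_zero k (prePart k H s (r + 1) - LinearMap.id) ω
      fun w hedges hhairs => ?_)
    rw [LinearMap.sub_apply, prePart_gr, if_pos (by omega), LinearMap.id_apply, sub_self]
  · rw [map_zero]
    refine map_addEdge_gr_eq_zero k _ ω fun w hedges hhairs => ?_
    rw [prePart_gr, if_neg (by omega)]

theorem prePart_one_expAddEdge_inclT (ω : LinearMap.BilinForm k H) (s : ℕ) (t : T k H) :
    prePart k H s 1 (expAddEdge ω (inclT k H t)) =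
      addEdge ω (prePart k H (s + 2) 0 (inclT k H t)) := by
  have hsum : prePart k H s 1 (expAddEdge ω (inclT k H t)) = ∑ᶠ n : ℕ, prePart k H s 1
      ((n.factorial : k)⁻¹ • (addEdge ω ^ n) (inclT k H t)) :=
    (prePart k H s 1).toAddMonoidHom.map_finsum (finite_support_exp ω _)
  rw [hsum, finsum_eq_single _ 1]
  · rw [Nat.factorial_one, Nat.cast_one, inv_one, one_smul, pow_one, prePart_succ_addEdge]
  · rintro (_ | _ | n) hn
    · have hzero : prePart k H s 1 (inclT k H t) = 0 :=
        LinearMap.congr_fun (prePart_inclT s 1 le_rfl) t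
      rw [map_smul, pow_zero, Module.End.one_apply, hzero, smul_zero]
    · exact absurd rfl hn
    · rw [map_smul, pow_succ', Module.End.mul_apply, prePart_succ_addEdge, pow_succ',
        Module.End.mul_apply, prePart_zero_addEdge, map_zero, smul_zero]

theorem prePart_zero_inclT {s : ℕ} {t : T k H} (ht : t ∈ TDeg k H s) :
    prePart k H (s + 2) 0 (inclT k H t) = inclT k H t := by
  refine (Submodule.span_le (p := LinearMap.eqLocus (prePart k H (s + 2) 0 ∘ₗ inclT k H)
    (inclT k H))).2 ?_ ht
  rintro _ ⟨t, rfl, rfl⟩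
  rw [SetLike.mem_coe, LinearMap.mem_eqLocus, LinearMap.comp_apply, inclT_mk, prePart_gr, if_pos]
  constructor
  · rw [numEdges, tails_hair, List.length_nil]
  · rw [leaves_relabel, numHairs_map_hair, leaves, List.length_append, leavesR_length,
      leavesR_length, trivalent]
    omega

end RankOne

/-! ### The trace formula -/

section HairSum

variable (k : Type u) [Field k] {H : Type v} [AddCommGroup H] [Module k H]

omit [AddCommGroup H] in
theorem map_hairSum {M N : Type*} [AddCommGroup M] [AddCommGroup N] (g : M →+ N)
    (ℓ : Leaf H) (a : FreeMagma (Leaf H)) (f : H → FreeMagma (Leaf H) → M) :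
    g (hairSum ℓ a f) = hairSum ℓ a fun v c => g (f v c) := by
  rw [hairSum, map_list_sum, List.map_map]
  rfl

theorem hairSum_map_hair (ℓ : Leaf H) (a b : FreeMagma H) :
    hairSum ℓ (FreeMagma.map Leaf.hair a) (fun v c => v ⊗ₜ[k] gr k (c, FreeMagma.map Leaf.hair b)) =
      ((rootingsR a b).map fun q => q.1 ⊗ₜ[k] gr k (.of ℓ, FreeMagma.map Leaf.hair q.2)).sum := by
  induction a generalizing b with
  | ih1 v => simp [hairSum, replaceR]
  | ih2 a₁ a₂ ih₁ ih₂ =>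
    have hleft (c : FreeMagma (Leaf H)) :
        gr k (c * FreeMagma.map Leaf.hair a₂, FreeMagma.map Leaf.hair b) =
          gr k (c, FreeMagma.map Leaf.hair (a₂ * b)) := by
      rw [gr_move, map_mul]
    have hright (c : FreeMagma (Leaf H)) :
        gr k (FreeMagma.map Leaf.hair a₁ * c, FreeMagma.map Leaf.hair b) =
          gr k (c, FreeMagma.map Leaf.hair (b * a₁)) := by
      rw [map_mul]
      exact treeMk_rotate k _ _ _ _
    rw [map_mul, hairSum_mul, rootingsR_mul, List.map_append, List.sum_append, ← ih₁, ← ih₂]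
    simp only [hleft, hright]

theorem detach_gr_eq_hairSum (ℓ : Leaf H) (a b : FreeMagma (Leaf H)) : detach k ℓ (gr k (a, b)) =
    hairSum ℓ a (fun v c => v ⊗ₜ[k] gr k (c, b)) + hairSum ℓ b (fun v c => v ⊗ₜ[k] gr k (a, c)) :=
  (detach_gr ℓ (a, b)).trans (detachTree_eq ℓ a b)

theorem detach_relabel_hair (ℓ : Leaf H) (t : UTree H) :
    detach k ℓ (gr k (relabel Leaf.hair t)) =
      ((rootings t).map fun q => q.1 ⊗ₜ[k] gr k (.of ℓ, FreeMagma.map Leaf.hair q.2)).sum := by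
  have hflip : ∀ c, gr k (FreeMagma.map Leaf.hair t.1, c) =
      gr k (c, FreeMagma.map Leaf.hair t.1) := gr_flip _
  rw [relabel, detach_gr_eq_hairSum, hairSum_map_hair]
  simp only [hflip]
  rw [hairSum_map_hair, ← List.sum_append, ← List.map_append, rootings]

theorem detach_root {z : Leaf H} (hz : z.hair? = none) (ℓ : Leaf H) (c : FreeMagma (Leaf H)) :
    detach k ℓ (gr k (.of z, c)) = hairSum ℓ c fun v d => v ⊗ₜ[k] gr k (.of z, d) := by
  rw [detach_gr_eq_hairSum]
  cases z with
  | hair v => cases hz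
  | _ => exact zero_add _

theorem firstLetter_leafIndicator_map_hair {e : Leaf H} (he : e.hair? = none) (a : FreeMagma H) :
    firstLetter (hairWord k) (leafIndicator k e) (FreeMagma.map Leaf.hair a) = 0 := by
  rw [firstLetter_map]
  exact firstLetter_eq_zero _ a fun v _ => leafIndicator_hair k he v

theorem hairSum_firstLetter (φ : H → k) {e : Leaf H} (he : e.hair? = none) (a : FreeMagma H) :
    hairSum e (FreeMagma.map Leaf.hair a)
        (fun v c => φ v • firstLetter (hairWord k) (leafIndicator k e) c) =
      firstLetter (TensorAlgebra.ι k) φ a := by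
  induction a with
  | ih1 v => simp [hairSum, replaceR, Algebra.algebraMap_eq_smul_one]
  | ih2 a b ha hb =>
    have hcomm (a : FreeMagma H) :
        comm (hairWord k) (FreeMagma.map Leaf.hair a) = comm (TensorAlgebra.ι k) a :=
      comm_map _ _ a
    have hleft (v : H) (c : FreeMagma (Leaf H)) :
        φ v • firstLetter (hairWord k) (leafIndicator k e) (c * FreeMagma.map Leaf.hair b) =
          (φ v • firstLetter (hairWord k) (leafIndicator k e) c) * comm (TensorAlgebra.ι k) b := by
      rw [firstLetter_mul, firstLetter_leafIndicator_map_hair k he, zero_mul, sub_zero, hcomm,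
        smul_mul_assoc]
    have hright (v : H) (c : FreeMagma (Leaf H)) :
        φ v • firstLetter (hairWord k) (leafIndicator k e) (FreeMagma.map Leaf.hair a * c) =
          -((φ v • firstLetter (hairWord k) (leafIndicator k e) c) *
            comm (TensorAlgebra.ι k) a) := by
      rw [firstLetter_mul, firstLetter_leafIndicator_map_hair k he, zero_mul, zero_sub, hcomm,
        smul_neg, smul_mul_assoc]
    rw [map_mul, hairSum_mul, firstLetter_mul, ← ha, ← hb, sub_eq_add_neg]
    simp only [hleft, hright]
    exact congrArg₂ (· + ·)
      (map_hairSum (AddMonoidHom.mulRight (comm (TensorAlgebra.ι k) b)) e _ _).symm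
      (map_hairSum (-AddMonoidHom.mulRight (comm (TensorAlgebra.ι k) a)) e _ _).symm

end HairSum

section TraceFormula

variable (k : Type u) [Field k] {H : Type v} [AddCommGroup H] [Module k H]

variable {k} in
/-- The contraction of the first two factors of `H ⊗ H ⊗ PreGraph` with `ω`. -/
def contractLabels (ω : LinearMap.BilinForm k H) :
    H ⊗[k] (H ⊗[k] PreGraph k H) →ₗ[k] PreGraph k H :=
  (TensorProduct.lid k (PreGraph k H)).toLinearMap ∘ₗ
    (TensorProduct.lift ω).rTensor (PreGraph k H) ∘ₗ
    (TensorProduct.assoc k H H (PreGraph k H)).symm.toLinearMap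

theorem contractLabels_tmul (ω : LinearMap.BilinForm k H) (v w : H) (x : PreGraph k H) :
    contractLabels ω (v ⊗ₜ (w ⊗ₜ x)) = ω v w • x := by
  simp [contractLabels]

theorem addEdge_eq_contractLabels (ω : LinearMap.BilinForm k H) (x : PreGraph k H) :
    addEdge ω x = (2⁻¹ : k) •
      contractLabels ω ((detach k (.head 0)).lTensor H (detach k (.tail 0) (shift k H x))) := rfl

theorem leavesR_map {X Y : Type v} (f : X → Y) (a : FreeMagma X) :
    leavesR (FreeMagma.map f a) = (leavesR a).map f := by
  induction a with
  | ih1 x => rfl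
  | ih2 a b ha hb => simp [ha, hb]

theorem loopTrace_gr_of_mem_replaceR (s : ℕ) {c : FreeMagma H} {p : H × FreeMagma (Leaf H)}
    (hp : p ∈ replaceR (.head 0) (FreeMagma.map Leaf.hair c)) :
    loopTrace k H s (gr k (.of (.tail 0), p.2)) =
      dih k H s (firstLetter (hairWord k) (leafIndicator k (.head 0)) p.2) := by
  obtain ⟨l, hc, hp_leaves⟩ := replaceR_perm _ _ p hp
  obtain ⟨hs, rfl⟩ : ∃ hs : List H, l = hs.map Leaf.hair := by
    refine exists_eq_map_hair fun x hx => ?_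
    rw [leavesR_map] at hc
    obtain ⟨w, -, rfl⟩ := List.mem_map.1 (hc.symm.subset (List.mem_cons_of_mem _ hx))
    exact ⟨w, rfl⟩
  exact (loopTrace_root k s (z := .tail 0) rfl hp_leaves).trans (one_smul k _)

theorem loopTrace_contractLabels (ω : LinearMap.BilinForm k H) (s : ℕ) (v : H) (c : FreeMagma H) :
    loopTrace k H s (contractLabels ω (v ⊗ₜ detach k (.head 0)
      (gr k (.of (.tail 0), FreeMagma.map Leaf.hair c)))) =
      dih k H s (firstLetter (TensorAlgebra.ι k) (ω v) c) := by
  let contractWith := loopTrace k H s ∘ₗ contractLabels ω ∘ₗ TensorProduct.mk k H _ v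
  rw [detach_root k rfl, ← hairSum_firstLetter k (ω v) (e := .head 0) rfl]
  refine (map_hairSum contractWith.toAddMonoidHom _ _ _).trans ?_
  refine .trans ?_ (map_hairSum (dih k H s).toAddMonoidHom _ _ _).symm
  refine congrArg List.sum (List.map_congr_left fun p hp => ?_)
  change loopTrace k H s (contractLabels ω (v ⊗ₜ (p.1 ⊗ₜ gr k (.of (.tail 0), p.2)))) =
    dih k H s (ω v p.1 • firstLetter (hairWord k) (leafIndicator k (.head 0)) p.2)
  rw [contractLabels_tmul, map_smul, map_smul, loopTrace_gr_of_mem_replaceR k s hp]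

theorem shift_relabel_hair (t : UTree H) :
    shift k H (gr k (relabel Leaf.hair t)) = gr k (relabel Leaf.hair t) := by
  have hmap (a : FreeMagma H) : FreeMagma.map (Leaf.rename Nat.succ) (FreeMagma.map Leaf.hair a) =
      FreeMagma.map (Leaf.hair : H → Leaf H) a :=
    DFunLike.congr_fun (FreeMagma.hom_ext (f := (FreeMagma.map (Leaf.rename Nat.succ)).comp
      (FreeMagma.map Leaf.hair)) (g := FreeMagma.map Leaf.hair) rfl) a
  rw [shift_gr, relabel, relabel, hmap, hmap]

theorem loopTrace_addEdge (ω : LinearMap.BilinForm k H) (s : ℕ) (t : UTree H) :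
    loopTrace k H s (addEdge ω (gr k (relabel Leaf.hair t))) =
      (2⁻¹ : k) • dih k H s (algTrace (TensorAlgebra.ι k) (fun x y => ω x y) t) := by
  let contractDetached := loopTrace k H s ∘ₗ contractLabels ω ∘ₗ (detach k (.head 0)).lTensor H
  rw [addEdge_eq_contractLabels, shift_relabel_hair, detach_relabel_hair, map_smul]
  refine congrArg _ ((map_list_sum contractDetached _).trans ?_)
  rw [algTrace, map_list_sum, List.map_map, List.map_map]
  exact congrArg List.sum (List.map_congr_left fun q _ => loopTrace_contractLabels k ω s q.1 q.2)

theorem loopTrace_addEdge_inclT (ω : LinearMap.BilinForm k H) (s : ℕ) (t : T k H) :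
    loopTrace k H s (addEdge ω (inclT k H t)) =
      (2⁻¹ : k) • cycToDih k H s (trTree k ω s t) := by
  suffices h : loopTrace k H s ∘ₗ addEdge ω ∘ₗ inclT k H =
      (2⁻¹ : k) • (cycToDih k H s ∘ₗ trTree k ω s) from LinearMap.congr_fun h t
  refine treeSpace_ext k id fun t => ?_
  rw [LinearMap.comp_apply, LinearMap.comp_apply, inclT_mk, loopTrace_addEdge,
    LinearMap.smul_apply, LinearMap.comp_apply, trTree_mk, cycToDih_cyc]

theorem omegaTrace_trC (ω : LinearMap.BilinForm k H) {s : ℕ} (hs : 2 ≤ s) (t : TDeg k H s) :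
    omegaTrace k H s hs (projOmega k H s 1 le_rfl (trC ω t)) =
      (1 / 2 : k) • cycToDih k H s (trES ω s (eta k H s t)) := by
  have hproj : omegaTrace k H s hs (projOmega k H s 1 le_rfl (trC ω t)) =
      loopTrace k H s (prePart k H s 1 (expAddEdge ω (inclT k H t))) :=
    omegaTrace_mk k hs ⟨_, prePart_mem s 1 _ (trCKV ω t).2⟩
  rw [hproj, prePart_one_expAddEdge_inclT, prePart_zero_inclT k t.2, loopTrace_addEdge_inclT,
    trES_eta, one_div]

end TraceFormula

end Johnson

end

theorem mainTheorem5_general {k : Type*} {H : Type*} [Field k] [CharZero k] [AddCommGroup H]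
    [Module k H] (ω : LinearMap.BilinForm k H) (hω : ω.IsAlt) :
    (∀ s : ℕ,
      (∀ d : D k H s, revCyc k H s (trES ω s d) = trES ω s d) ∧
      Function.Bijective ((cycToDih k H s).domRestrict
        (LinearMap.ker (revCyc k H s - LinearMap.id)))) ∧
    (∀ s : ℕ, Function.Bijective (eta k H s)) ∧
    (∀ s : ℕ, 2 ≤ s → ∃ Φ : OmegaPart k H s 1 ≃ₗ[k] DihCoinv k H s,
      (∀ v : Fin s → H, Φ (loopClass k v) = Submodule.mkQ _ (PiTensorProduct.tprod k v)) ∧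
      ∀ t : TDeg k H s, Φ (projOmega k H s 1 le_rfl (trC ω t)) =
        (1 / 2 : k) • cycToDih k H s (trES ω s (eta k H s t))) :=
  ⟨fun s => ⟨revCyc_trES k ω hω s, cycToDih_bijective k s⟩, eta_bijective k H, fun _ hs =>
    ⟨omegaEquiv k H hs, omegaTrace_loopClass k hs, omegaTrace_trC k ω hs⟩⟩

theorem mainTheorem5 {k : Type*} {H : Type*} [Field k] [CharZero k] [AddCommGroup H] [Module k H]
    [FiniteDimensional k H] (ω : LinearMap.BilinForm k H) (hω : ω.IsAlt) (hnd : ω.Nondegenerate) :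
    (∀ s : ℕ,
      (∀ d : D k H s, revCyc k H s (trES ω s d) = trES ω s d) ∧
      Function.Bijective ((cycToDih k H s).domRestrict
        (LinearMap.ker (revCyc k H s - LinearMap.id)))) ∧
    (∀ s : ℕ, Function.Bijective (eta k H s)) ∧
    (∀ s : ℕ, 2 ≤ s → ∃ Φ : OmegaPart k H s 1 ≃ₗ[k] DihCoinv k H s,
      (∀ v : Fin s → H, Φ (loopClass k v) = Submodule.mkQ _ (PiTensorProduct.tprod k v)) ∧
      ∀ t : TDeg k H s, Φ (projOmega k H s 1 le_rfl (trC ω t)) =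
        (1 / 2 : k) • cycToDih k H s (trES ω s (eta k H s t))) :=
  mainTheorem5_general ω hω
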